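/- For a family $\mathcal H$ of graphs, Mutually Induced $\mathcal H$-Packing asks, given a finite simple graph $G$, for a set $S\subseteq V(G)$ of maximum cardinality such that $G[S]$ is a disjoint union of graphs each isomorphic to a member of $\mathcal H$. For a positive integer $n$, let $D_n$ be the decorated path obtained from the $n$-vertex path by adding, for each of its two ends $u$, two new adjacent vertices $u',u''$, both adjacent to $u$ (so $D_n$ has $n+4$ vertices; for $n=1$ both ends are the same vertex, and $D_1$ consists of two triangles sharing one vertex). Let $\mathcal H=\{D_n : n\geq 1\}$. A trigraph has disjoint sets of black and red edges; contracting two vertices $u,v$ replaces them by one vertex $w$, where for every other vertex $z$ the pair $wz$ is a black edge if $uz$ and $vz$ are both black, a non-edge if $uz$ and $vz$ are both non-edges, and a red edge otherwise. A $4$-sequence of a graph $G$ is a sequence of contractions leading from $G$ (without red edges) to a one-vertex trigraph, such that every trigraph in the sequence has maximum red degree at most $4$. An $r(n)$-approximation algorithm for a maximization problem is one that, on every instance whose graph has $n$ vertices, outputs a feasible solution of value at least the optimum divided by $r(n)$. Theorem. Suppose that for every real $\varepsilon>0$ there is a polynomial-time $n^{\varepsilon}$-approximation algorithm for Mutually Induced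 $\mathcal H$-Packing on $n$-vertex graphs given together with a $4$-sequence. Then for every real $\varepsilon>0$ there is a polynomial-time $n^{\varepsilon}$-approximation algorithm for Longest Path (find a path with the maximum number of edges) on arbitrary nonempty finite simple $n$-vertex graphs. -/

import Mathlib

/-! ### Programs on binary trees, with a step count -/

/-- The data of the machine model: unlabelled binary trees (LISP-style nested pairs). -/
abbrev Data : Type := BinaryTree Unit

/-- The pair of two data items. -/
def Data.pair (a b : Data) : Data := BinaryTree.node () a b

/-- Programs of the "pure LISP" / WHILE language on binary trees, in one-variable form: every
program maps the current datum to a new one. -/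
inductive Prog : Type
  /-- return the current datum -/
  | id : Prog
  /-- return the empty tree -/
  | nil : Prog
  /-- return the left component of the current datum -/
  | fst : Prog
  /-- return the right component of the current datum -/
  | snd : Prog
  /-- run both programs on the current datum and pair the results -/
  | pair (p q : Prog) : Prog
  /-- run the first program, then the second one on its result -/
  | seq (p q : Prog) : Prog
  /-- if `c` returns a nonempty tree on the current datum then run `p` on it, else run `q` -/
  | ite (c p q : Prog) : Prog
  /-- as long as `c` returns a nonempty tree on the current datum, replace the datum by the
  result of `p` on it -/
  | loop (c p : Prog) : Prog

/-- `Runs p x y t`: on the datum `x`, the program `p` halts with result `y` after exactly `t`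
elementary steps. Each elementary operation has unit cost: a pointer machine stores trees with
shared subtrees, so none of the operations copies anything. With this (standard) cost measure,
polynomial time is the same as polynomial time on Turing machines. -/
inductive Runs : Prog → Data → Data → ℕ → Prop
  | id (x : Data) : Runs Prog.id x x 1
  | nil (x : Data) : Runs Prog.nil x BinaryTree.nil 1
  | fst (x : Data) : Runs Prog.fst x x.left 1
  | snd (x : Data) : Runs Prog.snd x x.right 1
  | pair {p q : Prog} {x y z : Data} {s t : ℕ} :
      Runs p x y s → Runs q x z t → Runs (Prog.pair p q) x (Data.pair y z) (s + t + 1)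
  | seq {p q : Prog} {x y z : Data} {s t : ℕ} :
      Runs p x y s → Runs q y z t → Runs (Prog.seq p q) x z (s + t + 1)
  | ite_true {c p q : Prog} {x b y : Data} {s t : ℕ} :
      Runs c x b s → b ≠ BinaryTree.nil → Runs p x y t → Runs (Prog.ite c p q) x y (s + t + 1)
  | ite_false {c p q : Prog} {x y : Data} {s t : ℕ} :
      Runs c x BinaryTree.nil s → Runs q x y t → Runs (Prog.ite c p q) x y (s + t + 1)
  | loop_stop {c p : Prog} {x : Data} {s : ℕ} :
      Runs c x BinaryTree.nil s → Runs (Prog.loop c p) x x (s + 1)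
  | loop_step {c p : Prog} {x b y z : Data} {s t u : ℕ} :
      Runs c x b s → b ≠ BinaryTree.nil → Runs p x y t → Runs (Prog.loop c p) y z u →
      Runs (Prog.loop c p) x z (s + t + u + 1)

/-! ### Encodings -/

/-- Lists of data as right-nested pairs. -/
def encList : List Data → Data
  | [] => BinaryTree.nil
  | a :: l => Data.pair a (encList l)

/-- Natural numbers in unary. -/
def encNat (n : ℕ) : Data := encList (List.replicate n BinaryTree.nil)

open Classical in
/-- Truth values: the empty tree is `false`, the one-node tree is `true`. -/
noncomputable def encBit (P : Prop) : Data :=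
  if P then Data.pair BinaryTree.nil BinaryTree.nil else BinaryTree.nil

/-- A graph on `{0, …, n - 1}` is given by its adjacency matrix. -/
noncomputable def encGraph {n : ℕ} (G : SimpleGraph (Fin n)) : Data :=
  encList (List.ofFn fun i => encList (List.ofFn fun j => encBit (G.Adj i j)))

/-- A set of vertices is given by its characteristic vector. -/
noncomputable def encVertexSet {n : ℕ} (S : Finset (Fin n)) : Data :=
  encList (List.ofFn fun i => encBit (i ∈ S))

/-- A list of vertices is given by the list of their numbers. -/
def encVertexList {n : ℕ} (l : List (Fin n)) : Data :=
  encList (l.map fun v => encNat v)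

/-- A list of pairs of vertices. -/
def encPairList {n : ℕ} (l : List (Fin n × Fin n)) : Data :=
  encList (l.map fun e => Data.pair (encNat e.1) (encNat e.2))

/-! ### Maximization problems on graphs and polynomial-time approximation -/

/-- A maximization problem on (finite, simple) graphs. -/
structure MaxProblem where
  /-- the instances -/
  Inst : Type
  /-- the encoding of an instance as an input of a program -/
  encInst : Inst → Data
  /-- the number of vertices of the graph of an instance -/
  order : Inst → ℕ
  /-- the candidate solutions of an instance -/
  Sol : Inst → Type
  /-- the encoding of a candidate solution as an output of a program -/
  encSol : ∀ x, Sol x → Data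
  /-- the feasible solutions -/
  Feasible : ∀ x, Sol x → Prop
  /-- the objective value, which is to be maximized -/
  value : ∀ x, Sol x → ℕ

/-- The problem has a polynomial-time `r(n)`-approximation algorithm, where `n` is the number of
vertices: a program that on every instance halts after a number of steps polynomial in the size of
the input, with a feasible solution whose value is at least the optimum divided by `r(n)`. -/
def MaxProblem.HasPolyTimeApprox (Q : MaxProblem) (r : ℕ → ℝ) : Prop :=
  ∃ (p : Prog) (T : Polynomial ℕ), ∀ x : Q.Inst, ∃ (y : Q.Sol x) (t : ℕ),
    Runs p (Q.encInst x) (Q.encSol x y) t ∧ t ≤ T.eval (Q.encInst x).numNodes ∧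
    Q.Feasible x y ∧
    ∀ z : Q.Sol x, Q.Feasible x z → (Q.value x z : ℝ) ≤ r (Q.order x) * (Q.value x y : ℝ)

/-! ### Trigraphs and contraction sequences -/

/-- Trigraphs whose vertex set `verts` is a subset of `V`: disjoint sets of black and red edges. -/
structure Trigraph (V : Type) where
  verts : Set V
  black : SimpleGraph V
  red : SimpleGraph V
  black_mem : ∀ {x y}, black.Adj x y → x ∈ verts
  red_mem : ∀ {x y}, red.Adj x y → x ∈ verts
  disj : ∀ {x y}, black.Adj x y → ¬ red.Adj x y

namespace Trigraph

variable {V : Type}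

/-- A graph, as a trigraph without red edges. -/
def ofGraph (G : SimpleGraph V) : Trigraph V where
  verts := Set.univ
  black := G
  red := ⊥
  black_mem := fun _ => Set.mem_univ _
  red_mem := fun _ => Set.mem_univ _
  disj := fun _ h => h

/-- `x` and `y` are linked by a black or a red edge. -/
def Linked (T : Trigraph V) (x y : V) : Prop := T.black.Adj x y ∨ T.red.Adj x y

/-- The vertex that `u` and `v` are contracted into has a black edge to `z`. -/
def MergeBlack (T : Trigraph V) (u v z : V) : Prop := T.black.Adj u z ∧ T.black.Adj v z

/-- The vertex that `u` and `v` are contracted into has a red edge to `z`: it is neither the case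
that `uz` and `vz` are both black, nor that both are non-edges. -/
def MergeRed (T : Trigraph V) (u v z : V) : Prop :=
  ¬ T.MergeBlack u v z ∧ ¬ (¬ T.Linked u z ∧ ¬ T.Linked v z)

/-- The contraction of two distinct vertices `u` and `v` of a trigraph. The new vertex is again
called `u`; the name `v` disappears. -/
def contract (T : Trigraph V) (u v : V) (hu : u ∈ T.verts) (huv : u ≠ v) : Trigraph V where
  verts := T.verts \ {v}
  black :=
    { Adj := fun x y => x ≠ v ∧ y ≠ v ∧ x ≠ y ∧
        ((x = u ∧ T.MergeBlack u v y) ∨ (y = u ∧ T.MergeBlack u v x) ∨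
          (x ≠ u ∧ y ≠ u ∧ T.black.Adj x y))
      symm := ⟨fun x y h => by
        obtain ⟨h1, h2, h3, h4⟩ := h
        refine ⟨h2, h1, h3.symm, ?_⟩
        rcases h4 with h | h | ⟨a, b, h⟩
        · exact Or.inr (Or.inl h)
        · exact Or.inl h
        · exact Or.inr (Or.inr ⟨b, a, h.symm⟩)⟩
      loopless := ⟨fun x h => h.2.2.1 rfl⟩ }
  red :=
    { Adj := fun x y => x ≠ v ∧ y ≠ v ∧ x ≠ y ∧
        ((x = u ∧ T.MergeRed u v y) ∨ (y = u ∧ T.MergeRed u v x) ∨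
          (x ≠ u ∧ y ≠ u ∧ T.red.Adj x y))
      symm := ⟨fun x y h => by
        obtain ⟨h1, h2, h3, h4⟩ := h
        refine ⟨h2, h1, h3.symm, ?_⟩
        rcases h4 with h | h | ⟨a, b, h⟩
        · exact Or.inr (Or.inl h)
        · exact Or.inl h
        · exact Or.inr (Or.inr ⟨b, a, h.symm⟩)⟩
      loopless := ⟨fun x h => h.2.2.1 rfl⟩ }
  black_mem := by
    rintro x y ⟨h1, h2, h3, h4⟩
    refine ⟨?_, h1⟩
    rcases h4 with ⟨rfl, h⟩ | ⟨rfl, h⟩ | ⟨_, _, h⟩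
    · exact hu
    · exact T.black_mem h.1.symm
    · exact T.black_mem h
  red_mem := by
    rintro x y ⟨h1, h2, h3, h4⟩
    refine ⟨?_, h1⟩
    rcases h4 with ⟨rfl, h⟩ | ⟨rfl, h⟩ | ⟨_, _, h⟩
    · exact hu
    · by_contra hx
      exact h.2 ⟨fun hl => hx (hl.elim (fun k => T.black_mem k.symm) (fun k => T.red_mem k.symm)),
        fun hl => hx (hl.elim (fun k => T.black_mem k.symm) (fun k => T.red_mem k.symm))⟩
    · exact T.red_mem h
  disj := by
    rintro x y ⟨_, _, h3, h4⟩ ⟨_, _, _, h5⟩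
    rcases h4 with ⟨rfl, h⟩ | ⟨rfl, h⟩ | ⟨a, b, h⟩
    · rcases h5 with ⟨_, k⟩ | ⟨e, _⟩ | ⟨a, _⟩
      · exact k.1 h
      · exact h3 e.symm
      · exact a rfl
    · rcases h5 with ⟨e, _⟩ | ⟨_, k⟩ | ⟨_, b, _⟩
      · exact h3 e
      · exact k.1 h
      · exact b rfl
    · rcases h5 with ⟨e, _⟩ | ⟨e, _⟩ | ⟨_, _, k⟩
      · exact a e
      · exact b e
      · exact T.disj h k

/-- The red graph has maximum degree at most `d`. -/
def RedDegreeLE (T : Trigraph V) (d : ℕ) : Prop :=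
  ∀ x ∈ T.verts, (T.red.neighborSet x).encard ≤ d

/-- The list of pairs of vertices describes successive contractions that lead from `T` to a
one-vertex trigraph such that all the trigraphs on the way, including `T` and the last one, have
maximum red degree at most `d`. -/
def IsSequence (d : ℕ) : Trigraph V → List (V × V) → Prop
  | T, [] => T.RedDegreeLE d ∧ ∃ w, T.verts = {w}
  | T, e :: l => T.RedDegreeLE d ∧ ∃ (hu : e.1 ∈ T.verts) (_ : e.2 ∈ T.verts) (huv : e.1 ≠ e.2),
      IsSequence d (T.contract e.1 e.2 hu huv) l

end Trigraph

/-! ### Mutually Induced Packing -/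

/-- The induced subgraph `G[S]` is a disjoint union of graphs that are each isomorphic to a member
of the family `H`. -/
def IsMutuallyInducedPacking {V ι : Type} {W : ι → Type} (H : ∀ i, SimpleGraph (W i))
    (G : SimpleGraph V) (S : Finset V) : Prop :=
  ∃ C : Set (Set V), (S : Set V) = ⋃₀ C ∧
    (∀ A ∈ C, ∃ i, Nonempty (G.induce A ≃g H i)) ∧
    (∀ A ∈ C, ∀ B ∈ C, A ≠ B → Disjoint A B ∧ ∀ a ∈ A, ∀ b ∈ B, ¬ G.Adj a b)

/-- A graph given together with a `d`-sequence. -/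
structure GraphWithSequence (d : ℕ) where
  n : ℕ
  graph : SimpleGraph (Fin n)
  contractions : List (Fin n × Fin n)
  isSequence : (Trigraph.ofGraph graph).IsSequence d contractions

/-- Mutually Induced `H`-Packing on graphs given with a `d`-sequence: find a set `S` of vertices,
of maximum cardinality, such that `G[S]` is a disjoint union of copies of members of `H`. -/
noncomputable def mutuallyInducedPacking {ι : Type} {W : ι → Type} (H : ∀ i, SimpleGraph (W i))
    (d : ℕ) : MaxProblem where
  Inst := GraphWithSequence d
  encInst := fun x => Data.pair (encGraph x.graph) (encPairList x.contractions)
  order := fun x => x.n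
  Sol := fun x => Finset (Fin x.n)
  encSol := fun _ S => encVertexSet S
  Feasible := fun x S => IsMutuallyInducedPacking H x.graph S
  value := fun _ S => S.card

/-- Adjacency in the decorated path: `inl i` is the `i`-th vertex of the path on `n` vertices;
`inr (false, _)` are the two vertices added at its first vertex, and `inr (true, _)` the two
vertices added at its last vertex. -/
def decoratedPathAdj (n : ℕ) : Fin n ⊕ (Bool × Bool) → Fin n ⊕ (Bool × Bool) → Prop
  | .inl i, .inl j => (SimpleGraph.pathGraph n).Adj i j
  | .inl i, .inr (e, _) => (e = false ∧ (i : ℕ) = 0) ∨ (e = true ∧ (i : ℕ) + 1 = n)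
  | .inr (e, _), .inl i => (e = false ∧ (i : ℕ) = 0) ∨ (e = true ∧ (i : ℕ) + 1 = n)
  | .inr (e, b), .inr (e', b') => e = e' ∧ b ≠ b'

/-- The decorated path `D n`: a path on `n` vertices terminated by a triangle at each end. -/
def decoratedPath (n : ℕ) : SimpleGraph (Fin n ⊕ (Bool × Bool)) where
  Adj := decoratedPathAdj n
  symm := ⟨by
    rintro (i | ⟨e, b⟩) (j | ⟨e', b'⟩) h
    · exact SimpleGraph.Adj.symm (G := SimpleGraph.pathGraph n) h
    · exact h
    · exact h
    · exact ⟨h.1.symm, h.2.symm⟩⟩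
  loopless := ⟨by
    rintro (i | ⟨e, b⟩) h
    · exact SimpleGraph.irrefl (SimpleGraph.pathGraph n) h
    · exact h.2 rfl⟩

/-- The family of all decorated paths `D n`, for positive integers `n`. -/
def decoratedPaths (n : ℕ+) : SimpleGraph (Fin n ⊕ (Bool × Bool)) := decoratedPath n

/-! ### Longest Path -/

/-- A graph with at least one vertex. -/
structure NonemptyGraph where
  n : ℕ
  pos : 0 < n
  graph : SimpleGraph (Fin n)

/-- Longest Path on general graphs: find a path with as many edges as possible. A path is given
as the list of its vertices, in order. -/
noncomputable def longestPath : MaxProblem where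
  Inst := NonemptyGraph
  encInst := fun x => encGraph x.graph
  order := fun x => x.n
  Sol := fun x => Σ (u : Fin x.n) (v : Fin x.n), x.graph.Walk u v
  encSol := fun _ w => encVertexList w.2.2.support
  Feasible := fun _ w => w.2.2.IsPath
  value := fun _ w => w.2.2.length

/-!
The reduction replaces a graph `G` on `n` vertices, with two of its vertices `u ≠ v`, by the
following graph (`SubdivVertex.graph`): each edge becomes two long paths with `n` inner vertices
each, and triangles are attached at `u` and at `v`. The graph has no other triangles, whereas a
decorated path has two, so that a nonempty packing is a single induced decorated path, whose
triangles are the two attached ones (`isDecorated_of_packing`).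

A path of `G` with `L` edges from `u` to `v` becomes a decorated path with more than `L * (n + 1)`
vertices (`exists_packing_of_path`). Conversely, a decorated path contains with one inner vertex of
a long path all of that path, hence traces out a walk in `G`, from `u`; the walk is recovered
greedily, by moving on along edges whose long path is used, to vertices not visited before. By
connectedness the walk sees the whole decorated path, and since the latter has small degrees, a walk
with `k ≥ 1` edges accounts for at most `6 * k * (n + 1)` vertices (`IsDecorated.card_le`). Thus an
`N ^ δ`-approximation on the new graph, for all pairs `u ≠ v`, yields a path whose length is optimal
up to the factor `6 * N ^ δ`, where `N ≤ n ^ 5` is the order of the new graph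
(`length_le_of_ratio`). With `δ = ε / 10` this factor is at most `n ^ ε` for all but finitely many
graphs, and on these an optimal path is looked up in a table (`PolyTime.of_finite`).

A `4`-sequence has to be computed along with the new graph (`Trigraph.PathLayout.isSequence`). To
this end a spine of `n` isolated vertices is added. The long path of `(i, j)` moves along the spine
from position `i` to position `j` and then rests there, so that adjacent vertices have positions at
distance at most one. The vertices are contracted one by one into the spine vertices at their
positions: the long paths first, each from its beginning to its end, then the triangles, and then
the vertices of `G`. In the meantime the spine is a red path, where each spine vertex has red edges
in addition at most to the vertex of `G` with its number and to the next vertex to be contracted.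
Finally the spine itself is contracted from one end.

Polynomial running time is handled by the notion `PolyTime`, which is closed under composition,
bounded loops (`PolyTime.iterate`) and the usual operations on lists and unary numbers. The
reduction, the greedy walk and the choice of the longest walk are built from these operations.
-/

/-! ### Polynomial-time computable maps -/

theorem Polynomial.eval_nat_mono (T : Polynomial ℕ) {a b : ℕ} (h : a ≤ b) :
    T.eval a ≤ T.eval b := by
  simp only [Polynomial.eval_eq_sum, Polynomial.sum]
  gcongr

@[simp] theorem numNodes_pair (a b : Data) :
    (Data.pair a b).numNodes = a.numNodes + b.numNodes + 1 := rfl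

@[simp] theorem left_pair (a b : Data) : (Data.pair a b).left = a := rfl

theorem pair_ne_nil (a b : Data) : Data.pair a b ≠ BinaryTree.nil := by
  simp [Data.pair]

theorem numNodes_left_le (d : Data) : d.left.numNodes ≤ d.numNodes := by
  cases d with
  | nil => rfl
  | node v l r => exact Nat.le_succ_of_le (Nat.le_add_right _ _)

theorem numNodes_right_le (d : Data) : d.right.numNodes ≤ d.numNodes := by
  cases d with
  | nil => rfl
  | node v l r => exact Nat.le_succ_of_le (Nat.le_add_left _ _)

/-- For an index type `I`, whose elements are presented to programs by `e`, the map `g` is computed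
by a program that runs in polynomial time. As programs can build trees of exponential size by
sharing subtrees, polynomial size of the results is part of the notion: only this makes it closed
under composition. -/
def PolyTime {I : Type} (e g : I → Data) : Prop :=
  ∃ (p : Prog) (T : Polynomial ℕ), ∀ i, (∃ t, Runs p (e i) (g i) t ∧ t ≤ T.eval (e i).numNodes) ∧
    (g i).numNodes ≤ T.eval (e i).numNodes

namespace PolyTime

variable {I J : Type} {e g h : I → Data}

theorem numNodes_le (h : PolyTime e g) :
    ∃ T : Polynomial ℕ, ∀ i, (g i).numNodes ≤ T.eval (e i).numNodes := by
  obtain ⟨p, T, hp⟩ := h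
  exact ⟨T, fun i => (hp i).2⟩

theorem id (e : I → Data) : PolyTime e e :=
  ⟨Prog.id, Polynomial.X + 1, fun i => ⟨⟨1, Runs.id _, by simp⟩, by simp⟩⟩

theorem comp (h1 : PolyTime e g) (h2 : PolyTime g h) : PolyTime e h := by
  obtain ⟨p, S, hp⟩ := h1
  obtain ⟨q, T, hq⟩ := h2
  refine ⟨Prog.seq p q, S + T.comp S + 1, fun i => ?_⟩
  obtain ⟨⟨s, hs, hs'⟩, hS⟩ := hp i
  obtain ⟨⟨t, ht, ht'⟩, hT⟩ := hq i
  have := T.eval_nat_mono hS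
  refine ⟨⟨_, Runs.seq hs ht, ?_⟩, ?_⟩ <;> simp <;> omega

/-- A program for all the indices works for some of them, too. -/
theorem reindex (φ : J → I) (h : PolyTime e g) :
    PolyTime (fun j => e (φ j)) (fun j => g (φ j)) := by
  obtain ⟨p, T, hp⟩ := h
  exact ⟨p, T, fun j => hp (φ j)⟩

theorem congr (h1 : PolyTime e g) (h2 : ∀ i, g i = h i) : PolyTime e h := by
  rwa [← funext h2]

theorem pair (h1 : PolyTime e g) (h2 : PolyTime e h) :
    PolyTime e (fun i => Data.pair (g i) (h i)) := by
  obtain ⟨p, S, hp⟩ := h1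
  obtain ⟨q, T, hq⟩ := h2
  refine ⟨Prog.pair p q, S + T + 1, fun i => ?_⟩
  obtain ⟨⟨s, hs, hs'⟩, hS⟩ := hp i
  obtain ⟨⟨t, ht, ht'⟩, hT⟩ := hq i
  refine ⟨⟨_, Runs.pair hs ht, ?_⟩, ?_⟩ <;> simp <;> omega

theorem left (h : PolyTime e g) : PolyTime e (fun i => (g i).left) := by
  refine h.comp ⟨Prog.fst, Polynomial.X + 1, fun i => ⟨⟨1, Runs.fst _, by simp⟩, ?_⟩⟩
  simpa using (numNodes_left_le (g i)).trans (Nat.le_succ _)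

theorem right (h : PolyTime e g) : PolyTime e (fun i => (g i).right) := by
  refine h.comp ⟨Prog.snd, Polynomial.X + 1, fun i => ⟨⟨1, Runs.snd _, by simp⟩, ?_⟩⟩
  simpa using (numNodes_right_le (g i)).trans (Nat.le_succ _)

theorem fst (h1 : PolyTime e (fun i => Data.pair (g i) (h i))) : PolyTime e g := h1.left

theorem snd (h1 : PolyTime e (fun i => Data.pair (g i) (h i))) : PolyTime e h := h1.right

theorem const (e : I → Data) (d : Data) : PolyTime e (fun _ => d) := by
  induction d with
  | nil => exact ⟨Prog.nil, 1, fun i => ⟨⟨1, Runs.nil _, by simp⟩, by simp⟩⟩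
  | node v l r hl hr => exact hl.pair hr

theorem encBit_true {P : Prop} (h : P) : encBit P = Data.pair BinaryTree.nil BinaryTree.nil := by
  simp [encBit, h]

theorem encBit_false {P : Prop} (h : ¬ P) : encBit P = BinaryTree.nil := by
  simp [encBit, h]

theorem encBit_ne_nil {P : Prop} : encBit P ≠ BinaryTree.nil ↔ P := by
  by_cases h : P <;> simp [encBit, h, Data.pair]

/-- Case distinction, where each branch has to run on the indices of its case only. -/
theorem cases_on {P : I → Prop} {c : I → Data} (hc : PolyTime e c)
    (hcP : ∀ i, c i ≠ BinaryTree.nil ↔ P i)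
    (h1 : PolyTime (fun i : {i // P i} => e i) (fun i => g i))
    (h2 : PolyTime (fun i : {i // ¬ P i} => e i) (fun i => g i)) : PolyTime e g := by
  obtain ⟨r, R, hr⟩ := hc
  obtain ⟨p, S, hp⟩ := h1
  obtain ⟨q, T, hq⟩ := h2
  refine ⟨Prog.ite r p q, R + S + T + 1, fun i => ?_⟩
  obtain ⟨⟨s, hs, hs'⟩, -⟩ := hr i
  by_cases h : P i
  · obtain ⟨⟨t, ht, ht'⟩, hT⟩ := hp ⟨i, h⟩
    refine ⟨⟨_, Runs.ite_true hs ((hcP i).2 h) ht, ?_⟩, ?_⟩ <;> simp at * <;> omega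
  · obtain ⟨⟨t, ht, ht'⟩, hT⟩ := hq ⟨i, h⟩
    have hs0 : c i = BinaryTree.nil := by
      by_contra h0
      exact h ((hcP i).1 h0)
    rw [hs0] at hs
    refine ⟨⟨_, Runs.ite_false hs ht, ?_⟩, ?_⟩ <;> simp at * <;> omega

open Classical in
theorem ite {P : I → Prop} (hP : PolyTime e (fun i => encBit (P i))) (h1 : PolyTime e g)
    (h2 : PolyTime e h) : PolyTime e (fun i => if P i then g i else h i) := by
  refine hP.cases_on (P := P) (fun i => encBit_ne_nil) ?_ ?_
  · refine (h1.reindex (Subtype.val : {i // P i} → I)).congr fun i => ?_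
    simp [i.2]
  · refine (h2.reindex (Subtype.val : {i // ¬ P i} → I)).congr fun i => ?_
    simp [i.2]

/-- Any datum counts as a truth value: being nonempty is decidable. -/
theorem bit_of_ne_nil {P : I → Prop} (hg : PolyTime e g) (hP : ∀ i, g i ≠ BinaryTree.nil ↔ P i) :
    PolyTime e (fun i => encBit (P i)) := by
  refine hg.cases_on hP ?_ ?_
  · exact (const _ _).congr fun i => (encBit_true i.2).symm
  · exact (const _ _).congr fun i => (encBit_false i.2).symm

theorem bit_congr {P Q : I → Prop} (hP : PolyTime e (fun i => encBit (P i)))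
    (hPQ : ∀ i, P i ↔ Q i) : PolyTime e (fun i => encBit (Q i)) :=
  hP.congr fun i => by rw [propext (hPQ i)]

theorem not {P : I → Prop} (hP : PolyTime e (fun i => encBit (P i))) :
    PolyTime e (fun i => encBit (¬ P i)) := by
  classical
  refine (ite hP (const e BinaryTree.nil) (const e (encBit True))).congr fun i => ?_
  by_cases h : P i <;> simp [h, encBit]

theorem and {P Q : I → Prop} (hP : PolyTime e (fun i => encBit (P i)))
    (hQ : PolyTime e (fun i => encBit (Q i))) : PolyTime e (fun i => encBit (P i ∧ Q i)) := by
  classical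
  refine (ite hP hQ (const e BinaryTree.nil)).congr fun i => ?_
  by_cases h : P i <;> simp [h, encBit]

theorem or {P Q : I → Prop} (hP : PolyTime e (fun i => encBit (P i)))
    (hQ : PolyTime e (fun i => encBit (Q i))) : PolyTime e (fun i => encBit (P i ∨ Q i)) := by
  classical
  refine (ite hP (const e (encBit True)) hQ).congr fun i => ?_
  by_cases h : P i <;> simp [h, encBit]

/-- A loop that runs for polynomially many rounds through states of polynomial size, with a body
that is polynomial-time on the states that occur, is polynomial-time. -/
theorem iterate (D : I → ℕ → Data) (len : I → ℕ) (L B : Polynomial ℕ)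
    (h0 : PolyTime e (fun i => D i 0))
    (hstep : PolyTime (fun j : Σ i, Fin (len i) => D j.1 j.2) (fun j => D j.1 (j.2 + 1)))
    (hgo : ∀ i k, k < len i → (D i k).left ≠ BinaryTree.nil)
    (hdone : ∀ i, (D i (len i)).left = BinaryTree.nil)
    (hL : ∀ i, len i ≤ L.eval (e i).numNodes)
    (hB : ∀ i k, k ≤ len i → (D i k).numNodes ≤ B.eval (e i).numNodes) :
    PolyTime e (fun i => D i (len i)) := by
  obtain ⟨p, S, hp⟩ := h0
  obtain ⟨q, T, hq⟩ := hstep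
  have key : ∀ i d, d ≤ len i → ∃ t, Runs (Prog.loop Prog.fst q) (D i (len i - d)) (D i (len i)) t ∧
      t ≤ d * (T.eval (B.eval (e i).numNodes) + 2) + 2 := by
    intro i d
    induction d with
    | zero =>
      intro _
      have h := Runs.fst (D i (len i))
      rw [hdone] at h
      exact ⟨_, Runs.loop_stop h, by simp⟩
    | succ d ih =>
      intro hd
      obtain ⟨t, ht, ht'⟩ := ih (by omega)
      obtain ⟨⟨s, hs, hs'⟩, -⟩ := hq ⟨i, ⟨len i - (d + 1), by omega⟩⟩
      simp only [show len i - (d + 1) + 1 = len i - d by omega] at hs hs'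
      have hb := T.eval_nat_mono (hB i (len i - (d + 1)) (by omega))
      refine ⟨_, Runs.loop_step (Runs.fst _) (hgo i _ (by omega)) hs ht, ?_⟩
      rw [add_mul]
      omega
  refine ⟨Prog.seq p (Prog.loop Prog.fst q), S + L * (T.comp B + 2) + 2 + B + 1, fun i => ?_⟩
  obtain ⟨⟨s, hs, hs'⟩, -⟩ := hp i
  obtain ⟨t, ht, ht'⟩ := key i (len i) le_rfl
  rw [Nat.sub_self] at ht
  refine ⟨⟨_, Runs.seq hs ht, ?_⟩, ?_⟩
  · have := Nat.mul_le_mul_right (T.eval (B.eval (e i).numNodes) + 2) (hL i)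
    simp
    omega
  · have := hB i (len i) le_rfl
    simp
    omega

theorem numNodes_encList_drop_le (l : List Data) (k : ℕ) :
    (encList (l.drop k)).numNodes ≤ (encList l).numNodes := by
  induction l generalizing k with
  | nil => simp
  | cons a l ih =>
    cases k with
    | zero => simp
    | succ k => have := ih k; simp [encList]; omega

theorem length_le_numNodes_encList (l : List Data) : l.length ≤ (encList l).numNodes := by
  induction l with
  | nil => simp
  | cons a l ih => simp [encList]; omega

theorem encList_drop (l : List Data) (k : ℕ) (hk : k < l.length) :
    encList (l.drop k) = Data.pair l[k] (encList (l.drop (k + 1))) := by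
  rw [List.drop_eq_getElem_cons hk]
  rfl

/-- A pass over a list, where `s i k` is the state after `k` elements. The loop carries along the
rest of the list and the input. -/
theorem fold (l : I → List Data) (s : I → ℕ → Data) (B : Polynomial ℕ)
    (hl : PolyTime e (fun i => encList (l i))) (h0 : PolyTime e (fun i => s i 0))
    (hstep : PolyTime (fun j : Σ i, Fin (l i).length =>
      Data.pair (e j.1) (Data.pair (l j.1)[j.2] (s j.1 j.2))) (fun j => s j.1 (j.2 + 1)))
    (hB : ∀ i k, k ≤ (l i).length → (s i k).numNodes ≤ B.eval (e i).numNodes) :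
    PolyTime e (fun i => s i (l i).length) := by
  obtain ⟨T, hT⟩ := hl.numNodes_le
  let D : I → ℕ → Data := fun i k =>
    Data.pair (encList ((l i).drop k)) (Data.pair (e i) (s i k))
  suffices h : PolyTime e (fun i => D i (l i).length) from h.snd.snd
  refine iterate D (fun i => (l i).length) T (T + Polynomial.X + B + 2) ?_ ?_ ?_ ?_ ?_ ?_
  · simpa [D] using hl.pair ((PolyTime.id e).pair h0)
  · have hD := PolyTime.id fun j : Σ i, Fin (l i).length => D j.1 j.2
    have h1 := hD.left
    have h2 := hD.right.left
    have h3 := hD.right.right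
    refine PolyTime.pair (h1.right.congr fun j => ?_) (h2.pair ?_)
    · simp only [D, encList_drop _ _ j.2.2]
      rfl
    · refine ((h2.pair (h1.left.pair h3)).congr fun j => ?_).comp hstep
      simp only [D, encList_drop _ _ j.2.2]
      rfl
  · intro i k hk
    simp only [D, encList_drop _ _ hk, left_pair]
    exact pair_ne_nil _ _
  · intro i
    simp only [D, List.drop_length]
    rfl
  · exact fun i => (length_le_numNodes_encList _).trans (hT i)
  · intro i k hk
    have h1 := numNodes_encList_drop_le (l i) k
    have h2 := (hT i)
    have h3 := hB i k hk
    simp [D]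
    omega

end PolyTime

theorem map_finRange {α : Type} {n : ℕ} (f : ℕ → α) :
    (List.finRange n).map (fun i : Fin n => f i) = (List.range n).map f := by
  rw [← List.map_coe_finRange_eq_range, List.map_map]
  rfl

namespace PolyTime

variable {I : Type} {e : I → Data}

/-! ### Polynomial-time list operations -/

theorem numNodes_encList (l : List Data) :
    (encList l).numNodes = (l.map fun d => d.numNodes + 1).sum := by
  induction l with
  | nil => rfl
  | cons a l ih => simp [encList, ih]; ring

theorem numNodes_encList_append (l l' : List Data) :
    (encList (l ++ l')).numNodes = (encList l).numNodes + (encList l').numNodes := by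
  simp [numNodes_encList]

theorem numNodes_encList_reverse (l : List Data) :
    (encList l.reverse).numNodes = (encList l).numNodes := by
  simp [numNodes_encList, List.sum_reverse]

theorem numNodes_encList_take_le (l : List Data) (k : ℕ) :
    (encList (l.take k)).numNodes ≤ (encList l).numNodes := by
  conv_rhs => rw [← List.take_append_drop k l, numNodes_encList_append]
  omega

theorem numNodes_le_of_mem {l : List Data} {d : Data} (h : d ∈ l) :
    d.numNodes ≤ (encList l).numNodes := by
  obtain ⟨s, t, rfl⟩ := List.append_of_mem h
  simp [numNodes_encList_append, encList]
  omega

theorem numNodes_encList_flatMap_le {α : Type} (l : List α) (g : α → List Data) (C : ℕ)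
    (h : ∀ a ∈ l, (encList (g a)).numNodes ≤ C) :
    (encList (l.flatMap g)).numNodes ≤ l.length * C := by
  induction l with
  | nil => simp [encList]
  | cons a l ih =>
    have h1 := h a (by simp)
    have h2 := ih fun b hb => h b (by simp [hb])
    simp only [List.flatMap_cons, numNodes_encList_append, List.length_cons, add_mul]
    omega

theorem cons {a : I → Data} {l : I → List Data} (ha : PolyTime e a)
    (hl : PolyTime e (fun i => encList (l i))) : PolyTime e (fun i => encList (a i :: l i)) :=
  ha.pair hl

theorem tail {l : I → List Data} (hl : PolyTime e (fun i => encList (l i))) :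
    PolyTime e (fun i => encList (l i).tail) := by
  refine hl.right.congr fun i => ?_
  cases l i <;> rfl

theorem reverse {l : I → List Data} (hl : PolyTime e (fun i => encList (l i))) :
    PolyTime e (fun i => encList (l i).reverse) := by
  obtain ⟨T, hT⟩ := hl.numNodes_le
  refine (fold l (fun i k => encList ((l i).take k).reverse) T hl ?_ ?_ ?_).congr fun i => ?_
  · simpa using const e _
  · have h := (PolyTime.id fun j : Σ i, Fin (l i).length => Data.pair (e j.1)
      (Data.pair (l j.1)[j.2] (encList ((l j.1).take j.2).reverse))).snd
    refine (h.fst.pair h.snd).congr fun j => ?_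
    rw [← List.take_concat_get' _ _ j.2.2, List.reverse_append]
    rfl
  · intro i k _
    rw [numNodes_encList_reverse]
    exact (numNodes_encList_take_le _ _).trans (hT i)
  · simp

theorem append {a b : I → List Data} (ha : PolyTime e (fun i => encList (a i)))
    (hb : PolyTime e (fun i => encList (b i))) : PolyTime e (fun i => encList (a i ++ b i)) := by
  obtain ⟨S, hS⟩ := ha.reverse.numNodes_le
  obtain ⟨T, hT⟩ := hb.numNodes_le
  refine (fold (fun i => (a i).reverse) (fun i k => encList (((a i).reverse.take k).reverse ++ b i))
    (S + T) ha.reverse ?_ ?_ ?_).congr fun i => ?_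
  · simpa using hb
  · have h := (PolyTime.id fun j : Σ i, Fin (a i).reverse.length => Data.pair (e j.1)
      (Data.pair (a j.1).reverse[j.2] (encList (((a j.1).reverse.take j.2).reverse ++ b j.1)))).snd
    refine (h.fst.pair h.snd).congr fun j => ?_
    have hj : (j.2 : ℕ) < (a j.1).length := by simpa using j.2.2
    simp [List.take_add_one, encList, hj]
  · intro i k _
    have h1 := numNodes_encList_take_le (a i).reverse k
    have h2 := (hS i)
    have h3 := (hT i)
    rw [numNodes_encList_append, numNodes_encList_reverse, Polynomial.eval_add]
    omega
  · rw [List.take_length, List.reverse_reverse]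

variable {α : I → Type} {enc : ∀ i, α i → Data} {l : ∀ i, List (α i)}

/-- For maps `l i ↦ …` of lists it is shown that the step is polynomial-time when the list element
is given together with the input. Then whatever depends on the input only is still computable. -/
theorem lift {g : I → Data} (enc : ∀ i, α i → Data) (hg : PolyTime e g) :
    PolyTime (fun q : Σ i, α i => Data.pair (e q.1) (enc q.1 q.2)) (fun q => g q.1) :=
  (PolyTime.id _).fst.comp (hg.reindex _)

/-- The list element that is given together with the input is computable. -/
theorem last (e : I → Data) (enc : ∀ i, α i → Data) :
    PolyTime (fun q : Σ i, α i => Data.pair (e q.1) (enc q.1 q.2)) (fun q => enc q.1 q.2) :=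
  (PolyTime.id _).snd

theorem flatMap {g : ∀ i, α i → List Data}
    (hl : PolyTime e (fun i => encList ((l i).map (enc i))))
    (hg : PolyTime (fun q : Σ i, α i => Data.pair (e q.1) (enc q.1 q.2))
      (fun q => encList (g q.1 q.2))) :
    PolyTime e (fun i => encList ((l i).flatMap (g i))) := by
  obtain ⟨S, hS⟩ := hl.numNodes_le
  obtain ⟨T, hT⟩ := hg.numNodes_le
  refine (fold (fun i => ((l i).map (enc i)).reverse)
    (fun i k => encList (((l i).drop ((l i).length - k)).flatMap (g i)))
    (S * T.comp (Polynomial.X + S + 1)) hl.reverse ?_ ?_ ?_).congr fun i => ?_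
  · simpa using const e _
  · have h := (PolyTime.id fun j : Σ i, Fin ((l i).map (enc i)).reverse.length => Data.pair (e j.1)
      (Data.pair ((l j.1).map (enc j.1)).reverse[j.2]
        (encList (((l j.1).drop ((l j.1).length - j.2)).flatMap (g j.1)))))
    have hlt : ∀ j : Σ i, Fin ((l i).map (enc i)).reverse.length,
        (l j.1).length - (j.2 + 1) < (l j.1).length := by
      intro j
      have hj : (j.2 : ℕ) < (l j.1).length := by simpa using j.2.2
      omega
    have hg2 := hg.reindex (J := Σ i, Fin ((l i).map (enc i)).reverse.length)
      fun j => ⟨j.1, (l j.1)[(l j.1).length - (j.2 + 1)]'(hlt j)⟩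
    have h2 := ((h.fst.pair h.snd.fst).congr fun j => ?_).comp hg2
    · refine (h2.append h.snd.snd).congr fun j => ?_
      have hj : (j.2 : ℕ) < (l j.1).length := by simpa using j.2.2
      rw [List.drop_eq_getElem_cons (hlt j), List.flatMap_cons,
        show (l j.1).length - (j.2 + 1) + 1 = (l j.1).length - j.2 by omega]
    · simp [Nat.sub_sub, Nat.add_comm 1]
  · intro i k _
    have h1 : (l i).length ≤ S.eval (e i).numNodes := by
      simpa using (length_le_numNodes_encList ((l i).map (enc i))).trans (hS i)
    refine (numNodes_encList_flatMap_le _ _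
      (T.eval ((e i).numNodes + S.eval (e i).numNodes + 1)) ?_).trans ?_
    · intro a ha
      refine (hT ⟨i, a⟩).trans (T.eval_nat_mono ?_)
      have := numNodes_le_of_mem (List.mem_map_of_mem (f := enc i) (List.mem_of_mem_drop ha))
      have := (hS i)
      simp
      omega
    · simp
      exact Nat.mul_le_mul_right _ (by omega)
  · simp

theorem map {g : ∀ i, α i → Data} (hl : PolyTime e (fun i => encList ((l i).map (enc i))))
    (hg : PolyTime (fun q : Σ i, α i => Data.pair (e q.1) (enc q.1 q.2)) (fun q => g q.1 q.2)) :
    PolyTime e (fun i => encList ((l i).map (g i))) := by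
  refine (flatMap (g := fun i a => [g i a]) hl (hg.pair (const _ BinaryTree.nil))).congr fun i => ?_
  rw [← List.map_eq_flatMap]

open Classical in
theorem filter {P : ∀ i, α i → Prop} (hl : PolyTime e (fun i => encList ((l i).map (enc i))))
    (hP : PolyTime (fun q : Σ i, α i => Data.pair (e q.1) (enc q.1 q.2))
      (fun q => encBit (P q.1 q.2))) :
    PolyTime e (fun i => encList (((l i).filter fun a => P i a).map (enc i))) := by
  refine (flatMap (g := fun i a => if P i a then [enc i a] else []) hl
    ((ite hP ((last e enc).pair (const _ BinaryTree.nil)) (const _ BinaryTree.nil)).congr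
      fun q => ?_)).congr fun i => ?_
  · by_cases h : P q.1 q.2 <;> simp [h, encList]
  · congr 1
    induction l i with
    | nil => rfl
    | cons a l ih => by_cases h : P i a <;> simp [h, ih]

theorem exists_mem {P : ∀ i, α i → Prop} (hl : PolyTime e (fun i => encList ((l i).map (enc i))))
    (hP : PolyTime (fun q : Σ i, α i => Data.pair (e q.1) (enc q.1 q.2))
      (fun q => encBit (P q.1 q.2))) :
    PolyTime e (fun i => encBit (∃ a ∈ l i, P i a)) := by
  classical
  refine (hl.filter hP).bit_of_ne_nil fun i => ?_
  rw [← not_iff_not, not_not]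
  have : ∀ l : List Data, encList l = BinaryTree.nil ↔ l = [] := by
    rintro (_ | ⟨a, l⟩) <;> simp [encList, Data.pair]
  simp [this]

/-! ### Polynomial-time arithmetic -/

theorem encNat_succ (n : ℕ) : encNat (n + 1) = Data.pair BinaryTree.nil (encNat n) := rfl

theorem numNodes_encNat (n : ℕ) : (encNat n).numNodes = n := by
  induction n with
  | zero => rfl
  | succ n ih => simp [encNat_succ, ih]

theorem encNat_ne_nil {n : ℕ} : encNat n ≠ BinaryTree.nil ↔ n ≠ 0 := by
  cases n with
  | zero => simp [encNat, encList]
  | succ n => simp [encNat_succ, pair_ne_nil]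

/-- As numbers are unary, the length of a list is obtained by emptying its elements. -/
theorem length {l : I → List Data} (hl : PolyTime e (fun i => encList (l i))) :
    PolyTime e (fun i => encNat (l i).length) := by
  refine (map (l := l) (enc := fun _ d => d) (g := fun _ _ => BinaryTree.nil) (by simpa using hl)
    (const _ _)).congr fun i => ?_
  simp [encNat]

/-- A loop with a given number of rounds, where `s i k` is the state after `k` rounds. -/
theorem iter (n : I → ℕ) (s : I → ℕ → Data) (B : Polynomial ℕ)
    (hn : PolyTime e (fun i => encNat (n i))) (h0 : PolyTime e (fun i => s i 0))
    (hstep : PolyTime (fun j : Σ i, Fin (n i) => Data.pair (e j.1) (s j.1 j.2))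
      (fun j => s j.1 (j.2 + 1)))
    (hB : ∀ i k, k ≤ n i → (s i k).numNodes ≤ B.eval (e i).numNodes) :
    PolyTime e (fun i => s i (n i)) := by
  refine (fold (fun i => List.replicate (n i) BinaryTree.nil) s B hn h0 ?_
    fun i k hk => hB i k (by simpa using hk)).congr fun i => by simp
  have h := (PolyTime.id fun j : Σ i, Fin (List.replicate (n i) (BinaryTree.nil : Data)).length =>
    Data.pair (e j.1) (Data.pair (List.replicate (n j.1) BinaryTree.nil)[j.2] (s j.1 j.2)))
  have hstep' := hstep.reindex
    fun j : Σ i, Fin (List.replicate (n i) (BinaryTree.nil : Data)).length =>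
      (⟨j.1, ⟨j.2, by simpa using j.2.2⟩⟩ : Σ i, Fin (n i))
  exact (h.fst.pair h.snd.snd).comp hstep'

theorem drop {n : I → ℕ} {l : I → List Data} (hn : PolyTime e (fun i => encNat (n i)))
    (hl : PolyTime e (fun i => encList (l i))) :
    PolyTime e (fun i => encList ((l i).drop (n i))) := by
  obtain ⟨T, hT⟩ := hl.numNodes_le
  refine iter n (fun i k => encList ((l i).drop k)) T hn (by simpa using hl) ?_
    fun i k _ => (numNodes_encList_drop_le _ _).trans (hT i)
  refine (PolyTime.id fun j : Σ i, Fin (n i) =>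
    Data.pair (e j.1) (encList ((l j.1).drop j.2))).snd.tail.congr fun j => ?_
  simp

theorem add {m n : I → ℕ} (hm : PolyTime e (fun i => encNat (m i)))
    (hn : PolyTime e (fun i => encNat (n i))) : PolyTime e (fun i => encNat (m i + n i)) := by
  refine (hm.append hn).congr fun i => ?_
  simp [encNat]

theorem sub {m n : I → ℕ} (hm : PolyTime e (fun i => encNat (m i)))
    (hn : PolyTime e (fun i => encNat (n i))) : PolyTime e (fun i => encNat (m i - n i)) := by
  refine (hn.drop hm).congr fun i => ?_
  simp [encNat]

theorem max {m n : I → ℕ} (hm : PolyTime e (fun i => encNat (m i)))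
    (hn : PolyTime e (fun i => encNat (n i))) :
    PolyTime e (fun i => encNat (Max.max (m i) (n i))) :=
  (hm.add (hn.sub hm)).congr fun i => congrArg encNat (by omega)

theorem min {m n : I → ℕ} (hm : PolyTime e (fun i => encNat (m i)))
    (hn : PolyTime e (fun i => encNat (n i))) :
    PolyTime e (fun i => encNat (Min.min (m i) (n i))) :=
  (hm.sub (hm.sub hn)).congr fun i => congrArg encNat (by omega)

theorem mul {m n : I → ℕ} (hm : PolyTime e (fun i => encNat (m i)))
    (hn : PolyTime e (fun i => encNat (n i))) : PolyTime e (fun i => encNat (m i * n i)) := by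
  refine (flatMap (α := fun _ => Data) (enc := fun _ d => d)
    (l := fun i => List.replicate (m i) BinaryTree.nil)
    (g := fun i _ => List.replicate (n i) BinaryTree.nil) (by simpa [encNat] using hm)
    (hn.lift (α := fun _ => Data) fun _ d => d)).congr fun i => ?_
  rw [encNat]
  congr 1
  induction m i with
  | zero => simp
  | succ k ih => simp [List.replicate_succ, ih, add_mul, add_comm]

theorem lt {m n : I → ℕ} (hm : PolyTime e (fun i => encNat (m i)))
    (hn : PolyTime e (fun i => encNat (n i))) : PolyTime e (fun i => encBit (m i < n i)) :=
  (hn.sub hm).bit_of_ne_nil fun i => by rw [encNat_ne_nil]; omega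

theorem eq {m n : I → ℕ} (hm : PolyTime e (fun i => encNat (m i)))
    (hn : PolyTime e (fun i => encNat (n i))) : PolyTime e (fun i => encBit (m i = n i)) :=
  ((hm.lt hn).or (hn.lt hm)).not.bit_congr fun i => by omega

theorem range {n : I → ℕ} (hn : PolyTime e (fun i => encNat (n i))) :
    PolyTime e (fun i => encList ((List.finRange (n i)).map fun k : Fin (n i) => encNat k)) := by
  obtain ⟨T, hT⟩ := hn.numNodes_le
  have hB : ∀ i, n i ≤ T.eval (e i).numNodes := fun i => by
    simpa [numNodes_encNat] using (hT i)
  refine (iter n (fun i k => Data.pair (encNat (n i - k))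
    (encList ((List.range' (n i - k) k).map encNat))) (T + T * (T + 1) + 1) hn ?_ ?_
    ?_).snd.congr fun i => ?_
  · simpa using hn.pair (const e _)
  · have h := (PolyTime.id fun j : Σ i, Fin (n i) => Data.pair (e j.1)
      (Data.pair (encNat (n j.1 - j.2))
        (encList ((List.range' (n j.1 - j.2) j.2).map encNat)))).snd
    have h1 := h.fst.sub ((const _ (encNat 1)).congr fun _ => rfl)
    refine (h1.pair (h1.cons h.snd)).congr fun j => ?_
    have hj := j.2.2
    rw [Nat.sub_sub, List.range'_succ, List.map_cons,
      show n j.1 - (j.2 + 1) + 1 = n j.1 - j.2 by omega]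
  · intro i k hk
    have h1 : ∀ l : List ℕ, (∀ x ∈ l, x ≤ n i) →
        (encList (l.map encNat)).numNodes ≤ l.length * (n i + 1) := by
      intro l
      induction l with
      | nil => simp [encList]
      | cons a l ih =>
        intro h
        have h2 := ih fun x hx => h x (by simp [hx])
        have h3 := h a (by simp)
        simp [encList, numNodes_encNat, add_mul] at *
        omega
    have h2 := h1 (List.range' (n i - k) k) fun x hx => by
      simp [List.mem_range'_1] at hx
      omega
    have h3 : k * (n i + 1) ≤ T.eval (e i).numNodes * (T.eval (e i).numNodes + 1) :=
      Nat.mul_le_mul (hk.trans (hB i)) (Nat.succ_le_succ (hB i))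
    have h4 := hB i
    rw [List.length_range'] at h2
    simp [numNodes_encNat]
    omega
  · simp only [Nat.sub_self, ← List.range_eq_range']
    rw [map_finRange]

end PolyTime

namespace PolyTime

variable {I : Type} {e g : I → Data}

/-! ### Constants, tables and encoded graphs -/

theorem eq_const (d : Data) (hg : PolyTime e g) : PolyTime e (fun i => encBit (g i = d)) := by
  induction d generalizing g with
  | nil =>
    exact (hg.bit_of_ne_nil fun i => Iff.rfl).not.bit_congr fun i => not_not
  | node v l r hl hr =>
    refine ((hg.bit_of_ne_nil fun i => Iff.rfl).and
      ((hl hg.left).and (hr hg.right))).bit_congr fun i => ?_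
    cases g i with
    | nil => simp
    | node v' l' r' => simp [BinaryTree.left, BinaryTree.right]

/-- On finitely many inputs, anything can be computed by looking it up in a table. -/
theorem of_finite [Finite I] (he : Function.Injective e) (g : I → Data) : PolyTime e g := by
  classical
  have := Fintype.ofFinite I
  suffices h : ∀ s : Finset I, PolyTime e (fun i => if i ∈ s then g i else BinaryTree.nil) by
    simpa using h Finset.univ
  intro s
  induction s using Finset.induction_on with
  | empty => simpa using const e BinaryTree.nil
  | insert a s _ ih =>
    refine (ite (((PolyTime.id e).eq_const (e a)).bit_congr fun i => he.eq_iff)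
      (const e (g a)) ih).congr fun i => ?_
    by_cases h : i = a <;> simp [h]

/-- The element at a given place of a list; it is `nil` if the list is too short. -/
theorem getElem? {l : I → List Data} {k : I → ℕ} (hl : PolyTime e (fun i => encList (l i)))
    (hk : PolyTime e (fun i => encNat (k i))) :
    PolyTime e (fun i => ((l i)[k i]?).getD BinaryTree.nil) := by
  refine (hk.drop hl).left.congr fun i => ?_
  rw [← List.head?_drop]
  cases (l i).drop (k i) <;> rfl

theorem mem_vertexSet {N : I → ℕ} {S : ∀ i, Finset (Fin (N i))} {k : I → ℕ}
    (hS : PolyTime e (fun i => encVertexSet (S i))) (hk : PolyTime e (fun i => encNat (k i))) :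
    PolyTime e (fun i => encBit (∃ h : k i < N i, (⟨k i, h⟩ : Fin (N i)) ∈ S i)) := by
  refine (getElem? hS hk).congr fun i => ?_
  by_cases h : k i < N i
  · simp [h]
  · simp [h, encBit]

theorem adj {n : I → ℕ} {G : ∀ i, SimpleGraph (Fin (n i))} {a b : I → ℕ}
    (hG : PolyTime e (fun i => encGraph (G i))) (ha : PolyTime e (fun i => encNat (a i)))
    (hb : PolyTime e (fun i => encNat (b i))) :
    PolyTime e (fun i => encBit (∃ (ha : a i < n i) (hb : b i < n i),
      (G i).Adj ⟨a i, ha⟩ ⟨b i, hb⟩)) := by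
  have h := (getElem? hG ha).congr (h := fun i => encList (if ha : a i < n i then
    List.ofFn fun j => encBit ((G i).Adj ⟨a i, ha⟩ j) else [])) fun i => by
      by_cases h : a i < n i
      · simp [h]
      · simp [h, encList]
  refine (getElem? h hb).congr fun i => ?_
  by_cases h : a i < n i
  · by_cases h' : b i < n i
    · simp [h, h']
    · simp [h, h', encBit]
  · simp [h, encBit]

end PolyTime

/-! ### Contraction sequences of graphs that are laid out along a path -/

namespace Trigraph

variable {V : Type}

/-- The trigraph `T` arises from the graph `G` by contracting the fibres of `f` to single vertices.
Only those consequences are recorded that bound red degrees: linked vertices have adjacent elements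
in their fibres, and the ends `x`, `y` of a red edge do not both have a trivial fibre, `{x}` resp.
`{y}`. -/
structure IsQuotient (G : SimpleGraph V) (T : Trigraph V) (f : V → V) : Prop where
  verts_eq : T.verts = Set.range f
  linked : ∀ x y, T.Linked x y → ∃ a b, f a = x ∧ f b = y ∧ G.Adj a b
  red : ∀ x y, T.red.Adj x y → ¬ ((∀ a, f a = x → a = x) ∧ ∀ b, f b = y → b = y)

theorem isQuotient_ofGraph (G : SimpleGraph V) : IsQuotient G (ofGraph G) (fun v => v) where
  verts_eq := by simp [ofGraph]
  linked x y h := ⟨x, y, rfl, rfl, h.elim (fun h => h) (fun h => h.elim)⟩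
  red x y h := h.elim

theorem linked_of_merge {T : Trigraph V} {u v z : V} (h : T.MergeBlack u v z ∨ T.MergeRed u v z) :
    T.Linked u z ∨ T.Linked v z := by
  rcases h with h | h
  · exact Or.inl (Or.inl h.1)
  · by_contra hn
    rw [not_or] at hn
    exact h.2 hn

theorem IsQuotient.contract {G : SimpleGraph V} {T : Trigraph V} {f f' : V → V}
    (hT : IsQuotient G T f) {u v : V} (hu : u ∈ T.verts) (hv : v ∈ T.verts) (huv : u ≠ v)
    (hf : ∀ a, f a = v → f' a = u) (hf' : ∀ a, f a ≠ v → f' a = f a) :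
    IsQuotient G (T.contract u v hu huv) f' where
  verts_eq := by
    ext x
    simp only [Trigraph.contract, hT.verts_eq, Set.mem_sdiff, Set.mem_range, Set.mem_singleton_iff]
    constructor
    · rintro ⟨⟨a, rfl⟩, h⟩
      exact ⟨a, hf' a h⟩
    · rintro ⟨a, rfl⟩
      by_cases h : f a = v
      · rw [hf a h]
        rw [hT.verts_eq] at hu
        exact ⟨hu, huv⟩
      · rw [hf' a h]
        exact ⟨⟨a, rfl⟩, h⟩
  linked := by
    have key : ∀ z, z ≠ v → T.MergeBlack u v z ∨ T.MergeRed u v z →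
        ∃ a b, f' a = u ∧ f' b = z ∧ G.Adj a b := by
      intro z hz h
      rcases linked_of_merge h with h | h
      · obtain ⟨a, b, rfl, rfl, hab⟩ := hT.linked _ _ h
        exact ⟨a, b, hf' a huv, hf' b hz, hab⟩
      · obtain ⟨a, b, ha, rfl, hab⟩ := hT.linked _ _ h
        exact ⟨a, b, hf a ha, hf' b hz, hab⟩
    have key' : ∀ x y, x ≠ v → y ≠ v → T.Linked x y → ∃ a b, f' a = x ∧ f' b = y ∧ G.Adj a b := by
      intro x y hx hy h
      obtain ⟨a, b, rfl, rfl, hab⟩ := hT.linked _ _ h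
      exact ⟨a, b, hf' a hx, hf' b hy, hab⟩
    rintro x y (⟨h1, h2, -, ⟨rfl, h⟩ | ⟨rfl, h⟩ | ⟨-, -, h⟩⟩ |
      ⟨h1, h2, -, ⟨rfl, h⟩ | ⟨rfl, h⟩ | ⟨-, -, h⟩⟩)
    · exact key y h2 (Or.inl h)
    · obtain ⟨a, b, ha, hb, hab⟩ := key x h1 (Or.inl h)
      exact ⟨b, a, hb, ha, hab.symm⟩
    · exact key' x y h1 h2 (Or.inl h)
    · exact key y h2 (Or.inr h)
    · obtain ⟨a, b, ha, hb, hab⟩ := key x h1 (Or.inr h)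
      exact ⟨b, a, hb, ha, hab.symm⟩
    · exact key' x y h1 h2 (Or.inr h)
  red := by
    -- The fibre of `u` contains the former fibres of both `u` and `v`, hence is not trivial.
    have key : ¬ ∀ a, f' a = u → a = u := by
      intro h
      rw [hT.verts_eq] at hu hv
      obtain ⟨a, ha⟩ := hu
      obtain ⟨b, hb⟩ := hv
      have h1 := h a ((hf' a (ha ▸ huv)).trans ha)
      have h2 := h b (hf b hb)
      rw [h1] at ha
      rw [h2] at hb
      exact huv (ha.symm.trans hb)
    rintro x y ⟨h1, h2, -, ⟨rfl, -⟩ | ⟨rfl, -⟩ | ⟨hx, hy, h⟩⟩ ⟨h3, h4⟩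
    · exact key h3
    · exact key h4
    · refine hT.red x y h ⟨fun a ha => h3 a ?_, fun b hb => h4 b ?_⟩
      · rw [hf' a (ha ▸ h1), ha]
      · rw [hf' b (hb ▸ h2), hb]

/-- If the fibre maps `f 0, f 1, …, f R` describe successive contractions of the pairs `c r`,
then these form a contraction sequence as soon as red degrees are bounded. The list of the last `k`
pairs is treated by induction on `k`. -/
theorem IsQuotient.isSequence {G : SimpleGraph V} {d R : ℕ} (f : ℕ → V → V) (c : ℕ → V × V)
    (h1 : ∀ r < R, (c r).1 ∈ Set.range (f r)) (h2 : ∀ r < R, (c r).2 ∈ Set.range (f r))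
    (hne : ∀ r < R, (c r).1 ≠ (c r).2)
    (hf : ∀ r < R, ∀ a, f r a = (c r).2 → f (r + 1) a = (c r).1)
    (hf' : ∀ r < R, ∀ a, f r a ≠ (c r).2 → f (r + 1) a = f r a)
    (hred : ∀ r ≤ R, ∀ T, IsQuotient G T (f r) → T.RedDegreeLE d)
    (hend : ∃ w, Set.range (f R) = {w}) :
    ∀ k ≤ R, ∀ T, IsQuotient G T (f (R - k)) →
      T.IsSequence d ((List.range' (R - k) k).map c) := by
  intro k
  induction k with
  | zero =>
    intro _ T hT
    refine ⟨hred _ (by omega) T hT, ?_⟩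
    rwa [hT.verts_eq]
  | succ k ih =>
    intro hk T hT
    have hlt : R - (k + 1) < R := by omega
    have hu : (c (R - (k + 1))).1 ∈ T.verts := hT.verts_eq ▸ h1 _ hlt
    have hv : (c (R - (k + 1))).2 ∈ T.verts := hT.verts_eq ▸ h2 _ hlt
    refine ⟨hred _ (by omega) T hT, hu, hv, hne _ hlt, ?_⟩
    have hs : R - (k + 1) + 1 = R - k := by omega
    rw [hs]
    refine ih (by omega) _ ?_
    rw [← hs]
    exact hT.contract hu hv (hne _ hlt) (hf _ hlt) (hf' _ hlt)

/-- A layout of a graph along a path: the vertices are listed as `w 0, w 1, …`, the last `n` of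
them being the isolated vertices of the path. Each vertex has a position on the path such that
adjacent vertices have positions at distance at most one, and each vertex has, among its neighbours
that come later in the list, only its successor and a vertex that depends on its position only. -/
structure PathLayout (G : SimpleGraph V) (M n : ℕ) where
  w : ℕ → V
  idx : V → ℕ
  pos : V → ℕ
  hub : ℕ → V
  idx_w : ∀ k < M + n, idx (w k) = k
  w_idx : ∀ v, w (idx v) = v
  idx_lt : ∀ v, idx v < M + n
  pos_lt : ∀ v, pos v < n
  pos_w : ∀ t < n, pos (w (M + t)) = t
  idx_lt_of_adj : ∀ {a b}, G.Adj a b → idx a < M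
  pos_le_of_adj : ∀ {a b}, G.Adj a b → pos a ≤ pos b + 1
  later_of_adj : ∀ {a b}, G.Adj a b → idx a < idx b → idx b = idx a + 1 ∨ b = hub (pos a)

theorem redDegreeLE_four {T : Trigraph V}
    (h : ∀ x, ∃ a b c d, ∀ y, T.red.Adj x y → y = a ∨ y = b ∨ y = c ∨ y = d) :
    T.RedDegreeLE 4 := by
  classical
  intro x _
  obtain ⟨a, b, c, d, hx⟩ := h x
  calc (T.red.neighborSet x).encard ≤ ((({a, b, c, d} : Finset V) : Set V)).encard :=
        Set.encard_le_encard fun y hy => by simpa using hx y hy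
    _ ≤ 4 := by
        rw [Set.encard_coe_eq_coe_finsetCard]
        exact_mod_cast Finset.card_le_four

namespace PathLayout

variable {G : SimpleGraph V} {M n : ℕ} (L : PathLayout G M n)

/-- The fibre map after `r` contractions: the first `M` contractions send each vertex in turn to
the path vertex at its position, the others send the path vertices in turn to the first one. -/
def fibreMap (r : ℕ) (v : V) : V :=
  if r < M then if L.idx v < r then L.w (M + L.pos v) else v
  else L.w (M + if L.pos v < r - M + 1 then 0 else L.pos v)

/-- The pair of vertices that the `r`-th contraction identifies. -/
def contraction (r : ℕ) : V × V :=
  if r < M then (L.w (M + L.pos (L.w r)), L.w r) else (L.w M, L.w (M + (r - M + 1)))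

theorem w_inj {a b : ℕ} (ha : a < M + n) (hb : b < M + n) (h : L.w a = L.w b) : a = b := by
  rw [← L.idx_w a ha, h, L.idx_w b hb]

theorem w_pos_inj {s t : ℕ} (hs : s < n) (ht : t < n) (h : L.w (M + s) = L.w (M + t)) :
    s = t := by
  have := L.w_inj (by omega) (by omega) h
  omega

/-- The first of the two phases may be extended to its end, where both descriptions agree. -/
theorem fibreMap_of_le {r : ℕ} (hr : r ≤ M) (v : V) :
    L.fibreMap r v = if L.idx v < r then L.w (M + L.pos v) else v := by
  rcases hr.lt_or_eq with h | rfl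
  · simp [fibreMap, h]
  · simp only [fibreMap, lt_irrefl, if_false, Nat.sub_self]
    have h0 : (if L.pos v < 0 + 1 then 0 else L.pos v) = L.pos v := by
      split_ifs <;> omega
    rw [h0]
    split_ifs with h
    · rfl
    · have h1 := L.idx_lt v
      have h2 := L.pos_w (L.idx v - r) (by omega)
      rw [show r + (L.idx v - r) = L.idx v by omega, L.w_idx] at h2
      rw [h2, show r + (L.idx v - r) = L.idx v by omega, L.w_idx]

theorem fibreMap_of_ge {r : ℕ} (hr : M ≤ r) (v : V) :
    L.fibreMap r v = L.w (M + if L.pos v < r - M + 1 then 0 else L.pos v) := by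
  simp [fibreMap, hr.not_gt]

/-- Before the path is contracted, a path vertex may have red edges to its two neighbours on the
path, to the successor of the vertex contracted last, and to the hub of its position; each other
vertex has red edges to path vertices only, at most three of them. -/
theorem redDegreeLE_of_le {r : ℕ} (hr : r ≤ M) {T : Trigraph V}
    (hT : IsQuotient G T (L.fibreMap r)) : T.RedDegreeLE 4 := by
  apply redDegreeLE_four
  intro x
  -- The neighbours of a vertex that is still to be contracted, resp. of a vertex of the path.
  suffices h : ∀ y, T.red.Adj x y →
      (L.idx x < M ∧ (y = L.w (M + (L.pos x - 1)) ∨ y = L.w (M + L.pos x) ∨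
        y = L.w (M + (L.pos x + 1)))) ∨
      (M ≤ L.idx x ∧ (y = L.w (M + (L.pos x - 1)) ∨ y = L.w r ∨
        y = L.w (M + (L.pos x + 1)) ∨ y = L.hub (L.pos x))) by
    by_cases hx : L.idx x < M
    · refine ⟨L.w (M + (L.pos x - 1)), L.w (M + L.pos x), L.w (M + (L.pos x + 1)), x,
        fun y hy => ?_⟩
      rcases h y hy with ⟨-, h⟩ | ⟨h, -⟩
      · exact h.imp_right fun h => h.imp_right Or.inl
      · omega
    · refine ⟨L.w (M + (L.pos x - 1)), L.w r, L.w (M + (L.pos x + 1)), L.hub (L.pos x),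
        fun y hy => ?_⟩
      rcases h y hy with ⟨h, -⟩ | ⟨-, h⟩
      · omega
      · exact h
  intro y hxy
  obtain ⟨a, b, ha, hb, hab⟩ := hT.linked x y (Or.inr hxy)
  have hred := hT.red x y hxy
  rw [L.fibreMap_of_le hr] at ha hb
  have haM := L.idx_lt_of_adj hab
  have hbM := L.idx_lt_of_adj hab.symm
  have hp1 := L.pos_le_of_adj hab
  have hp2 := L.pos_le_of_adj hab.symm
  have hsingle : ∀ z, r ≤ L.idx z → L.idx z < M → ∀ a, L.fibreMap r a = z → a = z := by
    intro z hz hzM a' ha'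
    rw [L.fibreMap_of_le hr] at ha'
    split_ifs at ha' with h
    · have := L.idx_w (M + L.pos a') (by have := L.pos_lt a'; omega)
      rw [ha'] at this
      omega
    · exact ha'
  split_ifs at ha with har
  · have hxi : L.idx x = M + L.pos a := by
      rw [← ha, L.idx_w]
      have := L.pos_lt a
      omega
    have hxp : L.pos x = L.pos a := by rw [← ha, L.pos_w _ (L.pos_lt a)]
    refine Or.inr ⟨by omega, ?_⟩
    rw [hxp]
    split_ifs at hb with hbr
    · have hne : L.pos b ≠ L.pos a := by
        intro h
        rw [h] at hb
        exact hxy.ne (ha.symm.trans hb)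
      rcases (show L.pos b = L.pos a - 1 ∨ L.pos b = L.pos a + 1 by omega) with h | h
      · exact Or.inl (by rw [← hb, h])
      · exact Or.inr (Or.inr (Or.inl (by rw [← hb, h])))
    · subst hb
      rcases L.later_of_adj hab (by omega) with h | h
      · refine Or.inr (Or.inl ?_)
        rw [← L.w_idx b, show L.idx b = r by omega]
      · exact Or.inr (Or.inr (Or.inr h))
  · subst ha
    refine Or.inl ⟨haM, ?_⟩
    split_ifs at hb with hbr
    · rcases (show L.pos b = L.pos a - 1 ∨ L.pos b = L.pos a ∨ L.pos b = L.pos a + 1 by omega)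
        with h | h | h
      · exact Or.inl (by rw [← hb, h])
      · exact Or.inr (Or.inl (by rw [← hb, h]))
      · exact Or.inr (Or.inr (by rw [← hb, h]))
    · subst hb
      exact absurd ⟨hsingle a (by omega) haM, hsingle b (by omega) hbM⟩ hred

/-- While the path is contracted, the trigraph is a path. -/
theorem redDegreeLE_of_ge {r : ℕ} (hr : M ≤ r) {T : Trigraph V}
    (hT : IsQuotient G T (L.fibreMap r)) : T.RedDegreeLE 4 := by
  apply redDegreeLE_four
  intro x
  refine ⟨L.w M, L.w (M + (r - M + 1)), L.w (M + (L.pos x - 1)), L.w (M + (L.pos x + 1)),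
    fun y hxy => ?_⟩
  obtain ⟨a, b, ha, hb, hab⟩ := hT.linked x y (Or.inr hxy)
  rw [L.fibreMap_of_ge hr] at ha hb
  have hp1 := L.pos_le_of_adj hab
  have hp2 := L.pos_le_of_adj hab.symm
  have hne := hxy.ne
  split_ifs at hb with hbr
  · exact Or.inl hb.symm
  · split_ifs at ha with har
    · refine Or.inr (Or.inl ?_)
      rw [← hb, show L.pos b = r - M + 1 by omega]
    · have hxp : L.pos x = L.pos a := by rw [← ha, L.pos_w _ (L.pos_lt a)]
      have hne' : L.pos b ≠ L.pos a := by
        intro h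
        rw [h] at hb
        exact hne (ha.symm.trans hb)
      rw [hxp]
      rcases (show L.pos b = L.pos a - 1 ∨ L.pos b = L.pos a + 1 by omega) with h | h
      · exact Or.inr (Or.inr (Or.inl (by rw [← hb, h])))
      · exact Or.inr (Or.inr (Or.inr (by rw [← hb, h])))

/-- Contracting every vertex into the path vertex at its position, in the order of the list, and
then the path into its first vertex, is a `4`-sequence. -/
theorem isSequence (hn : 0 < n) :
    (ofGraph G).IsSequence 4 ((List.range M).map (fun k => (L.w (M + L.pos (L.w k)), L.w k)) ++
      (List.range (n - 1)).map (fun t => (L.w M, L.w (M + (t + 1))))) := by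
  have hlist : (List.range M).map (fun k => (L.w (M + L.pos (L.w k)), L.w k)) ++
      (List.range (n - 1)).map (fun t => (L.w M, L.w (M + (t + 1)))) =
      (List.range' (M + (n - 1) - (M + (n - 1))) (M + (n - 1))).map L.contraction := by
    rw [Nat.sub_self, ← List.range_eq_range', List.range_add, List.map_append, List.map_map]
    congr 1
    · refine List.map_congr_left fun k hk => ?_
      rw [List.mem_range] at hk
      simp [contraction, hk]
    · refine List.map_congr_left fun k hk => ?_
      simp [contraction]
  rw [hlist]
  have hpath : ∀ r v, r ≤ M → M ≤ L.idx v → L.fibreMap r v = v := by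
    intro r v hr hv
    rw [L.fibreMap_of_le hr, if_neg (by omega)]
  refine IsQuotient.isSequence (G := G) (R := M + (n - 1)) L.fibreMap L.contraction
    ?_ ?_ ?_ ?_ ?_ ?_ ?_ _ le_rfl _ ?_
  · intro r hr
    by_cases h : r < M
    · have hlt := L.pos_lt (L.w r)
      refine ⟨L.w (M + L.pos (L.w r)), ?_⟩
      simp only [contraction, h, if_true]
      exact hpath _ _ h.le (by rw [L.idx_w _ (by omega)]; omega)
    · refine ⟨L.w (M + 0), ?_⟩
      rw [L.fibreMap_of_ge (by omega), L.pos_w 0 hn]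
      simp [contraction, h]
  · intro r hr
    by_cases h : r < M
    · refine ⟨L.w r, ?_⟩
      rw [L.fibreMap_of_le h.le, if_neg (by rw [L.idx_w _ (by omega)]; omega)]
      simp [contraction, h]
    · refine ⟨L.w (M + (r - M + 1)), ?_⟩
      rw [L.fibreMap_of_ge (by omega), L.pos_w _ (by omega)]
      simp [contraction, h]
  · intro r hr heq
    by_cases h : r < M
    · have hlt := L.pos_lt (L.w r)
      simp only [contraction, h, if_true] at heq
      have := L.w_inj (by omega) (by omega) heq
      omega
    · simp only [contraction, h, if_false] at heq
      have := L.w_inj (by omega) (by omega) heq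
      omega
  · intro r hr a ha
    by_cases h : r < M
    · rw [L.fibreMap_of_le h.le] at ha
      simp only [contraction, h, if_true] at ha ⊢
      split_ifs at ha with hlt
      · have hlt' := L.pos_lt a
        have := L.w_inj (by omega) (by omega) ha
        omega
      · subst ha
        rw [L.fibreMap_of_le h, L.idx_w _ (by omega), if_pos (by omega)]
    · rw [L.fibreMap_of_ge (by omega)] at ha ⊢
      simp only [contraction, h, if_false] at ha ⊢
      have hlt := L.pos_lt a
      have := L.w_pos_inj (by split_ifs <;> omega) (by omega) ha
      rw [if_pos, Nat.add_zero]
      split_ifs at this ; omega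
  · intro r hr a ha
    by_cases h : r < M
    · rw [L.fibreMap_of_le h.le] at ha
      rw [L.fibreMap_of_le h.le, L.fibreMap_of_le h]
      simp only [contraction, h, if_true] at ha
      by_cases h1 : L.idx a < r
      · rw [if_pos h1, if_pos (by omega)]
      · have h2 : L.idx a ≠ r := by
          intro h2
          rw [if_neg h1, ← h2, L.w_idx] at ha
          exact ha rfl
        rw [if_neg h1, if_neg (by omega)]
    · rw [L.fibreMap_of_ge (by omega)] at ha
      rw [L.fibreMap_of_ge (by omega), L.fibreMap_of_ge (by omega)]
      simp only [contraction, h, if_false] at ha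
      have hne : L.pos a ≠ r - M + 1 := by
        intro h'
        rw [if_neg (by omega), h'] at ha
        exact ha rfl
      congr 2
      split_ifs <;> omega
  · intro r _ T hT
    rcases le_total r M with h | h
    · exact L.redDegreeLE_of_le h hT
    · exact L.redDegreeLE_of_ge h hT
  · refine ⟨L.w M, ?_⟩
    have hconst : L.fibreMap (M + (n - 1)) = fun _ => L.w M := by
      funext v
      have := L.pos_lt v
      rw [L.fibreMap_of_ge (by omega), if_pos (by omega), Nat.add_zero]
    rw [hconst]
    have : Nonempty V := ⟨L.w 0⟩
    exact Set.range_const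
  · have h0 : L.fibreMap (M + (n - 1) - (M + (n - 1))) = fun v => v := by
      funext v
      rw [Nat.sub_self, L.fibreMap_of_le (Nat.zero_le _), if_neg (Nat.not_lt_zero _)]
    rw [h0]
    exact isQuotient_ofGraph G

end PathLayout

end Trigraph

/-! ### The subdivided graph with two triangles -/

/-- The vertices of the graph that is built from a graph on `n` vertices: for each ordered pair
`(i, j)` the `n` inner vertices `sub i j k` of a path from `i` to `j`; the four additional vertices
of the two triangles; the original vertices `branch i`; and `n` isolated vertices `spine i`, which
serve for the contraction sequence only. -/
inductive SubdivVertex (n : ℕ) : Type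
  | sub (i j k : Fin n) : SubdivVertex n
  | tri (e b : Bool) : SubdivVertex n
  | branch (i : Fin n) : SubdivVertex n
  | spine (i : Fin n) : SubdivVertex n

namespace SubdivVertex

variable {n : ℕ}

/-- The number of a vertex in the list of all vertices. -/
def idx : SubdivVertex n → ℕ
  | sub i j k => (i * n + j) * n + k
  | tri e b => n * n * n + (2 * e.toNat + b.toNat)
  | branch i => n * n * n + 4 + i
  | spine i => n * n * n + 4 + n + i

/-- The position of a vertex on the path formed by the spine. The vertices `sub i j k`, for
`k = 0, …, n - 1`, move from `i` straight to `j` and stay there. -/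
def pos (u v : Fin n) : SubdivVertex n → ℕ
  | sub i j k => max (min (i + k) j) (i - k)
  | tri e _ => bif e then v else u
  | branch i => i
  | spine i => i

/-- The number of vertices outside the spine. -/
def numNonspine (n : ℕ) : ℕ := n * n * n + 4 + n

/-- All the vertices outside the spine, in the order of `idx`. -/
def nonspineList (n : ℕ) : List (SubdivVertex n) :=
  ((List.finRange n).flatMap fun i => (List.finRange n).flatMap fun j =>
    (List.finRange n).map fun k => sub i j k) ++
  ([tri false false, tri false true, tri true false, tri true true] ++
    (List.finRange n).map branch)

/-- All the vertices, in the order of `idx`. -/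
def list (n : ℕ) : List (SubdivVertex n) := nonspineList n ++ (List.finRange n).map spine

theorem flatMap_range_mul (a b : ℕ) :
    ((List.range a).flatMap fun i => (List.range b).map fun j => i * b + j) =
      List.range (a * b) := by
  induction a with
  | zero => simp
  | succ a ih =>
    rw [List.range_succ, List.flatMap_append, ih, add_mul, one_mul, List.range_add]
    simp

theorem flatMap_finRange {α : Type} (f : ℕ → List α) :
    (List.finRange n).flatMap (fun i : Fin n => f i) = (List.range n).flatMap f := by
  rw [List.flatMap_def, List.flatMap_def, map_finRange]

theorem map_idx_nonspineList : (nonspineList n).map idx = List.range (numNonspine n) := by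
  have h1 : ((List.finRange n).flatMap fun i => (List.finRange n).flatMap fun j =>
      (List.finRange n).map fun k => idx (sub i j k)) = List.range (n * n * n) := by
    simp only [idx]
    have h : ∀ i j : ℕ, (List.finRange n).map (fun k : Fin n => (i * n + j) * n + (k : ℕ)) =
        (List.range n).map fun k => (i * n + j) * n + k :=
      fun i j => map_finRange fun k => (i * n + j) * n + k
    simp only [h]
    have h : ∀ i : ℕ, ((List.finRange n).flatMap fun j : Fin n =>
        (List.range n).map fun k => (i * n + (j : ℕ)) * n + k) =
        (List.range n).flatMap fun j => (List.range n).map fun k => (i * n + j) * n + k :=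
      fun i => flatMap_finRange fun j => (List.range n).map fun k => (i * n + j) * n + k
    simp only [h]
    rw [flatMap_finRange fun i => (List.range n).flatMap fun j =>
      (List.range n).map fun k => (i * n + j) * n + k]
    rw [← flatMap_range_mul (n * n) n, ← flatMap_range_mul n n, List.flatMap_assoc]
    simp [List.flatMap_map]
  have h2 : (List.finRange n).map (fun i => idx (branch i)) =
      (List.range n).map fun i => n * n * n + 4 + i := map_finRange fun i => n * n * n + 4 + i
  rw [nonspineList, numNonspine, List.range_add, List.range_add, ← h1]
  simp only [List.map_append, List.map_flatMap, List.map_map, Function.comp_def, h2,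
    List.append_assoc]
  rfl

theorem map_idx_list : (list n).map idx = List.range (numNonspine n + n) := by
  rw [list, List.map_append, map_idx_nonspineList, List.range_add, List.map_map]
  congr 1
  exact map_finRange fun i => numNonspine n + i

theorem mem_list (x : SubdivVertex n) : x ∈ list n := by
  cases x with
  | sub i j k => simp [list, nonspineList]
  | tri e b => cases e <;> cases b <;> simp [list, nonspineList]
  | branch i => simp [list, nonspineList]
  | spine i => simp [list, nonspineList]

theorem length_list : (list n).length = numNonspine n + n := by
  simpa using congrArg List.length (map_idx_list (n := n))

theorem idx_getElem (k : ℕ) (hk : k < (list n).length) : idx (list n)[k] = k := by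
  have := congrArg (fun l => l[k]?) (map_idx_list (n := n))
  simpa [hk, ← length_list] using this

theorem idx_lt (x : SubdivVertex n) : idx x < numNonspine n + n := by
  have := List.mem_map_of_mem (f := idx) (mem_list x)
  rwa [map_idx_list, List.mem_range] at this

theorem getElem_idx (x : SubdivVertex n) (h : idx x < (list n).length) : (list n)[idx x] = x := by
  obtain ⟨k, hk, rfl⟩ := List.getElem_of_mem (mem_list x)
  simp only [idx_getElem]

/-- The numbering of the vertices. -/
def equiv (n : ℕ) : Fin (numNonspine n + n) ≃ SubdivVertex n where
  toFun k := (list n)[k]'(k.2.trans_eq length_list.symm)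
  invFun x := ⟨idx x, idx_lt x⟩
  left_inv _ := Fin.ext (idx_getElem _ _)
  right_inv x := getElem_idx x _

theorem idx_equiv (k : Fin (numNonspine n + n)) : idx (equiv n k) = k :=
  idx_getElem _ _

/-- The pairs of adjacent vertices, each in one of its two orders. -/
def Rel (G : SimpleGraph (Fin n)) (u v : Fin n) : SubdivVertex n → SubdivVertex n → Prop
  | sub i j k, sub i' j' k' => i = i' ∧ j = j' ∧ (k : ℕ) + 1 = k'
  | branch a, sub i j k => (a = i ∧ (k : ℕ) = 0) ∨ (a = j ∧ (k : ℕ) + 1 = n ∧ G.Adj i j)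
  | tri e b, tri e' b' => e = e' ∧ b = false ∧ b' = true
  | branch a, tri e _ => a = bif e then v else u
  | _, _ => False

/-- The graph `G` with each edge `ij` replaced by two paths from `i` to `j` (one for each of the
ordered pairs `(i, j)` and `(j, i)`) with `n` inner vertices each, and with triangles attached at
`u` and at `v`. If `i` and `j` are not adjacent then the path of `(i, j)` is there, too, but it is
attached at `i` only; this makes the vertex set independent of `G`. -/
def graph (G : SimpleGraph (Fin n)) (u v : Fin n) : SimpleGraph (SubdivVertex n) where
  Adj x y := Rel G u v x y ∨ Rel G u v y x
  symm := ⟨fun _ _ h => h.symm⟩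
  loopless := ⟨by rintro (⟨i, j, k⟩ | ⟨e, b⟩ | ⟨i⟩ | ⟨i⟩) h <;> simp [Rel] at h⟩

variable {G : SimpleGraph (Fin n)} {u v : Fin n}

theorem pos_lt (x : SubdivVertex n) : pos u v x < n := by
  cases x with
  | tri e b => cases e <;> simp [pos]
  | _ => simp only [pos]; omega

theorem idx_sub_lt (i j k : Fin n) : idx (sub i j k) < n * n * n := by
  have h1 : (i : ℕ) * n + j < n * n := by
    calc (i : ℕ) * n + j < i * n + n := by omega
      _ = (i + 1) * n := by ring
      _ ≤ n * n := Nat.mul_le_mul_right _ i.2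
  calc ((i : ℕ) * n + j) * n + k < (i * n + j) * n + n := by omega
    _ = (i * n + j + 1) * n := by ring
    _ ≤ n * n * n := Nat.mul_le_mul_right _ h1

theorem pos_of_rel {x y : SubdivVertex n} (h : Rel G u v x y) :
    pos u v x ≤ pos u v y + 1 ∧ pos u v y ≤ pos u v x + 1 := by
  rcases x with ⟨i, j, k⟩ | ⟨e, b⟩ | ⟨i⟩ | ⟨i⟩ <;>
    rcases y with ⟨i', j', k'⟩ | ⟨e', b'⟩ | ⟨i'⟩ | ⟨i'⟩ <;> simp only [Rel] at h
  · obtain ⟨rfl, rfl, h⟩ := h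
    simp only [pos]
    omega
  · obtain ⟨rfl, -, -⟩ := h
    simp [pos]
  · simp only [pos]
    rcases h with ⟨rfl, h⟩ | ⟨rfl, h, -⟩ <;> omega
  · subst h
    cases e' <;> simp [pos]

theorem pos_of_rel_branch_sub {a i j k : Fin n} (h : Rel G u v (branch a) (sub i j k)) :
    pos u v (sub i j k) = a := by
  simp only [pos]
  rcases h with ⟨rfl, h⟩ | ⟨rfl, h, -⟩ <;> omega

theorem idx_lt_of_adj {x y : SubdivVertex n} (h : (graph G u v).Adj x y) :
    idx x < numNonspine n := by
  rcases x with ⟨i, j, k⟩ | ⟨e, b⟩ | ⟨i⟩ | ⟨i⟩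
  · have := idx_sub_lt i j k
    rw [numNonspine]
    omega
  · simp only [idx, numNonspine]
    have := e.toNat_le
    have := b.toNat_le
    omega
  · simp only [idx, numNonspine]
    omega
  · exfalso
    cases y <;> simp [graph, Rel] at h

theorem later_of_adj {x y : SubdivVertex n} (h : (graph G u v).Adj x y) (hlt : idx x < idx y) :
    idx y = idx x + 1 ∨ ∃ a, y = branch a ∧ (a : ℕ) = pos u v x := by
  rcases x with ⟨i, j, k⟩ | ⟨e, b⟩ | ⟨i⟩ | ⟨i⟩ <;>
    rcases y with ⟨i', j', k'⟩ | ⟨e', b'⟩ | ⟨i'⟩ | ⟨i'⟩ <;>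
    simp only [graph, Rel, or_false, false_or] at h
  · left
    rcases h with ⟨rfl, rfl, h⟩ | ⟨rfl, rfl, h⟩ <;> simp only [idx] at hlt ⊢ <;> omega
  · exact Or.inr ⟨i', rfl, (pos_of_rel_branch_sub (G := G) (u := u) (v := v) h).symm⟩
  · left
    rcases h with ⟨rfl, rfl, rfl⟩ | ⟨rfl, rfl, rfl⟩ <;> simp [idx] at hlt ⊢
    omega
  · subst h
    exact Or.inr ⟨_, rfl, by cases e <;> rfl⟩
  · have := idx_sub_lt i' j' k'
    simp only [idx] at hlt this
    omega
  · have := e'.toNat_le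
    have := b'.toNat_le
    simp only [idx] at hlt
    omega

variable (G u v)

/-- The same graph, on the numbers of its vertices. -/
def finGraph : SimpleGraph (Fin (numNonspine n + n)) := (graph G u v).comap (equiv n)

/-- The layout of the graph along the spine. The hub of a position is the vertex of `G` with this
number: it follows, in the list, the inner vertices and the triangles at that position. -/
def layout : Trigraph.PathLayout (finGraph G u v) (numNonspine n) n where
  w k := if h : k < numNonspine n + n then ⟨k, h⟩ else (equiv n).symm (branch u)
  idx k := k
  pos k := pos u v (equiv n k)
  hub t := if h : t < n then (equiv n).symm (branch ⟨t, h⟩) else (equiv n).symm (branch u)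
  idx_w k hk := by simp [hk]
  w_idx k := by simp
  idx_lt k := k.2
  pos_lt k := pos_lt _
  pos_w t ht := by
    have h : (⟨numNonspine n + t, by omega⟩ : Fin (numNonspine n + n)) =
        (equiv n).symm (spine ⟨t, ht⟩) := rfl
    simp only [Nat.add_lt_add_iff_left, ht, dite_true, h, Equiv.apply_symm_apply]
    rfl
  idx_lt_of_adj {a b} h := by
    have := idx_lt_of_adj h
    rwa [idx_equiv] at this
  pos_le_of_adj {a b} h := by
    rcases h with h | h
    · exact (pos_of_rel h).1
    · exact (pos_of_rel h).2
  later_of_adj {a b} h hlt := by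
    rw [← idx_equiv a, ← idx_equiv b] at hlt
    rcases later_of_adj h hlt with h | ⟨c, hc, hc'⟩
    · left
      rwa [idx_equiv, idx_equiv] at h
    · right
      simp only [← hc', c.2, dite_true, Fin.eta]
      rw [← hc, Equiv.symm_apply_apply]

/-- The graph together with the contraction sequence along its spine, as an instance of Mutually
Induced Packing. -/
def inst : GraphWithSequence 4 where
  n := numNonspine n + n
  graph := finGraph G u v
  contractions := _
  isSequence := (layout G u v).isSequence u.pos

theorem encPairList_contractions : encPairList (inst G u v).contractions =
    encList (((nonspineList n).map fun x => Data.pair (encNat (numNonspine n + pos u v x))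
      (encNat (idx x))) ++ (List.finRange (n - 1)).map fun t : Fin (n - 1) =>
        Data.pair (encNat (numNonspine n)) (encNat (numNonspine n + (t + 1)))) := by
  have hn := u.pos
  simp only [inst, encPairList, List.map_append, List.map_map]
  congr 2
  · rw [← map_idx_nonspineList, List.map_map]
    refine List.map_congr_left fun x _ => ?_
    have h1 : (layout G u v).w (idx x) = (equiv n).symm x := by
      simp [layout, idx_lt x]
      rfl
    have h2 : (layout G u v).pos ((equiv n).symm x) = pos u v x := by
      simp [layout]
    have h3 : ((layout G u v).w (numNonspine n + pos u v x) : ℕ) = numNonspine n + pos u v x :=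
      (layout G u v).idx_w _ (by have := pos_lt (u := u) (v := v) x; omega)
    simp only [Function.comp_apply, h1, h2, h3]
    rfl
  · rw [map_finRange (n := n - 1) fun t =>
        Data.pair (encNat (numNonspine n)) (encNat (numNonspine n + (t + 1)))]
    refine List.map_congr_left fun t ht => ?_
    rw [List.mem_range] at ht
    have h1 : ((layout G u v).w (numNonspine n) : ℕ) = numNonspine n :=
      (layout G u v).idx_w _ (by omega)
    have h2 : ((layout G u v).w (numNonspine n + (t + 1)) : ℕ) = numNonspine n + (t + 1) :=
      (layout G u v).idx_w _ (by omega)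
    simp only [Function.comp_apply, h1, h2]

theorem encGraph_inst : encGraph (inst G u v).graph =
    encList ((list n).map fun x => encList ((list n).map fun y =>
      encBit ((graph G u v).Adj x y))) := by
  have h : ∀ f : SubdivVertex n → Data,
      (List.ofFn fun k : Fin (numNonspine n + n) => f (equiv n k)) = (list n).map f := by
    intro f
    refine List.ext_getElem (by simp [length_list]) fun k h1 h2 => ?_
    simp [equiv]
  rw [encGraph, ← h]
  congr 2
  funext k
  exact congrArg encList (h fun y => encBit ((graph G u v).Adj (equiv n k) y))

end SubdivVertex

/-! ### The reduction is polynomial-time -/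

theorem PolyTime.nat_ite {I : Type} {e : I → Data} {P : I → Prop} [∀ i, Decidable (P i)]
    {a b : I → ℕ} (hP : PolyTime e (fun i => encBit (P i)))
    (ha : PolyTime e (fun i => encNat (a i))) (hb : PolyTime e (fun i => encNat (b i))) :
    PolyTime e (fun i => encNat (if P i then a i else b i)) := by
  refine (hP.ite ha hb).congr fun i => ?_
  split_ifs <;> rfl

theorem PolyTime.order {I : Type} {e : I → Data} {n : I → ℕ} {G : ∀ i, SimpleGraph (Fin (n i))}
    (hG : PolyTime e (fun i => encGraph (G i))) : PolyTime e (fun i => encNat (n i)) :=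
  hG.length.congr fun i => by simp

namespace SubdivVertex

variable {n : ℕ}

/-- The kind of a vertex. -/
def tag : SubdivVertex n → ℕ
  | sub _ _ _ => 0
  | tri _ _ => 1
  | branch _ => 2
  | spine _ => 3

/-- The first parameter of a vertex. -/
def fst : SubdivVertex n → ℕ
  | sub i _ _ => i
  | tri e _ => e.toNat
  | branch i => i
  | spine i => i

/-- The second parameter of a vertex, if there is one. -/
def snd : SubdivVertex n → ℕ
  | sub _ j _ => j
  | tri _ b => b.toNat
  | _ => 0

/-- The third parameter of a vertex, if there is one. -/
def thd : SubdivVertex n → ℕ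
  | sub _ _ k => k
  | _ => 0

/-- The encoding of a vertex as a datum. -/
def enc (x : SubdivVertex n) : Data :=
  Data.pair (encNat x.tag) (Data.pair (encNat x.fst) (Data.pair (encNat x.snd) (encNat x.thd)))

theorem pos_eq (u v : Fin n) (x : SubdivVertex n) : pos u v x =
    if x.tag = 1 then if x.fst = 1 then (v : ℕ) else u
    else if x.tag = 0 then max (min (x.fst + x.thd) x.snd) (x.fst - x.thd) else x.fst := by
  cases x with
  | tri e b => cases e <;> simp [pos, tag, fst]
  | _ => simp [pos, tag, fst, snd, thd]

theorem idx_eq (x : SubdivVertex n) : idx x =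
    if x.tag = 0 then (x.fst * n + x.snd) * n + x.thd
    else n * n * n + if x.tag = 1 then 2 * x.fst + x.snd
      else 4 + if x.tag = 2 then x.fst else n + x.fst := by
  cases x <;> simp [idx, tag, fst, snd, thd, add_assoc]

theorem rel_iff (G : SimpleGraph (Fin n)) (u v : Fin n) (x y : SubdivVertex n) : Rel G u v x y ↔
    (y.tag = 0 ∧ ((x.tag = 0 ∧ x.fst = y.fst ∧ x.snd = y.snd ∧ x.thd + 1 = y.thd) ∨
      (x.tag = 2 ∧ ((x.fst = y.fst ∧ y.thd = 0) ∨ (x.fst = y.snd ∧ y.thd + 1 = n ∧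
        ∃ (h : y.fst < n) (h' : y.snd < n), G.Adj ⟨y.fst, h⟩ ⟨y.snd, h'⟩))))) ∨
    (y.tag = 1 ∧ ((x.tag = 1 ∧ x.fst = y.fst ∧ x.snd = 0 ∧ y.snd = 1) ∨
      (x.tag = 2 ∧ ((y.fst = 1 ∧ x.fst = v) ∨ (y.fst = 0 ∧ x.fst = u))))) := by
  rcases x with ⟨i, j, k⟩ | ⟨e, b⟩ | ⟨i⟩ | ⟨i⟩ <;>
    rcases y with ⟨i', j', k'⟩ | ⟨e', b'⟩ | ⟨i'⟩ | ⟨i'⟩ <;>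
    simp [Rel, tag, fst, snd, thd, Fin.ext_iff]
  · cases e <;> cases e' <;> cases b <;> cases b' <;> simp
  · cases e' <;> simp

variable {I : Type} {e : I → Data} {n : I → ℕ}

/-- The parameters of a vertex can be read off its encoding. -/
theorem polyTime_coords {x : ∀ i, SubdivVertex (n i)} (hx : PolyTime e (fun i => (x i).enc)) :
    PolyTime e (fun i => encNat (x i).tag) ∧ PolyTime e (fun i => encNat (x i).fst) ∧
    PolyTime e (fun i => encNat (x i).snd) ∧ PolyTime e (fun i => encNat (x i).thd) :=
  ⟨hx.fst, hx.snd.fst, hx.snd.snd.fst, hx.snd.snd.snd⟩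

theorem polyTime_enc {x : ∀ i, SubdivVertex (n i)} (h0 : PolyTime e (fun i => encNat (x i).tag))
    (h1 : PolyTime e (fun i => encNat (x i).fst)) (h2 : PolyTime e (fun i => encNat (x i).snd))
    (h3 : PolyTime e (fun i => encNat (x i).thd)) : PolyTime e (fun i => (x i).enc) :=
  h0.pair (h1.pair (h2.pair h3))

theorem polyTime_idx (hn : PolyTime e (fun i => encNat (n i))) {x : ∀ i, SubdivVertex (n i)}
    (hx : PolyTime e (fun i => (x i).enc)) : PolyTime e (fun i => encNat (idx (x i))) := by
  obtain ⟨h0, h1, h2, h3⟩ := polyTime_coords hx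
  have c : ∀ k, PolyTime e (fun _ => encNat k) := fun k => PolyTime.const e _
  simp only [idx_eq]
  exact (h0.eq (c 0)).nat_ite ((((h1.mul hn).add h2).mul hn).add h3)
    (((hn.mul hn).mul hn).add ((h0.eq (c 1)).nat_ite (((c 2).mul h1).add h2)
      ((c 4).add ((h0.eq (c 2)).nat_ite h1 (hn.add h1)))))

theorem polyTime_pos {u v : ∀ i, Fin (n i)} (hu : PolyTime e (fun i => encNat (u i)))
    (hv : PolyTime e (fun i => encNat (v i))) {x : ∀ i, SubdivVertex (n i)}
    (hx : PolyTime e (fun i => (x i).enc)) :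
    PolyTime e (fun i => encNat (pos (u i) (v i) (x i))) := by
  obtain ⟨h0, h1, h2, h3⟩ := polyTime_coords hx
  have c : ∀ k, PolyTime e (fun _ => encNat k) := fun k => PolyTime.const e _
  simp only [pos_eq]
  exact (h0.eq (c 1)).nat_ite ((h1.eq (c 1)).nat_ite hv hu)
    ((h0.eq (c 0)).nat_ite (((h1.add h3).min h2).max (h1.sub h3)) h1)

theorem polyTime_rel {G : ∀ i, SimpleGraph (Fin (n i))} {u v : ∀ i, Fin (n i)}
    (hG : PolyTime e (fun i => encGraph (G i))) (hu : PolyTime e (fun i => encNat (u i)))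
    (hv : PolyTime e (fun i => encNat (v i))) {x y : ∀ i, SubdivVertex (n i)}
    (hx : PolyTime e (fun i => (x i).enc)) (hy : PolyTime e (fun i => (y i).enc)) :
    PolyTime e (fun i => encBit (Rel (G i) (u i) (v i) (x i) (y i))) := by
  obtain ⟨h0, h1, h2, h3⟩ := polyTime_coords hx
  obtain ⟨k0, k1, k2, k3⟩ := polyTime_coords hy
  have c : ∀ k, PolyTime e (fun _ => encNat k) := fun k => PolyTime.const e _
  simp only [rel_iff]
  exact ((k0.eq (c 0)).and (((h0.eq (c 0)).and ((h1.eq k1).and ((h2.eq k2).and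
      ((h3.add (c 1)).eq k3)))).or ((h0.eq (c 2)).and (((h1.eq k1).and (k3.eq (c 0))).or
        ((h1.eq k2).and (((k3.add (c 1)).eq hG.order).and (hG.adj k1 k2))))))).or
    ((k0.eq (c 1)).and (((h0.eq (c 1)).and ((h1.eq k1).and ((h2.eq (c 0)).and (k2.eq (c 1))))).or
      ((h0.eq (c 2)).and (((k1.eq (c 1)).and (h1.eq hv)).or ((k1.eq (c 0)).and (h1.eq hu))))))

/-- The encodings of the elements of `Fin n`. -/
abbrev encFin (n : I → ℕ) (i : I) (k : Fin (n i)) : Data := encNat k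

theorem polyTime_nonspineList (hn : PolyTime e (fun i => encNat (n i))) :
    PolyTime e (fun i => encList ((nonspineList (n i)).map enc)) := by
  have c : ∀ {J : Type} {e : J → Data} (k : ℕ), PolyTime e (fun _ => encNat k) :=
    fun k => PolyTime.const _ _
  have h1 : PolyTime e (fun i => encList ((List.finRange (n i)).map (encFin n i))) := hn.range
  have h2 := h1.lift (encFin n)
  have h3 := h2.lift fun q : Σ i, Fin (n i) => fun k : Fin (n q.1) => encNat k
  have a1 := PolyTime.last e (encFin n)
  have a2 := a1.lift fun q : Σ i, Fin (n i) => fun k : Fin (n q.1) => encNat k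
  have a3 := a2.lift fun q : Σ q : Σ i, Fin (n i), Fin (n q.1) =>
    fun k : Fin (n q.1.1) => encNat k
  have b2 := PolyTime.last (fun q : Σ i, Fin (n i) => Data.pair (e q.1) (encNat q.2))
    fun q : Σ i, Fin (n i) => fun k : Fin (n q.1) => encNat k
  have c3 := PolyTime.last (fun q : Σ q : Σ i, Fin (n i), Fin (n q.1) =>
    Data.pair (Data.pair (e q.1.1) (encNat q.1.2)) (encNat q.2))
    fun q : Σ q : Σ i, Fin (n i), Fin (n q.1) => fun k : Fin (n q.1.1) => encNat k
  have b3 := b2.lift fun q : Σ q : Σ i, Fin (n i), Fin (n q.1) =>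
    fun k : Fin (n q.1.1) => encNat k
  have hsub := PolyTime.flatMap
    (g := fun i a => (List.finRange (n i)).flatMap fun b =>
      (List.finRange (n i)).map fun k => (sub a b k).enc) h1
    (PolyTime.flatMap (g := fun q b =>
      (List.finRange (n q.1)).map fun k => (sub q.2 b k).enc) h2
      (PolyTime.map (g := fun q k => (sub q.1.2 q.2 k).enc) h3
        (polyTime_enc (x := fun q : Σ q : Σ q : Σ i, Fin (n i), Fin (n q.1), Fin (n q.1.1) =>
          sub q.1.1.2 q.1.2 q.2) (c 0) a3 b3 c3)))
  have htri : PolyTime e (fun i => encList (([tri false false, tri false true, tri true false,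
      tri true true] : List (SubdivVertex (n i))).map enc)) :=
    (PolyTime.const e (encList (([tri false false, tri false true, tri true false,
      tri true true] : List (SubdivVertex 0)).map enc))).congr fun i => rfl
  have hbranch := PolyTime.map (g := fun i a => (branch a).enc) h1
    (polyTime_enc (x := fun q : Σ i, Fin (n i) => branch q.2) (c 2) a1 (c 0) (c 0))
  refine (hsub.append (htri.append hbranch)).congr fun i => ?_
  simp [nonspineList, List.map_flatMap, Function.comp_def]

theorem polyTime_list (hn : PolyTime e (fun i => encNat (n i))) :
    PolyTime e (fun i => encList ((list (n i)).map enc)) := by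
  have c : ∀ {J : Type} {e : J → Data} (k : ℕ), PolyTime e (fun _ => encNat k) :=
    fun k => PolyTime.const _ _
  have h1 : PolyTime e (fun i => encList ((List.finRange (n i)).map (encFin n i))) := hn.range
  have hspine := PolyTime.map (g := fun i a => (spine a).enc) h1
    (polyTime_enc (x := fun q : Σ i, Fin (n i) => spine q.2) (c 3)
    (PolyTime.last e (encFin n)) (c 0) (c 0))
  refine ((polyTime_nonspineList hn).append hspine).congr fun i => ?_
  simp [list, Function.comp_def]

theorem polyTime_inst {G : ∀ i, SimpleGraph (Fin (n i))} {u v : ∀ i, Fin (n i)}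
    (hG : PolyTime e (fun i => encGraph (G i))) (hu : PolyTime e (fun i => encNat (u i)))
    (hv : PolyTime e (fun i => encNat (v i))) :
    PolyTime e (fun i => (mutuallyInducedPacking decoratedPaths 4).encInst
      (inst (G i) (u i) (v i))) := by
  have hn := hG.order
  have c : ∀ {J : Type} {e : J → Data} (k : ℕ), PolyTime e (fun _ => encNat k) :=
    fun k => PolyTime.const _ _
  have hN : PolyTime e (fun i => encNat (numNonspine (n i))) :=
    (((hn.mul hn).mul hn).add (c 4)).add hn
  refine PolyTime.pair ?_ ?_
  · simp only [encGraph_inst]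
    let E : ∀ i, SubdivVertex (n i) → Data := fun _ x => x.enc
    let F : ∀ q : Σ i, SubdivVertex (n i), SubdivVertex (n q.1) → Data := fun _ x => x.enc
    have hl := polyTime_list hn
    have hx := (PolyTime.last e E).lift F
    have hy := PolyTime.last (fun q : Σ i, SubdivVertex (n i) => Data.pair (e q.1) (E q.1 q.2)) F
    have hG' := (hG.lift E).lift F
    have hu' := (hu.lift E).lift F
    have hv' := (hv.lift E).lift F
    exact PolyTime.map (enc := E) hl (PolyTime.map (enc := F) (hl.lift E)
      ((polyTime_rel hG' hu' hv' hx hy).or (polyTime_rel hG' hu' hv' hy hx)))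
  · simp only [encPairList_contractions]
    let E : ∀ i, SubdivVertex (n i) → Data := fun _ x => x.enc
    have hx := PolyTime.last e E
    have hm : PolyTime e (fun i => encNat (n i - 1)) := hn.sub (c 1)
    refine (PolyTime.map (enc := E) (polyTime_nonspineList hn)
      (((hN.lift E).add (polyTime_pos (hu.lift E) (hv.lift E) hx)).pair
        (polyTime_idx (hn.lift E) hx))).append ?_
    let F : ∀ i, Fin (n i - 1) → Data := fun _ t => encNat t
    exact PolyTime.map (enc := F) hm.range
      ((hN.lift F).pair ((hN.lift F).add ((PolyTime.last e F).add (c 1))))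

end SubdivVertex

/-! ### From paths to packings -/

theorem IsMutuallyInducedPacking.comap {V V' ι : Type} {W : ι → Type}
    {H : ∀ i, SimpleGraph (W i)} {G : SimpleGraph V} {S : Finset V}
    (h : IsMutuallyInducedPacking H G S) (E : V' ≃ V) :
    IsMutuallyInducedPacking H (G.comap E) (S.map E.symm.toEmbedding) := by
  obtain ⟨C, h1, h2, h3⟩ := h
  refine ⟨(fun A => E ⁻¹' A) '' C, ?_, ?_, ?_⟩
  · ext x
    have := Set.ext_iff.1 h1 (E x)
    simp only [Finset.mem_coe, Set.mem_sUnion] at this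
    simp [this]
  · rintro _ ⟨A, hA, rfl⟩
    obtain ⟨i, ⟨φ⟩⟩ := h2 A hA
    refine ⟨i, ⟨RelIso.trans (s := (G.induce A).Adj)
      ⟨⟨fun x => ⟨E x.1, x.2⟩, fun x => ⟨E.symm x.1, by simp⟩,
        fun x => by simp, fun x => by simp⟩, ?_⟩ φ⟩⟩
    intro a b
    rfl
  · rintro _ ⟨A, hA, rfl⟩ _ ⟨B, hB, rfl⟩ hAB
    obtain ⟨h4, h5⟩ := h3 A hA B hB fun h => hAB (by rw [h])
    exact ⟨h4.preimage E, fun a ha b hb => h5 _ ha _ hb⟩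

/-- The image of a decorated path under an embedding is a packing with a single component. -/
theorem isMutuallyInducedPacking_image {V : Type} [DecidableEq V] {G : SimpleGraph V} (m : ℕ+)
    (f : Fin m ⊕ (Bool × Bool) → V) (hf : Function.Injective f)
    (hadj : ∀ s t, G.Adj (f s) (f t) ↔ (decoratedPath m).Adj s t) :
    IsMutuallyInducedPacking decoratedPaths G (Finset.univ.image f) := by
  refine ⟨{Set.range f}, by simp, ?_, ?_⟩
  · rintro A rfl
    refine ⟨m, ⟨RelIso.symm ⟨Equiv.ofInjective f hf, ?_⟩⟩⟩
    intro a b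
    exact hadj a b
  · rintro A rfl B rfl h
    exact absurd rfl h

namespace SubdivVertex

variable {n : ℕ}

/-- The vertices of the subdivision of the path `x 0, x 1, …`: the vertex at distance `r ≤ n`
behind `x c`. -/
def onPath (x : ℕ → Fin n) (c r : ℕ) : SubdivVertex n :=
  if h : 1 ≤ r ∧ r ≤ n then sub (x c) (x (c + 1)) ⟨r - 1, by omega⟩ else branch (x c)

theorem mul_add_inj {n c r c' r' : ℕ} (hr : r ≤ n) (hr' : r' ≤ n)
    (h : c * (n + 1) + r = c' * (n + 1) + r') : c = c' ∧ r = r' := by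
  have h1 : ∀ c r, r ≤ n → (c * (n + 1) + r) / (n + 1) = c ∧ (c * (n + 1) + r) % (n + 1) = r := by
    intro c r hr
    have := Nat.lt_succ_of_le hr
    constructor
    · rw [mul_comm, Nat.mul_add_div (by omega), Nat.div_eq_of_lt this, add_zero]
    · rw [mul_comm, Nat.mul_add_mod, Nat.mod_eq_of_lt this]
  obtain ⟨h2, h3⟩ := h1 c r hr
  obtain ⟨h4, h5⟩ := h1 c' r' hr'
  exact ⟨by rw [← h2, h, h4], by rw [← h3, h, h5]⟩

variable {G : SimpleGraph (Fin n)} {x : ℕ → Fin n} {L : ℕ}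

theorem rel_onPath (hx : ∀ c ≤ L, ∀ c' ≤ L, x c = x c' → c = c') {u v : Fin n}
    {c r c' r' : ℕ} (hc : c ≤ L) (hcr : 1 ≤ r → c < L) (hr : r ≤ n) (hc' : c' ≤ L)
    (hcr' : 1 ≤ r' → c' < L) (hr' : r' ≤ n)
    (h : Rel G u v (onPath x c r) (onPath x c' r')) :
    c * (n + 1) + r + 1 = c' * (n + 1) + r' ∨ c' * (n + 1) + r' + 1 = c * (n + 1) + r := by
  unfold onPath at h
  split_ifs at h with h1 h2 h2
  · obtain ⟨h3, -, h4⟩ := h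
    have := hx c hc c' hc' h3
    subst this
    simp only at h4
    left
    omega
  · exact h.elim
  · have hr0 : r = 0 := by omega
    subst hr0
    have := hcr' h2.1
    rcases h with ⟨h3, h4⟩ | ⟨h3, h4, -⟩
    · have := hx c hc c' hc' h3
      subst this
      simp only at h4
      left
      omega
    · have := hx c hc (c' + 1) (by omega) h3
      subst this
      simp only at h4
      right
      rw [add_mul]
      omega
  · exact h.elim

theorem adj_onPath_succ (hadj : ∀ c < L, G.Adj (x c) (x (c + 1))) {u v : Fin n}
    {c r c' r' : ℕ} (hr : r ≤ n) (hcr : 1 ≤ r → c < L) (hr' : r' ≤ n) (hcr' : 1 ≤ r' → c' < L)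
    (h : c * (n + 1) + r + 1 = c' * (n + 1) + r') :
    (graph G u v).Adj (onPath x c r) (onPath x c' r') := by
  have hn := u.pos
  by_cases h1 : r = n
  · obtain ⟨rfl, rfl⟩ := mul_add_inj (c := c + 1) (r := 0) (Nat.zero_le _) hr'
      (by rw [← h, add_mul]; omega)
    right
    rw [onPath, dif_neg (by omega), onPath, dif_pos (by omega)]
    exact Or.inr ⟨rfl, by simp only; omega, hadj c (hcr (by omega))⟩
  · obtain ⟨rfl, rfl⟩ := mul_add_inj (r := r + 1) (by omega) hr' h
    left
    by_cases h2 : r = 0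
    · subst h2
      rw [onPath, dif_neg (by omega), onPath, dif_pos (by omega)]
      exact Or.inl ⟨rfl, rfl⟩
    · rw [onPath, dif_pos (by omega), onPath, dif_pos (by omega)]
      refine ⟨rfl, rfl, ?_⟩
      simp only
      omega

/-- A path of length `L` in the graph `G` gives a decorated path, in the subdivided graph with
triangles attached at the ends of the path. -/
theorem exists_packing_of_path (hx : ∀ c ≤ L, ∀ c' ≤ L, x c = x c' → c = c')
    (hadj : ∀ c < L, G.Adj (x c) (x (c + 1))) : ∃ S : Finset (SubdivVertex n),
    IsMutuallyInducedPacking decoratedPaths (graph G (x 0) (x L)) S ∧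
      S.card = L * (n + 1) + 5 := by
  classical
  let f : Fin (L * (n + 1) + 1) ⊕ (Bool × Bool) → SubdivVertex n
    | .inl q => onPath x (q / (n + 1)) (q % (n + 1))
    | .inr (e, b) => tri e b
  have hq : ∀ q : Fin (L * (n + 1) + 1), (q : ℕ) / (n + 1) ≤ L ∧
      (1 ≤ (q : ℕ) % (n + 1) → (q : ℕ) / (n + 1) < L) ∧ (q : ℕ) % (n + 1) ≤ n ∧
      (q : ℕ) / (n + 1) * (n + 1) + (q : ℕ) % (n + 1) = q := by
    intro q
    have h1 : (q : ℕ) / (n + 1) * (n + 1) + (q : ℕ) % (n + 1) = q := Nat.div_add_mod' _ _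
    have h2 : (q : ℕ) % (n + 1) < n + 1 := Nat.mod_lt _ (by omega)
    have h3 : (q : ℕ) / (n + 1) ≤ L := by
      rw [← Nat.lt_succ_iff, Nat.div_lt_iff_lt_mul (by omega), Nat.succ_mul]
      omega
    refine ⟨h3, fun h => h3.lt_of_ne fun h4 => ?_, by omega, h1⟩
    rw [h4] at h1
    omega
  have hbranch : ∀ q : Fin (L * (n + 1) + 1), ∀ c ≤ L,
      f (.inl q) = branch (x c) ↔ (q : ℕ) = c * (n + 1) := by
    intro q c hc
    obtain ⟨h1, h2, h3, h4⟩ := hq q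
    simp only [f, onPath]
    split_ifs with h
    · simp only [false_iff]
      intro h5
      have := mul_add_inj h3 (Nat.zero_le _) (h4.trans h5)
      omega
    · rw [branch.injEq]
      constructor
      · intro h5
        have := hx _ h1 _ hc h5
        rw [this] at h4
        omega
      · intro h5
        rw [(mul_add_inj h3 (Nat.zero_le _) (h4.trans h5)).1]
  have hinl : ∀ q q' : Fin (L * (n + 1) + 1), (graph G (x 0) (x L)).Adj (f (.inl q)) (f (.inl q')) ↔
      (q : ℕ) + 1 = q' ∨ (q' : ℕ) + 1 = q := by
    intro q q'
    obtain ⟨h1, h2, h3, h4⟩ := hq q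
    obtain ⟨h1', h2', h3', h4'⟩ := hq q'
    constructor
    · rintro (h | h)
      · have := rel_onPath hx h1 h2 h3 h1' h2' h3' h
        rwa [h4, h4'] at this
      · have := rel_onPath hx h1' h2' h3' h1 h2 h3 h
        rw [h4, h4'] at this
        exact this.symm
    · rintro (h | h)
      · exact adj_onPath_succ hadj h3 h2 h3' h2' (by rw [h4, h4', h])
      · exact (adj_onPath_succ hadj h3' h2' h3 h2 (by rw [h4, h4', h])).symm
  have htri : ∀ q e b, (graph G (x 0) (x L)).Adj (f (.inl q)) (tri e b) ↔
      (e = false ∧ (q : ℕ) = 0) ∨ (e = true ∧ (q : ℕ) + 1 = L * (n + 1) + 1) := by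
    intro q e b
    have h1 : (graph G (x 0) (x L)).Adj (f (.inl q)) (tri e b) ↔
        f (.inl q) = branch (bif e then x L else x 0) := by
      simp only [f, onPath]
      split_ifs with h <;> simp [graph, Rel]
    rw [h1]
    cases e
    · simpa using hbranch q 0 (Nat.zero_le _)
    · simpa using hbranch q L le_rfl
  have hadj' : ∀ s t, (graph G (x 0) (x L)).Adj (f s) (f t) ↔
      (decoratedPath (L * (n + 1) + 1)).Adj s t := by
    rintro (q | ⟨e, b⟩) (q' | ⟨e', b'⟩)
    · rw [hinl]
      exact SimpleGraph.pathGraph_adj.symm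
    · exact htri q e' b'
    · rw [SimpleGraph.adj_comm]
      exact htri q' e b
    · show (e = e' ∧ _ ∨ e' = e ∧ _) ↔ e = e' ∧ b ≠ b'
      cases e <;> cases e' <;> cases b <;> cases b' <;> simp
  have hinj : Function.Injective f := by
    rintro (q | ⟨e, b⟩) (q' | ⟨e', b'⟩) h
    · obtain ⟨h1, h2, h3, h4⟩ := hq q
      obtain ⟨h1', h2', h3', h4'⟩ := hq q'
      simp only [f, onPath] at h
      congr 1
      refine Fin.ext ?_
      rw [← h4, ← h4']
      split_ifs at h with h5 h6 h6
      · simp only [sub.injEq, Fin.mk.injEq] at h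
        rw [hx _ h1 _ h1' h.1]
        omega
      · rw [branch.injEq] at h
        rw [hx _ h1 _ h1' h]
        omega
    · simp only [f, onPath] at h
      split_ifs at h
    · simp only [f, onPath] at h
      split_ifs at h
    · simpa [f] using h
  refine ⟨Finset.univ.image f,
    isMutuallyInducedPacking_image (L * (n + 1)).succPNat f hinj hadj', ?_⟩
  have hcard : (Finset.univ.image f).card =
      Fintype.card (Fin (L * (n + 1) + 1) ⊕ (Bool × Bool)) :=
    Finset.card_image_of_injective _ hinj
  rw [hcard]
  simp

end SubdivVertex

/-! ### The structure of packings in the subdivided graph -/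

section DecoratedPath

variable {m : ℕ}

theorem decoratedPath_adj_inl (i j : Fin m) : (decoratedPath m).Adj (.inl i) (.inl j) ↔
    (i : ℕ) + 1 = j ∨ (j : ℕ) + 1 = i :=
  SimpleGraph.pathGraph_adj

theorem decoratedPath_adj_inl_inr (i : Fin m) (e b : Bool) :
    (decoratedPath m).Adj (.inl i) (.inr (e, b)) ↔
      (e = false ∧ (i : ℕ) = 0) ∨ (e = true ∧ (i : ℕ) + 1 = m) := Iff.rfl

theorem decoratedPath_adj_inr_inl (i : Fin m) (e b : Bool) :
    (decoratedPath m).Adj (.inr (e, b)) (.inl i) ↔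
      (e = false ∧ (i : ℕ) = 0) ∨ (e = true ∧ (i : ℕ) + 1 = m) := Iff.rfl

theorem decoratedPath_adj_inr (e b e' b' : Bool) :
    (decoratedPath m).Adj (.inr (e, b)) (.inr (e', b')) ↔ e = e' ∧ b ≠ b' := Iff.rfl

/-- Every vertex of a decorated path has at least two neighbours. -/
theorem decoratedPath_exists_two (hm : 0 < m) (x : Fin m ⊕ (Bool × Bool)) :
    ∃ y z, y ≠ z ∧ (decoratedPath m).Adj x y ∧ (decoratedPath m).Adj x z := by
  rcases x with i | ⟨e, b⟩
  · by_cases h0 : (i : ℕ) = 0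
    · exact ⟨.inr (false, false), .inr (false, true), by simp, Or.inl ⟨rfl, h0⟩, Or.inl ⟨rfl, h0⟩⟩
    · by_cases h1 : (i : ℕ) + 1 = m
      · exact ⟨.inr (true, false), .inr (true, true), by simp, Or.inr ⟨rfl, h1⟩, Or.inr ⟨rfl, h1⟩⟩
      · refine ⟨.inl ⟨(i : ℕ) - 1, by omega⟩, .inl ⟨(i : ℕ) + 1, by omega⟩, ?_, ?_, ?_⟩
        · rw [ne_eq, Sum.inl.injEq, Fin.mk.injEq]
          omega
        · rw [decoratedPath_adj_inl]
          simp only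
          omega
        · exact (decoratedPath_adj_inl _ _).2 (Or.inl rfl)
  · refine ⟨.inl (if e then ⟨m - 1, by omega⟩ else ⟨0, hm⟩), .inr (e, !b), by simp, ?_, ?_⟩
    · rw [decoratedPath_adj_inr_inl]
      cases e <;> simp
      omega
    · rw [decoratedPath_adj_inr]
      simp

/-- A vertex with three neighbours lies on a triangle. -/
theorem decoratedPath_of_three {x y₁ y₂ y₃ : Fin m ⊕ (Bool × Bool)}
    (h1 : (decoratedPath m).Adj x y₁) (h2 : (decoratedPath m).Adj x y₂)
    (h3 : (decoratedPath m).Adj x y₃) (h12 : y₁ ≠ y₂) (h13 : y₁ ≠ y₃) (h23 : y₂ ≠ y₃) :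
    ∃ y z, (decoratedPath m).Adj x y ∧ (decoratedPath m).Adj x z ∧ (decoratedPath m).Adj y z := by
  rcases x with i | ⟨e, b⟩
  · by_cases h0 : (i : ℕ) = 0
    · exact ⟨.inr (false, false), .inr (false, true), Or.inl ⟨rfl, h0⟩, Or.inl ⟨rfl, h0⟩,
        rfl, by simp⟩
    · by_cases h1' : (i : ℕ) + 1 = m
      · exact ⟨.inr (true, false), .inr (true, true), Or.inr ⟨rfl, h1'⟩, Or.inr ⟨rfl, h1'⟩,
          rfl, by simp⟩
      · exfalso
        have h : ∀ y, (decoratedPath m).Adj (.inl i) y → ∃ j : Fin m, y = .inl j ∧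
            ((j : ℕ) + 1 = i ∨ (j : ℕ) = i + 1) := by
          rintro (j | ⟨e, b⟩) h
          · rw [decoratedPath_adj_inl] at h
            exact ⟨j, rfl, by omega⟩
          · rw [decoratedPath_adj_inl_inr] at h
            omega
        obtain ⟨j1, rfl, hj1⟩ := h _ h1
        obtain ⟨j2, rfl, hj2⟩ := h _ h2
        obtain ⟨j3, rfl, hj3⟩ := h _ h3
        simp only [ne_eq, Sum.inl.injEq, Fin.ext_iff] at h12 h13 h23
        omega
  · have hi : ∃ i : Fin m, (e = false ∧ (i : ℕ) = 0) ∨ (e = true ∧ (i : ℕ) + 1 = m) := by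
      by_contra hn
      have h : ∀ y, (decoratedPath m).Adj (.inr (e, b)) y → y = .inr (e, !b) := by
        rintro (j | ⟨e', b'⟩) h
        · exact absurd ⟨j, h⟩ hn
        · obtain ⟨rfl, h⟩ := h
          cases b <;> cases b' <;> simp at h ⊢
      exact h12 ((h _ h1).trans (h _ h2).symm)
    obtain ⟨i, hi⟩ := hi
    exact ⟨.inl i, .inr (e, !b), hi, ⟨rfl, by simp⟩, hi⟩

/-- Only the central vertex of the decorated path on a one-vertex path has four neighbours. -/
theorem decoratedPath_of_four (hm : 2 ≤ m) {x y₁ y₂ y₃ y₄ : Fin m ⊕ (Bool × Bool)}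
    (h1 : (decoratedPath m).Adj x y₁) (h2 : (decoratedPath m).Adj x y₂)
    (h3 : (decoratedPath m).Adj x y₃) (h4 : (decoratedPath m).Adj x y₄) (h12 : y₁ ≠ y₂)
    (h13 : y₁ ≠ y₃) (h14 : y₁ ≠ y₄) (h23 : y₂ ≠ y₃) (h24 : y₂ ≠ y₄) (h34 : y₃ ≠ y₄) : False := by
  -- The neighbours of a vertex are among three numbers.
  let c : Fin m ⊕ (Bool × Bool) → Fin m ⊕ (Bool × Bool) → ℕ := fun x y => match x, y with
    | .inl i, .inl j => if (j : ℕ) + 1 = i ∨ (i : ℕ) = 0 then 0 else 1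
    | .inl _, .inr (_, b) => if b then 1 else 2
    | .inr _, .inl _ => 0
    | .inr _, .inr _ => 1
  have hc : ∀ y, (decoratedPath m).Adj x y → c x y < 3 := by
    intro y _
    rcases x with i | ⟨e, b⟩ <;> rcases y with j | ⟨e', b'⟩ <;> simp only [c] <;>
      (try split_ifs) <;> omega
  have hinj : ∀ y z, (decoratedPath m).Adj x y → (decoratedPath m).Adj x z → y ≠ z →
      c x y ≠ c x z := by
    intro y z hy hz hne h
    apply hne
    rcases x with i | ⟨e, b⟩ <;> rcases y with j | ⟨e', b'⟩ <;> rcases z with k | ⟨e'', b''⟩ <;>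
      simp only [decoratedPath_adj_inl, decoratedPath_adj_inl_inr, decoratedPath_adj_inr_inl,
        decoratedPath_adj_inr] at hy hz <;> simp only [c] at h
    · rw [Sum.inl.injEq, Fin.ext_iff]
      split_ifs at h <;> omega
    · have := j.2
      split_ifs at h <;> omega
    · have := k.2
      split_ifs at h <;> omega
    · rw [Sum.inr.injEq, Prod.mk.injEq]
      cases e' <;> cases b' <;> cases e'' <;> cases b'' <;> simp at hy hz h ⊢ <;> omega
    · rw [Sum.inl.injEq, Fin.ext_iff]
      cases e <;> simp at hy hz <;> omega
    · omega
    · omega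
    · obtain ⟨rfl, hy⟩ := hy
      obtain ⟨rfl, hz⟩ := hz
      cases b <;> cases b' <;> cases b'' <;> simp at hy hz ⊢
  have := hc _ h1
  have := hc _ h2
  have := hc _ h3
  have := hc _ h4
  have := hinj _ _ h1 h2 h12
  have := hinj _ _ h1 h3 h13
  have := hinj _ _ h1 h4 h14
  have := hinj _ _ h2 h3 h23
  have := hinj _ _ h2 h4 h24
  have := hinj _ _ h3 h4 h34
  omega

/-- Decorated paths are connected. -/
theorem decoratedPath_induction (hm : 0 < m) {P : Fin m ⊕ (Bool × Bool) → Prop}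
    (hP : ∀ x y, (decoratedPath m).Adj x y → P x → P y) {x : Fin m ⊕ (Bool × Bool)} (hx : P x)
    (y : Fin m ⊕ (Bool × Bool)) : P y := by
  have hiff : ∀ x y, (decoratedPath m).Adj x y → (P x ↔ P y) := fun x y h =>
    ⟨hP x y h, hP y x h.symm⟩
  have h1 : ∀ i (hi : i < m), P (.inl ⟨i, hi⟩) ↔ P (.inl ⟨0, hm⟩) := by
    intro i
    induction i with
    | zero => exact fun _ => Iff.rfl
    | succ i ih =>
      intro hi
      rw [← ih (by omega)]
      exact hiff _ _ ((decoratedPath_adj_inl _ _).2 (Or.inr rfl))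
  have h2 : ∀ x, P x ↔ P (.inl ⟨0, hm⟩) := by
    rintro (i | ⟨e, b⟩)
    · exact h1 i i.2
    · cases e
      · exact hiff _ _ ((decoratedPath_adj_inr_inl _ _ _).2 (Or.inl ⟨rfl, rfl⟩))
      · rw [← h1 (m - 1) (by omega)]
        exact hiff _ _ ((decoratedPath_adj_inr_inl _ _ _).2
          (Or.inr ⟨rfl, by simp only; omega⟩))
  exact (h2 y).2 ((h2 x).1 hx)

end DecoratedPath

namespace SubdivVertex

variable {n : ℕ} {G : SimpleGraph (Fin n)} {u v : Fin n}

/-- The end of the path to which the triangle with the given label is attached. -/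
def terminal (u v : Fin n) (e : Bool) : Fin n := bif e then v else u

/-- The vertices of one of the two triangles. -/
def triangle (u v : Fin n) (e : Bool) : Set (SubdivVertex n) :=
  {branch (terminal u v e), tri e false, tri e true}

theorem adj_tri_tri {e b e' b' : Bool} :
    (graph G u v).Adj (tri e b) (tri e' b') ↔ e = e' ∧ b ≠ b' := by
  cases e <;> cases e' <;> cases b <;> cases b' <;> simp [graph, Rel]

theorem adj_branch_tri {a : Fin n} {e b : Bool} :
    (graph G u v).Adj (branch a) (tri e b) ↔ a = terminal u v e := by
  simp [graph, Rel, terminal]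

theorem adj_branch_sub {a i j k : Fin n} : (graph G u v).Adj (branch a) (sub i j k) ↔
    (a = i ∧ (k : ℕ) = 0) ∨ (a = j ∧ (k : ℕ) + 1 = n ∧ G.Adj i j) := by
  simp [graph, Rel]

theorem adj_sub_sub {i j k i' j' k' : Fin n} : (graph G u v).Adj (sub i j k) (sub i' j' k') ↔
    i = i' ∧ j = j' ∧ ((k : ℕ) + 1 = k' ∨ (k' : ℕ) + 1 = k) := by
  simp only [graph, Rel]
  grind

theorem not_adj_sub_tri {i j k : Fin n} {e b : Bool} :
    ¬ (graph G u v).Adj (sub i j k) (tri e b) := by simp [graph, Rel]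

theorem not_adj_branch_branch {a b : Fin n} :
    ¬ (graph G u v).Adj (branch a) (branch b) := by simp [graph, Rel]

theorem not_adj_spine {i : Fin n} {x : SubdivVertex n} : ¬ (graph G u v).Adj (spine i) x := by
  cases x <;> simp [graph, Rel]

/-- A vertex `sub i j k` lies on no triangle. -/
theorem not_sub_triangle {i j k : Fin n} {y z : SubdivVertex n}
    (h1 : (graph G u v).Adj (sub i j k) y) (h2 : (graph G u v).Adj (sub i j k) z)
    (h3 : (graph G u v).Adj y z) : False := by
  -- The only critical case is a path with two inner vertices between equal ends.
  have key : ∀ {a i' j' k' : Fin n}, (graph G u v).Adj (sub i j k) (sub i' j' k') →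
      (graph G u v).Adj (sub i j k) (branch a) → ¬ (graph G u v).Adj (sub i' j' k') (branch a) := by
    intro a i' j' k' h1 h2 h3
    rw [adj_sub_sub] at h1
    obtain ⟨rfl, rfl, h1⟩ := h1
    rw [SimpleGraph.adj_comm, adj_branch_sub] at h2 h3
    rcases h2 with ⟨rfl, h2⟩ | ⟨rfl, h2, h2'⟩ <;> rcases h3 with ⟨h3, h3'⟩ | ⟨h3, h3', h3''⟩
    · omega
    · exact h3''.ne h3
    · exact h2'.ne h3.symm
    · omega
  rcases y with ⟨i', j', k'⟩ | ⟨e, b⟩ | ⟨a⟩ | ⟨a⟩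
  · rcases z with ⟨i'', j'', k''⟩ | ⟨e, b⟩ | ⟨a⟩ | ⟨a⟩
    · rw [adj_sub_sub] at h1 h2 h3
      omega
    · exact not_adj_sub_tri h2
    · exact key h1 h2 h3
    · exact not_adj_spine h2.symm
  · exact not_adj_sub_tri h1
  · rcases z with ⟨i'', j'', k''⟩ | ⟨e, b⟩ | ⟨a'⟩ | ⟨a'⟩
    · exact key h2 h1 h3.symm
    · exact not_adj_sub_tri h2
    · exact not_adj_branch_branch h3
    · exact not_adj_spine h2.symm
  · exact not_adj_spine h1.symm

theorem mem_triangle_of_adj {x y z : SubdivVertex n} (h1 : (graph G u v).Adj x y)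
    (h2 : (graph G u v).Adj x z) (h3 : (graph G u v).Adj y z) :
    ∃ e, x ∈ triangle u v e ∧ y ∈ triangle u v e ∧ z ∈ triangle u v e := by
  have hmem : ∀ e b, (tri e b : SubdivVertex n) ∈ triangle u v e := by
    intro e b
    cases b <;> simp [triangle]
  have hmem' : ∀ e, (branch (terminal u v e) : SubdivVertex n) ∈ triangle u v e := by
    simp [triangle]
  rcases x with ⟨i, j, k⟩ | ⟨e, b⟩ | ⟨a⟩ | ⟨a⟩
  · exact (not_sub_triangle h1 h2 h3).elim
  · rcases y with ⟨i, j, k⟩ | ⟨e', b'⟩ | ⟨a⟩ | ⟨a⟩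
    · exact (not_sub_triangle h1.symm h3 h2).elim
    · rcases z with ⟨i, j, k⟩ | ⟨e'', b''⟩ | ⟨a⟩ | ⟨a⟩
      · exact (not_sub_triangle h2.symm h3.symm h1).elim
      · rw [adj_tri_tri] at h1 h2
        obtain ⟨rfl, -⟩ := h1
        obtain ⟨rfl, -⟩ := h2
        exact ⟨_, hmem _ _, hmem _ _, hmem _ _⟩
      · rw [adj_tri_tri] at h1
        obtain ⟨rfl, -⟩ := h1
        rw [SimpleGraph.adj_comm, adj_branch_tri] at h2
        subst h2
        exact ⟨_, hmem _ _, hmem _ _, hmem' _⟩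
      · exact (not_adj_spine h2.symm).elim
    · rw [SimpleGraph.adj_comm, adj_branch_tri] at h1
      subst h1
      rcases z with ⟨i, j, k⟩ | ⟨e'', b''⟩ | ⟨a⟩ | ⟨a⟩
      · exact (not_sub_triangle h2.symm h3.symm (adj_branch_tri.2 rfl).symm).elim
      · rw [adj_tri_tri] at h2
        obtain ⟨rfl, -⟩ := h2
        exact ⟨_, hmem _ _, hmem' _, hmem _ _⟩
      · exact (not_adj_branch_branch h3).elim
      · exact (not_adj_spine h2.symm).elim
    · exact (not_adj_spine h1.symm).elim
  · rcases y with ⟨i, j, k⟩ | ⟨e', b'⟩ | ⟨a'⟩ | ⟨a'⟩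
    · exact (not_sub_triangle h1.symm h3 h2).elim
    · rw [adj_branch_tri] at h1
      subst h1
      rcases z with ⟨i, j, k⟩ | ⟨e'', b''⟩ | ⟨a⟩ | ⟨a⟩
      · exact (not_sub_triangle h2.symm h3.symm (adj_branch_tri.2 rfl)).elim
      · rw [adj_tri_tri] at h3
        obtain ⟨rfl, -⟩ := h3
        exact ⟨_, hmem' _, hmem _ _, hmem _ _⟩
      · exact (not_adj_branch_branch h2).elim
      · exact (not_adj_spine h2.symm).elim
    · exact (not_adj_branch_branch h1).elim
    · exact (not_adj_spine h1.symm).elim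
  · exact (not_adj_spine h1).elim

/-- A triangle of the subdivided graph is one of the two attached ones. -/
theorem exists_triangle_eq {x y z : SubdivVertex n} (h1 : (graph G u v).Adj x y)
    (h2 : (graph G u v).Adj x z) (h3 : (graph G u v).Adj y z) :
    ∃ e, triangle u v e = {x, y, z} := by
  obtain ⟨e, hx, hy, hz⟩ := mem_triangle_of_adj h1 h2 h3
  refine ⟨e, ?_⟩
  have := h1.ne
  have := h2.ne
  have := h3.ne
  ext w
  simp only [triangle, Set.mem_insert_iff, Set.mem_singleton_iff] at *
  grind

theorem disjoint_triangle (huv : u ≠ v) {e e' : Bool} {x : SubdivVertex n}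
    (h : x ∈ triangle u v e) (h' : x ∈ triangle u v e') : e = e' := by
  cases e <;> cases e' <;> simp [triangle, terminal] at h h' ⊢ <;>
    rcases h with rfl | rfl | rfl <;> simp [huv, huv.symm] at h'

/-- What is needed about the set `S` of vertices of an induced decorated path in the subdivided
graph: it contains both triangles, is connected, and has only degrees between 2 and 4, where
degree 4 is excluded because `u ≠ v` excludes the decorated path `D 1`, and vertices of degree 3
lie in the triangles. -/
structure IsDecorated (G : SimpleGraph (Fin n)) (u v : Fin n) (S : Set (SubdivVertex n)) :
    Prop where
  tri_mem : ∀ e b, tri e b ∈ S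
  branch_mem : ∀ e, branch (terminal u v e) ∈ S
  exists_two : ∀ x ∈ S, ∃ y ∈ S, ∃ z ∈ S, y ≠ z ∧ (graph G u v).Adj x y ∧ (graph G u v).Adj x z
  of_three : ∀ x ∈ S, ∀ y₁ ∈ S, ∀ y₂ ∈ S, ∀ y₃ ∈ S, (graph G u v).Adj x y₁ →
    (graph G u v).Adj x y₂ → (graph G u v).Adj x y₃ → y₁ ≠ y₂ → y₁ ≠ y₃ → y₂ ≠ y₃ →
    ∃ e, x ∈ triangle u v e
  of_four : ∀ x ∈ S, ∀ y₁ ∈ S, ∀ y₂ ∈ S, ∀ y₃ ∈ S, ∀ y₄ ∈ S, (graph G u v).Adj x y₁ →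
    (graph G u v).Adj x y₂ → (graph G u v).Adj x y₃ → (graph G u v).Adj x y₄ →
    y₁ ≠ y₂ → y₁ ≠ y₃ → y₁ ≠ y₄ → y₂ ≠ y₃ → y₂ ≠ y₄ → y₃ ≠ y₄ → False
  induction : ∀ P : SubdivVertex n → Prop,
    (∀ x ∈ S, ∀ y ∈ S, (graph G u v).Adj x y → P x → P y) → (∃ x ∈ S, P x) → ∀ x ∈ S, P x

theorem isDecorated_of_iso (huv : u ≠ v) {S : Set (SubdivVertex n)} {m : ℕ} (hm : 0 < m)
    (φ : (graph G u v).induce S ≃g decoratedPath m) : IsDecorated G u v S := by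
  have hadj : ∀ x y, (graph G u v).Adj (φ.symm x) (φ.symm y) ↔ (decoratedPath m).Adj x y :=
    fun x y => φ.symm.map_adj_iff
  have hinj : ∀ x y, (φ.symm x : SubdivVertex n) = φ.symm y → x = y := fun x y h =>
    φ.symm.injective (Subtype.ext h)
  -- The two triangles of the decorated path are mapped to the two attached triangles.
  let t : Bool → Fin m := fun e => if e then ⟨m - 1, by omega⟩ else ⟨0, hm⟩
  have ht : ∀ e b, (decoratedPath m).Adj (.inl (t e)) (.inr (e, b)) := by
    intro e b
    rw [decoratedPath_adj_inl_inr]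
    cases e <;> simp [t]
    omega
  have htri : ∀ e, ∃ e', triangle u v e' = {(φ.symm (.inl (t e)) : SubdivVertex n),
      (φ.symm (.inr (e, false)) : SubdivVertex n), (φ.symm (.inr (e, true)) : SubdivVertex n)} :=
    fun e => exists_triangle_eq ((hadj _ _).2 (ht e _)) ((hadj _ _).2 (ht e _))
      ((hadj _ _).2 ⟨rfl, by simp⟩)
  choose σ hσ using htri
  have hσne : σ false ≠ σ true := by
    intro h
    have h1 : (φ.symm (.inr (false, false)) : SubdivVertex n) ∈ triangle u v (σ true) := by
      rw [← h, hσ]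
      simp
    rw [hσ] at h1
    rcases h1 with h1 | h1 | h1 <;> simpa using hinj _ _ h1
  have hm2 : 2 ≤ m := by
    by_contra h
    have h1 : m = 1 := by omega
    subst h1
    have h2 : ∀ e, (φ.symm (.inl 0) : SubdivVertex n) ∈ triangle u v (σ e) := by
      intro e
      rw [hσ, Subsingleton.elim (t e) 0]
      simp
    exact hσne (disjoint_triangle huv (h2 _) (h2 _))
  have hsub : ∀ e, triangle u v e ⊆ S := by
    intro e
    obtain ⟨e', rfl⟩ : ∃ e', σ e' = e := by
      cases h1 : σ false <;> cases h2 : σ true <;> rw [h1, h2] at hσne <;> cases e <;> grind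
    rw [hσ]
    rintro x (rfl | rfl | rfl) <;> exact Subtype.prop _
  have hS : ∀ x ∈ S, ∃ z, x = (φ.symm z : SubdivVertex n) := fun x hx =>
    ⟨φ ⟨x, hx⟩, by simp⟩
  have hne : ∀ x y, (φ.symm x : SubdivVertex n) ≠ φ.symm y → x ≠ y := fun x y h h' =>
    h (by rw [h'])
  refine ⟨?_, ?_, ?_, ?_, ?_, ?_⟩
  · intro e b
    exact hsub e (by cases b <;> simp [triangle])
  · intro e
    exact hsub e (by simp [triangle])
  · intro x hx
    obtain ⟨x, rfl⟩ := hS x hx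
    obtain ⟨y, z, h1, h2, h3⟩ := decoratedPath_exists_two hm x
    exact ⟨_, (φ.symm y).2, _, (φ.symm z).2, fun h => h1 (hinj _ _ h), (hadj _ _).2 h2,
      (hadj _ _).2 h3⟩
  · intro x hx y₁ h1 y₂ h2 y₃ h3 k1 k2 k3 h12 h13 h23
    obtain ⟨x, rfl⟩ := hS x hx
    obtain ⟨y₁, rfl⟩ := hS _ h1
    obtain ⟨y₂, rfl⟩ := hS _ h2
    obtain ⟨y₃, rfl⟩ := hS _ h3
    obtain ⟨y, z, h4, h5, h6⟩ := decoratedPath_of_three ((hadj _ _).1 k1) ((hadj _ _).1 k2)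
      ((hadj _ _).1 k3) (hne _ _ h12) (hne _ _ h13) (hne _ _ h23)
    obtain ⟨e, he, -⟩ := mem_triangle_of_adj ((hadj _ _).2 h4) ((hadj _ _).2 h5) ((hadj _ _).2 h6)
    exact ⟨e, he⟩
  · intro x hx y₁ h1 y₂ h2 y₃ h3 y₄ h4 k1 k2 k3 k4 h12 h13 h14 h23 h24 h34
    obtain ⟨x, rfl⟩ := hS x hx
    obtain ⟨y₁, rfl⟩ := hS _ h1
    obtain ⟨y₂, rfl⟩ := hS _ h2
    obtain ⟨y₃, rfl⟩ := hS _ h3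
    obtain ⟨y₄, rfl⟩ := hS _ h4
    exact decoratedPath_of_four hm2 ((hadj _ _).1 k1) ((hadj _ _).1 k2) ((hadj _ _).1 k3)
      ((hadj _ _).1 k4) (hne _ _ h12) (hne _ _ h13) (hne _ _ h14) (hne _ _ h23) (hne _ _ h24)
      (hne _ _ h34)
  · rintro P hP ⟨x, hx, hPx⟩ y hy
    obtain ⟨x, rfl⟩ := hS x hx
    obtain ⟨y, rfl⟩ := hS y hy
    exact decoratedPath_induction (P := fun z => P (φ.symm z)) hm
      (fun a b hab => hP _ (φ.symm a).2 _ (φ.symm b).2 ((hadj _ _).2 hab)) hPx y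

/-- As each decorated path needs two triangles, a packing has at most one component. -/
theorem isDecorated_of_packing (huv : u ≠ v) {S : Finset (SubdivVertex n)} (hne : S.Nonempty)
    (hS : IsMutuallyInducedPacking decoratedPaths (graph G u v) S) : IsDecorated G u v S := by
  obtain ⟨C, h1, h2, h3⟩ := hS
  have hdec : ∀ A ∈ C, IsDecorated G u v A := by
    intro A hA
    obtain ⟨m, ⟨φ⟩⟩ := h2 A hA
    exact isDecorated_of_iso huv m.pos φ
  obtain ⟨x, hx⟩ := hne
  have hx' : x ∈ ⋃₀ C := by
    rw [← h1]
    exact hx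
  obtain ⟨A, hA, -⟩ := hx'
  have hC : C = {A} := by
    refine Set.eq_singleton_iff_unique_mem.2 ⟨hA, fun B hB => ?_⟩
    by_contra hBA
    exact Set.disjoint_left.1 (h3 B hB A hA hBA).1 ((hdec B hB).tri_mem true true)
      ((hdec A hA).tri_mem true true)
  rw [h1, hC, Set.sUnion_singleton]
  exact hdec A hA

end SubdivVertex

/-! ### Greedy walks -/

section Greedy

variable {n : ℕ} (F : Fin n → Fin n → Prop)

/-- The vertex `y` is related to the head of the list, and not on the list. -/
def GreedyNext (l : List (Fin n)) (y : Fin n) : Prop := (∃ a ∈ l.head?, F a y) ∧ y ∉ l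

open Classical in
/-- Extend a list at its head by the first related vertex that is not yet on the list. -/
noncomputable def greedyStep (l : List (Fin n)) : List (Fin n) :=
  ((List.finRange n).filter fun y => GreedyNext F l y).head?.toList ++ l

/-- The list, in reverse order, of the vertices on the walk that starts at `u` and moves on, `k`
times if possible, to the first related vertex that has not been visited. -/
noncomputable def greedyWalk (u : Fin n) (k : ℕ) : List (Fin n) := (greedyStep F)^[k] [u]

theorem greedyWalk_succ (u : Fin n) (k : ℕ) :
    greedyWalk F u (k + 1) = greedyStep F (greedyWalk F u k) :=
  Function.iterate_succ_apply' _ _ _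

theorem greedyStep_cases (l : List (Fin n)) :
    (greedyStep F l = l ∧ ∀ a ∈ l.head?, ∀ y, F a y → y ∈ l) ∨
    ∃ y, greedyStep F l = y :: l ∧ y ∉ l ∧ ∃ a ∈ l.head?, F a y := by
  classical
  unfold greedyStep
  rcases h : (List.finRange n).filter fun y => GreedyNext F l y with _ | ⟨y, l'⟩
  · refine Or.inl ⟨by simp, fun a ha y hy => ?_⟩
    rw [List.filter_eq_nil_iff] at h
    by_contra hyl
    exact h y (List.mem_finRange y) (decide_eq_true ⟨⟨a, ha, hy⟩, hyl⟩)
  · have hy : y ∈ (List.finRange n).filter fun y => GreedyNext F l y := by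
      rw [h]
      exact List.mem_cons_self
    rw [List.mem_filter, decide_eq_true_eq] at hy
    exact Or.inr ⟨y, by simp, hy.2.2, hy.2.1⟩

theorem greedyWalk_spec (u : Fin n) (k : ℕ) :
    (greedyWalk F u k).Nodup ∧ (greedyWalk F u k).IsChain (fun a b => F b a) ∧
    (greedyWalk F u k).getLast? = some u ∧
    ((greedyWalk F u k).length = k + 1 ∨
      ∀ a ∈ (greedyWalk F u k).head?, ∀ y, F a y → y ∈ greedyWalk F u k) := by
  induction k with
  | zero => simp [greedyWalk]
  | succ k ih =>
    obtain ⟨h1, h2, h3, h4⟩ := ih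
    rw [greedyWalk_succ]
    rcases greedyStep_cases F (greedyWalk F u k) with ⟨h5, h6⟩ | ⟨y, h5, h6, a, ha, hay⟩
    · rw [h5]
      exact ⟨h1, h2, h3, Or.inr h6⟩
    · rw [h5]
      refine ⟨List.nodup_cons.2 ⟨h6, h1⟩, ?_, ?_, ?_⟩
      · rw [List.isChain_cons]
        refine ⟨fun b hb => ?_, h2⟩
        rw [Option.mem_def] at ha hb
        rw [ha, Option.some.injEq] at hb
        exact hb ▸ hay
      · rw [List.getLast?_cons, h3]
        rfl
      · rcases h4 with h4 | h4
        · exact Or.inl (by simp [h4])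
        · exact absurd (h4 a ha y hay) h6

theorem greedyWalk_ne_nil (u : Fin n) (k : ℕ) : greedyWalk F u k ≠ [] := by
  intro h
  have := (greedyWalk_spec F u k).2.2.1
  simp [h] at this

/-- After `n` steps the walk is stuck. -/
theorem greedyWalk_maximal (u : Fin n) {a y : Fin n} (ha : a ∈ (greedyWalk F u n).head?)
    (hay : F a y) : y ∈ greedyWalk F u n := by
  obtain ⟨h1, -, -, h | h⟩ := greedyWalk_spec F u n
  · have := h1.length_le_card
    rw [h, Fintype.card_fin] at this
    omega
  · exact h a ha y hay

end Greedy

namespace SubdivVertex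

variable {n : ℕ} {G : SimpleGraph (Fin n)} {u v : Fin n} {S : Set (SubdivVertex n)}

/-- The edges of `G` for which the set `S` contains the first vertex of one of the paths that
replace them. -/
def Used (G : SimpleGraph (Fin n)) (S : Set (SubdivVertex n)) (a b : Fin n) : Prop :=
  G.Adj a b ∧ (sub a b ⟨0, a.pos⟩ ∈ S ∨ sub b a ⟨0, a.pos⟩ ∈ S)

theorem Used.symm {a b : Fin n} (h : Used G S a b) : Used G S b a :=
  ⟨h.1.symm, h.2.symm⟩

namespace IsDecorated

/-- An inner vertex of a path has at most two neighbours, hence `S` contains both of them. -/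
theorem sub_step (hS : IsDecorated G u v S) {a b k : Fin n} (hk : sub a b k ∈ S) :
    (∀ k' : Fin n, (k' : ℕ) + 1 = k → sub a b k' ∈ S) ∧
    (∀ k' : Fin n, (k : ℕ) + 1 = k' → sub a b k' ∈ S) ∧ ((k : ℕ) + 1 = n → G.Adj a b) ∧
    ((k : ℕ) = 0 → branch a ∈ S) := by
  obtain ⟨y, hy, z, hz, hyz, h1, h2⟩ := hS.exists_two _ hk
  have key : ∀ w, (graph G u v).Adj (sub a b k) w →
      (w = branch a ∧ (k : ℕ) = 0) ∨ (∃ k' : Fin n, w = sub a b k' ∧ (k' : ℕ) + 1 = k) ∨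
      (w = branch b ∧ (k : ℕ) + 1 = n ∧ G.Adj a b) ∨
      (∃ k' : Fin n, w = sub a b k' ∧ (k : ℕ) + 1 = k') := by
    intro w hw
    rcases w with ⟨i, j, k'⟩ | ⟨e, b⟩ | ⟨i⟩ | ⟨i⟩
    · rw [adj_sub_sub] at hw
      obtain ⟨rfl, rfl, h | h⟩ := hw
      · exact Or.inr (Or.inr (Or.inr ⟨k', rfl, h⟩))
      · exact Or.inr (Or.inl ⟨k', rfl, h⟩)
    · exact (not_adj_sub_tri hw).elim
    · rw [SimpleGraph.adj_comm, adj_branch_sub] at hw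
      rcases hw with ⟨rfl, h⟩ | ⟨rfl, h⟩
      · exact Or.inl ⟨rfl, h⟩
      · exact Or.inr (Or.inr (Or.inl ⟨rfl, h⟩))
    · exact (not_adj_spine hw.symm).elim
  have hsub : ∀ k' k'' : Fin n, (k' : ℕ) = k'' → sub a b k' = sub a b k'' := by
    intro k' k'' h
    rw [Fin.ext h]
  refine ⟨fun k' hk' => ?_, fun k' hk' => ?_, fun hk' => ?_, fun hk' => ?_⟩ <;>
    rcases key y h1 with ⟨rfl, h3⟩ | ⟨l, rfl, h3⟩ | ⟨rfl, h3, h3'⟩ | ⟨l, rfl, h3⟩ <;>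
    rcases key z h2 with ⟨rfl, h4⟩ | ⟨l', rfl, h4⟩ | ⟨rfl, h4, h4'⟩ | ⟨l', rfl, h4⟩ <;>
    first
    | omega
    | assumption
    | exact absurd rfl hyz
    | exact absurd (hsub _ _ (by omega)) hyz
    | (rw [hsub k' l (by omega)]; assumption)
    | (rw [hsub k' l' (by omega)]; assumption)

/-- The set `S` contains with one inner vertex of a path all of them, and then the path belongs to
an edge. -/
theorem sub_mem (hS : IsDecorated G u v S) {a b k : Fin n} (hk : sub a b k ∈ S) :
    (∀ k', sub a b k' ∈ S) ∧ G.Adj a b := by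
  have hdown : ∀ d, ∀ k' : Fin n, (k' : ℕ) + d = k → sub a b k' ∈ S := by
    intro d
    induction d with
    | zero =>
      intro k' h
      rwa [show k' = k from Fin.ext h]
    | succ d ih =>
      intro k' h
      have h' : sub a b ⟨(k' : ℕ) + 1, by omega⟩ ∈ S := ih _ (by simp only; omega)
      exact (hS.sub_step h').1 k' rfl
  have hup : ∀ d, ∀ k' : Fin n, (k : ℕ) + d = k' → sub a b k' ∈ S := by
    intro d
    induction d with
    | zero =>
      intro k' h
      rwa [show k' = k from Fin.ext h.symm]
    | succ d ih =>
      intro k' h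
      have h' : sub a b ⟨(k' : ℕ) - 1, by omega⟩ ∈ S := ih _ (by simp only; omega)
      refine (hS.sub_step h').2.1 k' ?_
      simp only
      omega
  have hall : ∀ k', sub a b k' ∈ S := by
    intro k'
    rcases le_total (k' : ℕ) k with h | h
    · exact hdown (k - k') k' (by omega)
    · exact hup (k' - k) k' (by omega)
  have hn := a.pos
  have hlast : sub a b ⟨n - 1, by omega⟩ ∈ S := hall _
  exact ⟨hall, (hS.sub_step hlast).2.2.1 (by simp only; omega)⟩

theorem used_of_sub_mem (hS : IsDecorated G u v S) {a b k : Fin n} (hk : sub a b k ∈ S) :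
    Used G S a b :=
  ⟨(hS.sub_mem hk).2, Or.inl ((hS.sub_mem hk).1 _)⟩

theorem exists_sub_of_used (hS : IsDecorated G u v S) {c d : Fin n} (h : Used G S c d) :
    ∃ w ∈ S, (graph G u v).Adj (branch c) w ∧ ∃ k, w = sub c d k ∨ w = sub d c k := by
  obtain ⟨h1, h2 | h2⟩ := h
  · exact ⟨_, h2, adj_branch_sub.2 (Or.inl ⟨rfl, rfl⟩), _, Or.inl rfl⟩
  · have hn := c.pos
    exact ⟨_, (hS.sub_mem h2).1 ⟨n - 1, by omega⟩,
      adj_branch_sub.2 (Or.inr ⟨rfl, by simp only; omega, h1.symm⟩), _, Or.inr rfl⟩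

/-- At the end of the path only one edge is used, as two neighbours are in the triangle. -/
theorem used_terminal (hS : IsDecorated G u v S) {e : Bool} {d d' : Fin n}
    (h : Used G S (terminal u v e) d) (h' : Used G S (terminal u v e) d') : d = d' := by
  by_contra hne
  obtain ⟨w, hw, hadj, k, hk⟩ := hS.exists_sub_of_used h
  obtain ⟨w', hw', hadj', k', hk'⟩ := hS.exists_sub_of_used h'
  have h1 := h.1.ne
  have h2 := h'.1.ne
  refine hS.of_four _ (hS.branch_mem e) _ hw _ hw' _ (hS.tri_mem e false) _ (hS.tri_mem e true)
    hadj hadj' (adj_branch_tri.2 rfl) (adj_branch_tri.2 rfl) ?_ ?_ ?_ ?_ ?_ ?_ <;> grind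

/-- At each vertex at most two edges are used. -/
theorem used_three (hS : IsDecorated G u v S) {c d₁ d₂ d₃ : Fin n} (hc : branch c ∈ S)
    (h1 : Used G S c d₁) (h2 : Used G S c d₂) (h3 : Used G S c d₃) :
    d₁ = d₂ ∨ d₁ = d₃ ∨ d₂ = d₃ := by
  by_contra! hne
  obtain ⟨hne1, hne2, hne3⟩ := hne
  obtain ⟨w1, hw1, hadj1, k1, hk1⟩ := hS.exists_sub_of_used h1
  obtain ⟨w2, hw2, hadj2, k2, hk2⟩ := hS.exists_sub_of_used h2
  obtain ⟨w3, hw3, hadj3, k3, hk3⟩ := hS.exists_sub_of_used h3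
  have := h1.1.ne
  have := h2.1.ne
  have := h3.1.ne
  obtain ⟨e, he⟩ := hS.of_three _ hc _ hw1 _ hw2 _ hw3 hadj1 hadj2 hadj3 (by grind) (by grind)
    (by grind)
  have hc' : c = terminal u v e := by
    simpa [triangle] using he
  subst hc'
  exact hne1 (hS.used_terminal h1 h2)

/-- The greedy walk along used edges visits with a vertex all vertices reached by used edges. -/
theorem mem_greedyWalk_of_used (hS : IsDecorated G u v S) {c d : Fin n} (hcS : branch c ∈ S)
    (hc : c ∈ greedyWalk (Used G S) u n) (hcd : Used G S c d) :
    d ∈ greedyWalk (Used G S) u n := by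
  obtain ⟨hnodup, hchain, hlast, -⟩ := greedyWalk_spec (Used G S) u n
  have hmax := fun (h : c ∈ (greedyWalk (Used G S) u n).head?) =>
    greedyWalk_maximal (Used G S) u h hcd
  generalize greedyWalk (Used G S) u n = l at *
  obtain ⟨l₁, l₂, rfl⟩ := List.append_of_mem hc
  rcases List.eq_nil_or_concat' l₁ with rfl | ⟨l₁, p, rfl⟩
  · exact hmax rfl
  · -- The vertex `p` comes after `c` on the walk.
    rw [List.append_assoc, List.singleton_append, List.isChain_append,
      List.isChain_cons_cons] at hchain
    have hp : Used G S c p := hchain.2.1.1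
    rcases l₂ with _ | ⟨s, l₂⟩
    · have hcu : c = terminal u v false := by
        simpa [terminal] using hlast
      rw [hcu] at hcd hp
      rw [hS.used_terminal hcd hp]
      simp
    · have hs : Used G S c s := (List.isChain_cons_cons.1 hchain.2.1.2).1.symm
      rcases hS.used_three hcS hp hs hcd with h | rfl | rfl
      · simp [h, List.nodup_append] at hnodup
      · simp
      · simp

/-- The vertices of the part of the subdivided graph that the list `l` of vertices of `G` spans. -/
def Spanned (u v : Fin n) (l : List (Fin n)) : SubdivVertex n → Prop
  | sub a b _ => a ∈ l ∧ b ∈ l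
  | tri e _ => terminal u v e ∈ l
  | branch a => a ∈ l
  | spine _ => False

/-- By connectedness, the greedy walk along used edges sees all of `S`. -/
theorem spanned_greedyWalk (hS : IsDecorated G u v S) {x : SubdivVertex n} (hx : x ∈ S) :
    Spanned u v (greedyWalk (Used G S) u n) x := by
  refine hS.induction (Spanned u v (greedyWalk (Used G S) u n)) ?_
    ⟨_, hS.branch_mem false, List.mem_of_getLast? (greedyWalk_spec (Used G S) u n).2.2.1⟩ x hx
  intro x hx y hy hadj h
  rcases x with ⟨i, j, k⟩ | ⟨e, b⟩ | ⟨a⟩ | ⟨a⟩ <;>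
    rcases y with ⟨i', j', k'⟩ | ⟨e', b'⟩ | ⟨a'⟩ | ⟨a'⟩
  · rw [adj_sub_sub] at hadj
    obtain ⟨rfl, rfl, -⟩ := hadj
    exact h
  · exact (not_adj_sub_tri hadj).elim
  · rw [SimpleGraph.adj_comm, adj_branch_sub] at hadj
    rcases hadj with ⟨rfl, -⟩ | ⟨rfl, -⟩
    · exact h.1
    · exact h.2
  · exact (not_adj_spine hadj.symm).elim
  · exact (not_adj_sub_tri hadj.symm).elim
  · rw [adj_tri_tri] at hadj
    obtain ⟨rfl, -⟩ := hadj
    exact h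
  · rw [SimpleGraph.adj_comm, adj_branch_tri] at hadj
    subst hadj
    exact h
  · exact (not_adj_spine hadj.symm).elim
  · have hu := hS.used_of_sub_mem hy
    rw [adj_branch_sub] at hadj
    rcases hadj with ⟨rfl, -⟩ | ⟨rfl, -⟩
    · exact ⟨h, hS.mem_greedyWalk_of_used hx h hu⟩
    · exact ⟨hS.mem_greedyWalk_of_used hx h hu.symm, h⟩
  · rw [adj_branch_tri] at hadj
    subst hadj
    exact h
  · exact (not_adj_branch_branch hadj).elim
  · exact (not_adj_spine hadj.symm).elim
  all_goals exact (not_adj_spine hadj).elim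

/-- The greedy walk has more than one vertex, since it has to reach `v`. -/
theorem two_le_length_greedyWalk (hS : IsDecorated G u v S) (huv : u ≠ v) :
    2 ≤ (greedyWalk (Used G S) u n).length := by
  have hu : u ∈ greedyWalk (Used G S) u n := hS.spanned_greedyWalk (hS.branch_mem false)
  have hv : v ∈ greedyWalk (Used G S) u n := hS.spanned_greedyWalk (hS.branch_mem true)
  generalize greedyWalk (Used G S) u n = l at *
  match l with
  | [] => simp at hu
  | [a] =>
    rw [List.mem_singleton] at hu hv
    exact absurd (hu.trans hv.symm) huv
  | _ :: _ :: _ => simp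

/-- The size of `S` is bounded in terms of the length of the greedy walk: for each of its
vertices, there are at most two paths in `S` that start there. -/
theorem card_le {S : Finset (SubdivVertex n)} (hS : IsDecorated G u v S) :
    S.card ≤ 4 + (greedyWalk (Used G S) u n).length * (2 * n + 1) := by
  classical
  have hspan := fun x (hx : x ∈ S) => hS.spanned_greedyWalk (Finset.mem_coe.2 hx)
  generalize greedyWalk (Used G S) u n = l at *
  let B : Fin n → Finset (Fin n) := fun a => Finset.univ.filter fun b => sub a b ⟨0, a.pos⟩ ∈ S
  have hB : ∀ a, (B a).card ≤ 2 := by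
    intro a
    by_contra! h
    obtain ⟨b₁, h1, b₂, h2, b₃, h3, h12, h13, h23⟩ := Finset.two_lt_card.1 h
    simp only [B, Finset.mem_filter, Finset.mem_univ, true_and] at h1 h2 h3
    have ha : (branch a : SubdivVertex n) ∈ S := (hS.sub_step h1).2.2.2 rfl
    rcases hS.used_three ha (hS.used_of_sub_mem h1) (hS.used_of_sub_mem h2)
      (hS.used_of_sub_mem h3) with h | h | h
    · exact h12 h
    · exact h13 h
    · exact h23 h
  have hsub : S ⊆ (Finset.univ.image fun p : Bool × Bool => tri p.1 p.2) ∪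
      (l.toFinset.image branch ∪ l.toFinset.biUnion fun a => (B a).biUnion fun b =>
        Finset.univ.image (sub a b)) := by
    intro x hx
    have h := hspan x hx
    simp only [Finset.mem_union, Finset.mem_image, Finset.mem_biUnion, Finset.mem_univ, true_and,
      List.mem_toFinset]
    rcases x with ⟨a, b, k⟩ | ⟨e, b⟩ | ⟨a⟩ | ⟨a⟩
    · refine Or.inr (Or.inr ⟨a, h.1, b, ?_, k, rfl⟩)
      simp only [B, Finset.mem_filter, Finset.mem_univ, true_and]
      exact (hS.sub_mem hx).1 _
    · exact Or.inl ⟨(e, b), rfl⟩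
    · exact Or.inr (Or.inl ⟨a, h, rfl⟩)
    · exact h.elim
  have h1 : (Finset.univ.image fun p : Bool × Bool =>
      (tri p.1 p.2 : SubdivVertex n)).card ≤ 4 := Finset.card_image_le
  have h2 : (l.toFinset.image (branch : Fin n → SubdivVertex n)).card ≤ l.length :=
    Finset.card_image_le.trans l.toFinset_card_le
  have h3 : (l.toFinset.biUnion fun a => (B a).biUnion fun b =>
      Finset.univ.image (sub a b)).card ≤ l.length * (2 * n) := by
    refine (Finset.card_biUnion_le_card_mul _ _ (2 * n) fun a _ => ?_).trans
      (Nat.mul_le_mul_right _ l.toFinset_card_le)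
    refine (Finset.card_biUnion_le_card_mul _ _ n fun b _ => ?_).trans
      (Nat.mul_le_mul_right _ (hB a))
    exact Finset.card_image_le.trans (by simp)
  calc S.card ≤ _ := Finset.card_le_card hsub
    _ ≤ _ := (Finset.card_union_le _ _).trans
        (Nat.add_le_add h1 ((Finset.card_union_le _ _).trans (Nat.add_le_add h2 h3)))
    _ = _ := by ring

end IsDecorated

end SubdivVertex

/-! ### Greedy walks in polynomial time -/

/-- The definition of `encVertexList` converts the list to numbers first, and then encodes them;
this is the same as encoding each vertex by its number. -/
theorem encVertexList_eq {n : ℕ} (l : List (Fin n)) :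
    encVertexList l = encList (l.map fun v : Fin n => encNat v) := by
  rw [encVertexList]
  congr 1
  induction l with
  | nil => rfl
  | cons a l ih => exact congrArg _ ih

namespace PolyTime

variable {I : Type} {e : I → Data} {n : I → ℕ} {F : ∀ i, Fin (n i) → Fin (n i) → Prop}

theorem mem_vertexList {l : ∀ i, List (Fin (n i))} {y : ∀ i, Fin (n i)}
    (hl : PolyTime e (fun i => encVertexList (l i))) (hy : PolyTime e (fun i => encNat (y i))) :
    PolyTime e (fun i => encBit (y i ∈ l i)) := by
  let E : ∀ i, Fin (n i) → Data := fun _ k => encNat k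
  refine (exists_mem (enc := E) (P := fun i k => (k : ℕ) = y i)
    (hl.congr fun i => encVertexList_eq _) ((last e E).eq (hy.lift E))).bit_congr fun i => ?_
  constructor
  · rintro ⟨k, hk, h⟩
    rwa [← Fin.ext h]
  · exact fun h => ⟨_, h, rfl⟩

theorem greedyStep {l : ∀ i, List (Fin (n i))} (hn : PolyTime e (fun i => encNat (n i)))
    (hl : PolyTime e (fun i => encVertexList (l i))) (hne : ∀ i, l i ≠ [])
    (hF : PolyTime (fun q : Σ i, Fin (n i) × Fin (n i) =>
      Data.pair (e q.1) (Data.pair (encNat q.2.1) (encNat q.2.2)))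
      (fun q => encBit (F q.1 q.2.1 q.2.2))) :
    PolyTime e (fun i => encVertexList (greedyStep (F i) (l i))) := by
  classical
  let E : ∀ i, Fin (n i) → Data := fun _ k => encNat k
  have hhead : PolyTime e (fun i => encNat ((l i).head (hne i))) := by
    refine hl.left.congr fun i => ?_
    obtain ⟨a, t, h⟩ := List.exists_cons_of_ne_nil (hne i)
    simp only [h]
    rfl
  have hy := last e E
  have hF' := (((id _).fst.pair ((hhead.lift E).pair hy))).comp
    (hF.reindex fun q : Σ i, Fin (n i) => ⟨q.1, ((l q.1).head (hne q.1), q.2)⟩)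
  have hnext : PolyTime (fun q : Σ i, Fin (n i) => Data.pair (e q.1) (E q.1 q.2))
      (fun q => encBit (GreedyNext (F q.1) (l q.1) q.2)) := by
    refine (hF'.and (mem_vertexList (hl.lift E) hy).not).bit_congr fun q => ?_
    rw [GreedyNext, List.head?_eq_some_head (hne q.1)]
    simp
  have hfilter := filter (P := fun i y => GreedyNext (F i) (l i) y) (enc := E) hn.range hnext
  refine (ite (hfilter.bit_of_ne_nil fun i => Iff.rfl) (hfilter.left.pair hl) hl).congr fun i => ?_
  rw [_root_.greedyStep]
  rcases (List.finRange (n i)).filter fun y => GreedyNext (F i) (l i) y with _ | ⟨y, l'⟩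
  · exact if_neg (not_not.2 rfl)
  · rw [List.map_cons, encList, if_pos (pair_ne_nil _ _), encVertexList_eq, encVertexList_eq]
    rfl

theorem greedyWalk {u : ∀ i, Fin (n i)} (hn : PolyTime e (fun i => encNat (n i)))
    (hu : PolyTime e (fun i => encNat (u i)))
    (hF : PolyTime (fun q : Σ i, Fin (n i) × Fin (n i) =>
      Data.pair (e q.1) (Data.pair (encNat q.2.1) (encNat q.2.2)))
      (fun q => encBit (F q.1 q.2.1 q.2.2))) :
    PolyTime e (fun i => encVertexList (greedyWalk (F i) (u i) (n i))) := by
  obtain ⟨T, hT⟩ := hn.numNodes_le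
  refine iter n (fun i k => encVertexList (_root_.greedyWalk (F i) (u i) k)) (T * (T + 1)) hn
    (hu.cons (const e (encList []))) ?_ ?_
  · have hid := id fun j : Σ i, Fin (n i) =>
      Data.pair (e j.1) (encVertexList (_root_.greedyWalk (F j.1) (u j.1) j.2))
    have hn' := hid.fst.comp (hn.reindex fun j : Σ i, Fin (n i) => j.1)
    have hid' := id fun q : Σ j : Σ i, Fin (n i), Fin (n j.1) × Fin (n j.1) =>
      Data.pair (Data.pair (e q.1.1) (encVertexList (_root_.greedyWalk (F q.1.1) (u q.1.1) q.1.2)))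
        (Data.pair (encNat q.2.1) (encNat q.2.2))
    have hF' := (hid'.fst.fst.pair hid'.snd).comp
      (hF.reindex fun q : Σ j : Σ i, Fin (n i), Fin (n j.1) × Fin (n j.1) => ⟨q.1.1, q.2⟩)
    refine (greedyStep (F := fun j : Σ i, Fin (n i) => F j.1) hn' hid.snd
      (fun j => greedyWalk_ne_nil _ _ _) hF').congr fun j => ?_
    rw [greedyWalk_succ]
  · intro i k _
    have h1 : ∀ l : List (Fin (n i)), (encVertexList l).numNodes ≤ l.length * (n i + 1) := by
      intro l
      induction l with
      | nil => simp [encVertexList_eq, encList]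
      | cons a l ih =>
        have := a.2
        simp only [encVertexList_eq, List.map_cons, encList, numNodes_pair, numNodes_encNat,
          List.length_cons, add_mul] at ih ⊢
        omega
    have h2 := (greedyWalk_spec (F i) (u i) k).1.length_le_card
    have h3 := hT i
    rw [Fintype.card_fin] at h2
    rw [numNodes_encNat] at h3
    refine (h1 _).trans ((Nat.mul_le_mul (h2.trans h3) (Nat.succ_le_succ h3)).trans ?_)
    simp

end PolyTime

/-! ### The algorithm for Longest Path -/

namespace SubdivVertex

/-- The answer of an algorithm for Mutually Induced Packing, as a set of vertices of the
subdivided graph. -/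
def answer (sol : ∀ x : GraphWithSequence 4, Finset (Fin x.n)) {n : ℕ} (G : SimpleGraph (Fin n))
    (u v : Fin n) : Finset (SubdivVertex n) :=
  (sol (inst G u v)).map (equiv n).toEmbedding

/-- The paths that are found for all the pairs of possible ends. -/
noncomputable def candidates (sol : ∀ x : GraphWithSequence 4, Finset (Fin x.n)) {n : ℕ}
    (G : SimpleGraph (Fin n)) : List (List (Fin n)) :=
  (List.finRange n).flatMap fun u => (List.finRange n).map fun v =>
    greedyWalk (Used G (answer sol G u v)) u n

/-- No list of `L` is longer than `l`. -/
def IsLongest {α : Type} (L : List (List α)) (l : List α) : Prop :=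
  ¬ ∃ l' ∈ L, l.length < l'.length

open Classical in
/-- A longest one of the paths that are found for all the pairs of possible ends. -/
noncomputable def longestCandidate (sol : ∀ x : GraphWithSequence 4, Finset (Fin x.n)) {n : ℕ}
    (G : SimpleGraph (Fin n)) : List (Fin n) :=
  (((candidates sol G).filter fun l => IsLongest (candidates sol G) l).head?).getD []

variable {sol : ∀ x : GraphWithSequence 4, Finset (Fin x.n)}

theorem longestCandidate_spec {n : ℕ} (hn : 0 < n) (G : SimpleGraph (Fin n)) :
    longestCandidate sol G ∈ candidates sol G ∧
      ∀ l ∈ candidates sol G, l.length ≤ (longestCandidate sol G).length := by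
  classical
  have hne : (candidates sol G).toFinset.Nonempty := by
    refine ⟨_, List.mem_toFinset.2 (List.mem_flatMap.2 ⟨⟨0, hn⟩, List.mem_finRange _,
      List.mem_map.2 ⟨⟨0, hn⟩, List.mem_finRange _, rfl⟩⟩)⟩
  obtain ⟨l, hl, hmax⟩ := Finset.exists_max_image _ List.length hne
  have hmem : l ∈ (candidates sol G).filter fun l => IsLongest (candidates sol G) l :=
    List.mem_filter.2 ⟨List.mem_toFinset.1 hl, decide_eq_true fun ⟨l', hl', h⟩ =>
      h.not_ge (hmax l' (List.mem_toFinset.2 hl'))⟩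
  unfold longestCandidate
  rcases h : (candidates sol G).filter fun l => IsLongest (candidates sol G) l with _ | ⟨l', t⟩
  · rw [h] at hmem
    exact absurd hmem List.not_mem_nil
  · obtain ⟨h1, h2⟩ := List.mem_filter.1 (h ▸ List.mem_cons_self : l' ∈ (candidates sol G).filter
      fun l => IsLongest (candidates sol G) l)
    exact ⟨h1, fun l'' hl'' => not_lt.1 fun h3 => of_decide_eq_true h2 ⟨l'', hl'', h3⟩⟩

theorem mem_map_equiv {n : ℕ} (T : Finset (Fin (numNonspine n + n))) (y : SubdivVertex n) :
    (∃ h : idx y < numNonspine n + n, (⟨idx y, h⟩ : Fin (numNonspine n + n)) ∈ T) ↔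
      y ∈ T.map (equiv n).toEmbedding := by
  rw [Finset.mem_map_equiv]
  exact ⟨fun ⟨_, h⟩ => h, fun h => ⟨idx_lt y, h⟩⟩

theorem polyTime_longestCandidate
    (hsol : PolyTime (mutuallyInducedPacking decoratedPaths 4).encInst
      (fun x => encVertexSet (sol x))) :
    PolyTime longestPath.encInst
      (fun x : NonemptyGraph => encVertexList (longestCandidate sol x.graph)) := by
  classical
  let E : ∀ x : NonemptyGraph, Fin x.n → Data := fun _ u => encNat u
  let E' : ∀ q : Σ x : NonemptyGraph, Fin x.n, Fin q.1.n → Data := fun _ v => encNat v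
  have hG : PolyTime longestPath.encInst (fun x : NonemptyGraph => encGraph x.graph) :=
    PolyTime.id _
  have hn := hG.order
  have hG' := (hG.lift E).lift E'
  have hn' := (hn.lift E).lift E'
  have hu := (PolyTime.last longestPath.encInst E).lift E'
  have hv := PolyTime.last (fun q : Σ x : NonemptyGraph, Fin x.n =>
    Data.pair (longestPath.encInst q.1) (E q.1 q.2)) E'
  have hS := (polyTime_inst hG' hu hv).comp
    (hsol.reindex fun q : Σ q : Σ x : NonemptyGraph, Fin x.n, Fin q.1.n =>
      inst q.1.1.graph q.1.2 q.2)
  -- Edges that are used by the answer are recognized in polynomial time.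
  have hF : PolyTime (fun r : Σ q : Σ q : Σ x : NonemptyGraph, Fin x.n, Fin q.1.n,
      Fin q.1.1.n × Fin q.1.1.n =>
      Data.pair (Data.pair (Data.pair (longestPath.encInst r.1.1.1) (encNat r.1.1.2))
        (encNat r.1.2)) (Data.pair (encNat r.2.1) (encNat r.2.2)))
      (fun r => encBit (Used r.1.1.1.graph (answer sol r.1.1.1.graph r.1.1.2 r.1.2)
        r.2.1 r.2.2)) := by
    let E'' : ∀ q : Σ q : Σ x : NonemptyGraph, Fin x.n, Fin q.1.n,
      Fin q.1.1.n × Fin q.1.1.n → Data := fun _ p => Data.pair (encNat p.1) (encNat p.2)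
    have hG'' := hG'.lift E''
    have hn'' := hn'.lift E''
    have hS'' := hS.lift E''
    have hp := PolyTime.last (fun q : Σ q : Σ x : NonemptyGraph, Fin x.n, Fin q.1.n =>
      Data.pair (Data.pair (longestPath.encInst q.1.1) (encNat q.1.2)) (encNat q.2)) E''
    have ha := hp.fst
    have hb := hp.snd
    have c : PolyTime (fun r : Σ q : Σ q : Σ x : NonemptyGraph, Fin x.n, Fin q.1.n,
      Fin q.1.1.n × Fin q.1.1.n =>
      Data.pair (Data.pair (Data.pair (longestPath.encInst r.1.1.1) (encNat r.1.1.2))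
        (encNat r.1.2)) (E'' r.1 r.2)) (fun _ => encNat 0) := PolyTime.const _ _
    have h1 := PolyTime.mem_vertexSet hS'' (polyTime_idx hn'' (polyTime_enc
      (x := fun r : Σ q : Σ q : Σ x : NonemptyGraph, Fin x.n, Fin q.1.n,
        Fin q.1.1.n × Fin q.1.1.n => sub r.2.1 r.2.2 ⟨0, r.2.1.pos⟩) c ha hb c))
    have h2 := PolyTime.mem_vertexSet hS'' (polyTime_idx hn'' (polyTime_enc
      (x := fun r : Σ q : Σ q : Σ x : NonemptyGraph, Fin x.n, Fin q.1.n,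
        Fin q.1.1.n × Fin q.1.1.n => sub r.2.2 r.2.1 ⟨0, r.2.1.pos⟩) c hb ha c))
    refine ((hG''.adj ha hb).and (h1.or h2)).bit_congr fun r => ?_
    rw [Used]
    refine and_congr ?_ (or_congr (mem_map_equiv _ _) (mem_map_equiv _ _))
    exact ⟨fun ⟨_, _, h⟩ => h, fun h => ⟨r.2.1.2, r.2.2.2, h⟩⟩
  have hwalk := PolyTime.greedyWalk (F := fun (q : Σ q : Σ x : NonemptyGraph, Fin x.n, Fin q.1.n) =>
    Used q.1.1.graph (answer sol q.1.1.graph q.1.2 q.2)) hn' hu hF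
  have hcand : PolyTime longestPath.encInst
      (fun x : NonemptyGraph => encList ((candidates sol x.graph).map encVertexList)) := by
    refine (PolyTime.flatMap (enc := E)
      (g := fun (x : NonemptyGraph) u => (List.finRange x.n).map fun v =>
        encVertexList (greedyWalk (Used x.graph (answer sol x.graph u v)) u x.n)) hn.range
      (PolyTime.map (g := fun (q : Σ x : NonemptyGraph, Fin x.n) v => encVertexList
        (greedyWalk (Used q.1.graph (answer sol q.1.graph q.2 v)) q.2 q.1.n))
        (enc := E') (hn.lift E).range hwalk)).congr fun x => ?_
    simp [candidates, List.map_flatMap, Function.comp_def]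
  let D : ∀ x : NonemptyGraph, List (Fin x.n) → Data := fun _ l => encVertexList l
  let D' : ∀ q : Σ x : NonemptyGraph, List (Fin x.n), List (Fin q.1.n) → Data :=
    fun _ l => encVertexList l
  have hlen : PolyTime (fun q : Σ x : NonemptyGraph, List (Fin x.n) =>
      Data.pair (longestPath.encInst q.1) (D q.1 q.2)) (fun q => encNat q.2.length) :=
    (PolyTime.length (PolyTime.last longestPath.encInst D)).congr fun q => by simp
  have hlen' : PolyTime (fun q : Σ q : Σ x : NonemptyGraph, List (Fin x.n), List (Fin q.1.n) =>
      Data.pair (Data.pair (longestPath.encInst q.1.1) (D q.1.1 q.1.2)) (D' q.1 q.2))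
      (fun q => encNat q.2.length) :=
    (PolyTime.length (PolyTime.last (fun q : Σ x : NonemptyGraph, List (Fin x.n) =>
      Data.pair (longestPath.encInst q.1) (D q.1 q.2)) D')).congr fun q => by simp
  have hbest := PolyTime.filter (enc := D)
    (P := fun (x : NonemptyGraph) l => IsLongest (candidates sol x.graph) l)
    hcand (PolyTime.exists_mem (enc := D') (hcand.lift D) ((hlen.lift D').lt hlen')).not
  refine hbest.left.congr fun x => ?_
  rw [longestCandidate]
  cases (candidates sol x.graph).filter fun l => IsLongest (candidates sol x.graph) l with
  | nil => rfl
  | cons l t => rfl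

end SubdivVertex

/-! ### The approximation ratio -/

theorem SimpleGraph.exists_longest_path {n : ℕ} (hn : 0 < n) (G : SimpleGraph (Fin n)) :
    ∃ y : Σ (u : Fin n) (v : Fin n), G.Walk u v, y.2.2.IsPath ∧
      ∀ z : Σ (u : Fin n) (v : Fin n), G.Walk u v, z.2.2.IsPath → z.2.2.length ≤ y.2.2.length := by
  let s : Set ℕ := {k | ∃ y : Σ (u : Fin n) (v : Fin n), G.Walk u v,
    y.2.2.IsPath ∧ y.2.2.length = k}
  have hne : s.Nonempty := ⟨0, ⟨⟨0, hn⟩, ⟨0, hn⟩, .nil⟩, .nil, rfl⟩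
  have hbdd : BddAbove s := by
    refine ⟨n, ?_⟩
    rintro _ ⟨y, hy, rfl⟩
    simpa using hy.length_lt.le
  obtain ⟨y, hy, h⟩ := Nat.sSup_mem hne hbdd
  exact ⟨y, hy, fun z hz => h ▸ le_csSup hbdd ⟨z, hz, rfl⟩⟩

namespace SubdivVertex

variable {sol : ∀ x : GraphWithSequence 4, Finset (Fin x.n)}

theorem exists_path_of_mem_candidates {n : ℕ} {G : SimpleGraph (Fin n)} {l : List (Fin n)}
    (hl : l ∈ candidates sol G) :
    ∃ y : Σ (u : Fin n) (v : Fin n), G.Walk u v, y.2.2.IsPath ∧ y.2.2.support = l := by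
  obtain ⟨u, -, hl⟩ := List.mem_flatMap.1 hl
  obtain ⟨v, -, rfl⟩ := List.mem_map.1 hl
  obtain ⟨h1, h2, -, -⟩ := greedyWalk_spec (Used G (answer sol G u v)) u n
  have hne := greedyWalk_ne_nil (Used G (answer sol G u v)) u n
  refine ⟨⟨_, _, SimpleGraph.Walk.ofSupport _ hne (h2.imp fun a b h => h.1.symm)⟩, .mk' ?_, ?_⟩
  · rwa [SimpleGraph.Walk.support_ofSupport]
  · rw [SimpleGraph.Walk.support_ofSupport]

/-- A path of length `L` from `u` to `v` yields a feasible solution with more than `L * (n + 1)`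
vertices, and from a feasible solution with `s > 0` vertices the greedy walk finds a path with at
least `s / (6 * (n + 1))` edges. -/
theorem length_le_of_ratio {n : ℕ} {G : SimpleGraph (Fin n)} {u v : Fin n} (huv : u ≠ v)
    {p : G.Walk u v} (hp : p.IsPath) {r : ℝ}
    (hfeas : IsMutuallyInducedPacking decoratedPaths (inst G u v).graph (sol (inst G u v)))
    (hopt : ∀ S : Finset (Fin (inst G u v).n),
      IsMutuallyInducedPacking decoratedPaths (inst G u v).graph S →
      (S.card : ℝ) ≤ r * (sol (inst G u v)).card) :
    (p.length : ℝ) ≤ r * 6 *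
      ((greedyWalk (Used G (answer sol G u v)) u n).length - 1 : ℕ) := by
  obtain ⟨S, hS, hcard⟩ := exists_packing_of_path (G := G) (x := p.getVert) (L := p.length)
    (fun c hc c' hc' h => hp.getVert_injOn hc hc' h) (fun c hc => p.adj_getVert_succ hc)
  rw [p.getVert_zero, p.getVert_length] at hS
  have h1 := hopt _ (hS.comap (equiv n))
  have hcard_map : (S.map (equiv n).symm.toEmbedding).card = _ := (Finset.card_map _).trans hcard
  replace h1 := (congrArg Nat.cast hcard_map).symm.trans_le h1
  have hcard' : (answer sol G u v).card = (sol (inst G u v)).card := Finset.card_map _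
  have hne : (answer sol G u v).Nonempty := by
    rw [← Finset.card_pos, hcard', Nat.pos_iff_ne_zero]
    intro h0
    rw [h0] at h1
    push_cast at h1
    have : (0 : ℝ) ≤ p.length * (n + 1) := by positivity
    linarith
  have hA : IsMutuallyInducedPacking decoratedPaths (graph G u v) (answer sol G u v) := by
    have hG : (inst G u v).graph.comap (equiv n).symm = graph G u v := by
      ext x y
      simp [inst, finGraph]
    exact hG ▸ hfeas.comap (equiv n).symm
  have hD := isDecorated_of_packing huv hne hA
  have h2 := hD.card_le
  have h3 := hD.two_le_length_greedyWalk huv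
  rw [hcard'] at h2
  generalize (greedyWalk (Used G (answer sol G u v)) u n).length = len at h2 h3 ⊢
  obtain ⟨k, rfl⟩ : ∃ k, len = k + 2 := ⟨len - 2, by omega⟩
  have h4 : (sol (inst G u v)).card ≤ 6 * (k + 1) * (n + 1) := h2.trans (by nlinarith)
  have h5 : ((sol (inst G u v)).card : ℝ) ≤ 6 * (k + 1) * (n + 1) := by exact_mod_cast h4
  have hpos : (0 : ℝ) < (sol (inst G u v)).card := by
    rw [← hcard']
    exact_mod_cast hne.card_pos
  have hr : 0 ≤ r := by
    by_contra hr
    have h6 := mul_neg_of_neg_of_pos (not_le.1 hr) hpos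
    have : (0 : ℝ) ≤ ((p.length * (n + 1) + 5 : ℕ) : ℝ) := Nat.cast_nonneg _
    linarith
  have h6 := h1.trans (mul_le_mul_of_nonneg_left h5 hr)
  push_cast at h6
  have h7 : (p.length : ℝ) * (n + 1) ≤ r * 6 * (k + 1) * (n + 1) := by linarith
  have h8 := le_of_mul_le_mul_right h7 (by positivity)
  simpa using h8

theorem numNonspine_add_le {n : ℕ} (hn : 2 ≤ n) : numNonspine n + n ≤ n ^ 5 := by
  have h1 : 4 * (n * n * n) ≤ n ^ 5 := by
    have : 2 * 2 * (n * n * n) ≤ n * n * (n * n * n) := by gcongr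
    calc 4 * (n * n * n) = 2 * 2 * (n * n * n) := by ring
      _ ≤ n * n * (n * n * n) := this
      _ = n ^ 5 := by ring
  have h2 : 2 * 2 * n ≤ n * n * n := by gcongr
  rw [numNonspine]
  omega

/-- If the graph is so large that `n ^ (ε / 2) ≥ 6` then an `N ^ (ε / 10)`-approximation for
packings, where `N ≤ n ^ 5` is the order of the subdivided graph, yields an `n ^ ε`-approximation
for paths. -/
theorem length_le_longestCandidate {ε : ℝ} (hε : 0 < ε)
    (hfeas : ∀ x, IsMutuallyInducedPacking decoratedPaths x.graph (sol x))
    (hopt : ∀ x : GraphWithSequence 4, ∀ S : Finset (Fin x.n),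
      IsMutuallyInducedPacking decoratedPaths x.graph S →
      (S.card : ℝ) ≤ (x.n : ℝ) ^ (ε / 10) * (sol x).card)
    {n : ℕ} (hn : 2 ≤ n) (hn6 : 6 ≤ (n : ℝ) ^ (ε / 2)) {G : SimpleGraph (Fin n)} {u v : Fin n}
    {p : G.Walk u v} (hp : p.IsPath) :
    (p.length : ℝ) ≤ (n : ℝ) ^ ε * ((longestCandidate sol G).length - 1 : ℕ) := by
  have hn0 : (0 : ℝ) < n := by positivity
  by_cases huv : u = v
  · subst huv
    rw [(SimpleGraph.Walk.isPath_iff_nil.1 hp).length_eq_zero, Nat.cast_zero]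
    positivity
  have h1 := length_le_of_ratio huv hp (hfeas _) (hopt _)
  have h2 : ((inst G u v).n : ℝ) ^ (ε / 10) ≤ (n : ℝ) ^ (ε / 2) := by
    have h3 : ((inst G u v).n : ℝ) ≤ (n : ℝ) ^ (5 : ℕ) := by
      exact_mod_cast numNonspine_add_le hn
    calc ((inst G u v).n : ℝ) ^ (ε / 10) ≤ ((n : ℝ) ^ (5 : ℕ)) ^ (ε / 10) :=
          Real.rpow_le_rpow (Nat.cast_nonneg _) h3 (by positivity)
      _ = (n : ℝ) ^ (ε / 2) := by
          rw [← Real.rpow_natCast, ← Real.rpow_mul hn0.le]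
          congr 1
          push_cast
          ring
  have h4 : (greedyWalk (Used G (answer sol G u v)) u n).length - 1 ≤
      (longestCandidate sol G).length - 1 :=
    Nat.sub_le_sub_right ((longestCandidate_spec (by omega) G).2 _ (List.mem_flatMap.2
      ⟨u, List.mem_finRange _, List.mem_map.2 ⟨v, List.mem_finRange _, rfl⟩⟩)) 1
  calc (p.length : ℝ) ≤ _ := h1
    _ ≤ (n : ℝ) ^ (ε / 2) * (n : ℝ) ^ (ε / 2) * ((longestCandidate sol G).length - 1 : ℕ) := by
        gcongr
    _ = (n : ℝ) ^ ε * ((longestCandidate sol G).length - 1 : ℕ) := by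
        rw [← Real.rpow_add hn0, add_halves]

end SubdivVertex

theorem exists_six_le_rpow {ε : ℝ} (hε : 0 < ε) : ∃ n₀ : ℕ, ∀ n, n₀ < n → 6 ≤ (n : ℝ) ^ ε := by
  obtain ⟨n₀, h⟩ := ((tendsto_rpow_atTop hε).comp tendsto_natCast_atTop_atTop).eventually_ge_atTop 6
    |>.exists_forall_of_atTop
  exact ⟨n₀, fun n hn => h n hn.le⟩

/-! ### Small graphs -/

theorem iff_of_encBit_eq {P Q : Prop} (h : encBit P = encBit Q) : P ↔ Q := by
  by_cases hP : P <;> by_cases hQ : Q <;> simp_all [encBit, Data.pair]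

theorem encList_injective : Function.Injective encList := by
  intro l
  induction l with
  | nil =>
    rintro (_ | ⟨b, l'⟩) h
    · rfl
    · simp [encList, Data.pair] at h
  | cons a l ih =>
    rintro (_ | ⟨b, l'⟩) h
    · simp [encList, Data.pair] at h
    · simp only [encList, Data.pair, BinaryTree.node.injEq, true_and] at h
      rw [h.1, ih h.2]

theorem encGraph_injective :
    Function.Injective fun x : NonemptyGraph => encGraph x.graph := by
  rintro ⟨n, hn, G⟩ ⟨n', hn', G'⟩ h
  have h1 := encList_injective h
  obtain rfl : n = n' := by simpa using congrArg List.length h1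
  congr 1
  ext i j
  have h2 := encList_injective (congrFun (List.ofFn_injective h1) i)
  exact iff_of_encBit_eq (congrFun (List.ofFn_injective h2) j)

theorem finite_nonemptyGraph_le (n₀ : ℕ) : Finite {x : NonemptyGraph // ¬ n₀ < x.n} := by
  refine Finite.of_injective (β := Σ k : Fin (n₀ + 1), SimpleGraph (Fin k))
    (fun x => ⟨⟨x.1.n, by have := x.2; omega⟩, x.1.graph⟩) ?_
  rintro ⟨⟨n, hn, G⟩, h⟩ ⟨⟨n', hn', G'⟩, h'⟩ heq
  simp only [Sigma.mk.injEq, Fin.mk.injEq] at heq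
  obtain ⟨rfl, heq⟩ := heq
  simpa using heq

/-! ### The reduction -/

/-- An approximation algorithm, as a map with solutions as values that is computable in the sense of
`PolyTime`, provided that all candidate solutions have polynomial size. -/
theorem PolyTime.of_approx {Q : MaxProblem} {r : ℕ → ℝ} (h : Q.HasPolyTimeApprox r)
    {T : Polynomial ℕ} (hT : ∀ x y, (Q.encSol x y).numNodes ≤ T.eval (Q.encInst x).numNodes) :
    ∃ sol : ∀ x, Q.Sol x, PolyTime Q.encInst (fun x => Q.encSol x (sol x)) ∧
      ∀ x, Q.Feasible x (sol x) ∧ ∀ z : Q.Sol x, Q.Feasible x z →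
        (Q.value x z : ℝ) ≤ r (Q.order x) * (Q.value x (sol x) : ℝ) := by
  obtain ⟨p, S, hp⟩ := h
  choose sol t h1 h2 h3 h4 using hp
  refine ⟨sol, ⟨p, S + T, fun x => ⟨⟨t x, h1 x, (h2 x).trans ?_⟩, (hT x _).trans ?_⟩⟩,
    fun x => ⟨h3 x, h4 x⟩⟩ <;> simp

theorem PolyTime.hasPolyTimeApprox {Q : MaxProblem} {r : ℕ → ℝ} {sol : ∀ x, Q.Sol x}
    (h : PolyTime Q.encInst (fun x => Q.encSol x (sol x)))
    (h' : ∀ x, Q.Feasible x (sol x) ∧ ∀ z : Q.Sol x, Q.Feasible x z →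
        (Q.value x z : ℝ) ≤ r (Q.order x) * (Q.value x (sol x) : ℝ)) :
    Q.HasPolyTimeApprox r := by
  obtain ⟨p, T, hp⟩ := h
  exact ⟨p, T, fun x => (hp x).1.elim fun t ht => ⟨sol x, t, ht.1, ht.2, h' x⟩⟩

theorem numNodes_encVertexSet_le {n : ℕ} (S : Finset (Fin n)) :
    (encVertexSet S).numNodes ≤ 2 * n := by
  have h : ∀ l : List (Fin n),
      (encList (l.map fun i => encBit (i ∈ S))).numNodes ≤ 2 * l.length := by
    intro l
    induction l with
    | nil => simp [encList]
    | cons a l ih =>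
      have : (encBit (a ∈ S)).numNodes ≤ 1 := by
        unfold encBit
        split_ifs <;> simp [Data.pair, BinaryTree.numNodes]
      simp only [List.map_cons, encList, numNodes_pair, List.length_cons]
      omega
  simpa [encVertexSet, List.ofFn_eq_map] using h (List.finRange n)

theorem mainTheorem10
    (h : ∀ ε : ℝ, 0 < ε →
      (mutuallyInducedPacking decoratedPaths 4).HasPolyTimeApprox (fun n => (n : ℝ) ^ ε)) :
    ∀ ε : ℝ, 0 < ε → longestPath.HasPolyTimeApprox (fun n => (n : ℝ) ^ ε) := by
  intro ε hε
  obtain ⟨sol, hsol, hspec⟩ := PolyTime.of_approx (h (ε / 10) (by positivity))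
    (T := 2 * Polynomial.X) fun (x : GraphWithSequence 4) (S : Finset (Fin x.n)) => by
      have h1 := PolyTime.length_le_numNodes_encList
        (List.ofFn fun i => encList (List.ofFn fun j => encBit (x.graph.Adj i j)))
      rw [List.length_ofFn] at h1
      have h2 : (mutuallyInducedPacking decoratedPaths 4).encInst x =
        Data.pair (encGraph x.graph) (encPairList x.contractions) := rfl
      have h3 := numNodes_encVertexSet_le S
      rw [h2, numNodes_pair]
      simp only [Polynomial.eval_mul, Polynomial.eval_ofNat, Polynomial.eval_X]
      change (encVertexSet S).numNodes ≤ _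
      change x.n ≤ (encGraph x.graph).numNodes at h1
      omega
  obtain ⟨n₀, hn₀⟩ := exists_six_le_rpow (half_pos hε)
  -- For `n ≥ 2` the order of the subdivided graph is at most `n ^ 5`.
  let n₁ := max 1 n₀
  -- On the finitely many graphs with at most `n₁` vertices, an optimal path is taken from a table.
  have key : ∀ x : NonemptyGraph, ∃ y : longestPath.Sol x, (longestPath.Feasible x y ∧
      ∀ z : longestPath.Sol x, longestPath.Feasible x z → (longestPath.value x z : ℝ) ≤
        (longestPath.order x : ℝ) ^ ε * (longestPath.value x y : ℝ)) ∧
      (n₁ < x.n → y.2.2.support = SubdivVertex.longestCandidate sol x.graph) := by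
    intro x
    by_cases hx : n₁ < x.n
    · obtain ⟨h1, h2⟩ := max_lt_iff.1 hx
      obtain ⟨y, hy, hys⟩ := SubdivVertex.exists_path_of_mem_candidates
        (SubdivVertex.longestCandidate_spec (sol := sol) x.pos x.graph).1
      refine ⟨y, ⟨hy, fun z hz => ?_⟩, fun _ => hys⟩
      have h3 := SubdivVertex.length_le_longestCandidate hε (fun x => (hspec x).1)
        (fun x => (hspec x).2) h1 (hn₀ _ h2) (G := x.graph) (p := z.2.2) hz
      rwa [← hys, SimpleGraph.Walk.length_support, Nat.add_sub_cancel] at h3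
    · obtain ⟨y, hy, hmax⟩ := x.graph.exists_longest_path x.pos
      refine ⟨y, ⟨hy, fun z hz => ?_⟩, fun h => absurd h hx⟩
      have h1 : (z.2.2.length : ℝ) ≤ y.2.2.length := by exact_mod_cast hmax z hz
      have h2 : (1 : ℝ) ≤ (x.n : ℝ) ^ ε :=
        Real.one_le_rpow (by exact_mod_cast x.pos) hε.le
      exact h1.trans (le_mul_of_one_le_left (Nat.cast_nonneg _) h2)
  choose y hy hlarge using key
  refine PolyTime.hasPolyTimeApprox (sol := y) ?_ hy
  have hlt : PolyTime longestPath.encInst (fun x : NonemptyGraph => encBit (n₁ < x.n)) :=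
    (PolyTime.const _ (encNat n₁)).lt
      (PolyTime.order (G := fun x : NonemptyGraph => x.graph) (PolyTime.id longestPath.encInst))
  have hinj := encGraph_injective
  have hfin := finite_nonemptyGraph_le n₁
  refine PolyTime.cases_on (P := fun x : NonemptyGraph => n₁ < x.n) hlt
    (fun x => PolyTime.encBit_ne_nil) ?_ ?_
  · refine ((SubdivVertex.polyTime_longestCandidate hsol).reindex
      (fun x : {x : NonemptyGraph // n₁ < x.n} => x.1)).congr fun x => ?_
    exact congrArg encVertexList (hlarge x.1 x.2).symm
  · exact PolyTime.of_finite (fun a b hab => Subtype.ext (hinj hab)) _
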